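/- **Theorem (Duality between homology and cohomology).** Let $X$ be a topological space. Let $D(X)$ be the unbounded derived category of sheaves of abelian groups on $X$ and $D(\mathbb Z)$ the unbounded derived category of abelian groups. Let $\pi_X^{-1}\colon D(\mathbb Z)\to D(X)$ be the functor induced by $G\mapsto$ the constant sheaf with stalk $G$, and assume that $\pi_X^{-1}$ has a left adjoint $\mathbb L(X,-)\colon D(X)\to D(\mathbb Z)$. For $F\in D(X)$ and $i\in\mathbb Z$ put $H_i(X,F):=H^{-i}(\mathbb L(X,F))$ and $H^i(X,F):=H^i(\mathbb R\Gamma(X,F))$. Let $\mathbb R\mathrm{Hom}^\bullet$ be the derived complex of homomorphisms of $D(\mathbb Z)$ and $\mathbb R\mathcal{H}om^\bullet$ the derived complex of sheaves of homomorphisms of $D(X)$. For $F\in D(X)$ put $F^\vee:=\mathbb R\mathcal{H}om^\bullet(F,\pi_X^{-1}\mathbb Z)$, and for $K\in D(\mathbb Z)$ put $K^\vee:=\mathbb R\mathrm{Hom}^\bullet(K,\mathbb Z)$. For an abelian group $G$ write $H^i(X,G):=H^i(X,\pi_X^{-1}G)$ and $H_i(X,G):=H_i(X,\pi_X^{-1}G)$.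 1. There are isomorphisms in $D(\mathbb Z)$, natural in $F\in D(X)$ and $G\in D(\mathbb Z)$, $$\mathbb R\mathrm{Hom}^\bullet(\mathbb L(X,F),G)\;\cong\;\mathbb R\Gamma\bigl(X,\mathbb R\mathcal{H}om^\bullet(F,\pi_X^{-1}G)\bigr).$$ 2. In particular, there are isomorphisms $\mathbb R\mathrm{Hom}^\bullet(\mathbb L(X,\pi_X^{-1}\mathbb Z),G)\cong\mathbb R\Gamma(X,\pi_X^{-1}G)$, natural in $G\in D(\mathbb Z)$, and $\mathbb L(X,F)^\vee\cong\mathbb R\Gamma(X,F^\vee)$, natural in $F\in D(X)$. 3. For every $i\in\mathbb Z$ there are short exact sequences $$0\to \mathrm{Ext}^1_{\mathbb Z}(H_{i-1}(X,F),\mathbb Z)\to H^i(X,F^\vee)\to \mathrm{Hom}_{\mathbb Z}(H_i(X,F),\mathbb Z)\to 0$$ whose maps are natural in $F\in D(X)$; each of them splits (not necessarily naturally in $F$). 4. $X$ is cohomologically trivial, i.e. $H^i(X,G)=0$ for all $i>0$ and all abelian groups $G$, if and only if $H_i(X,\mathbb Z)=0$ for all $i>0$. -/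

import Mathlib

universe w v u
open CategoryTheory Limits
open scoped ZeroObject
set_option linter.unusedSectionVars false
namespace CochainComplex

variable {C : Type u} [Category.{w} C] [Abelian C]

/-- Monomorphisms of complexes which are quasi-isomorphisms. -/
def trivCof (C : Type u) [Category.{w} C] [Abelian C] :
    MorphismProperty (CochainComplex C ℤ) :=
  MorphismProperty.monomorphisms _ ⊓ HomologicalComplex.quasiIso C (ComplexShape.up ℤ)

open HomComplex in
lemma trivCof_lifting {A B X Y : CochainComplex C ℤ} (i : A ⟶ B) (p : X ⟶ Y)
    (hi : trivCof C i) (hp : degreewiseEpiWithInjectiveKernel p) (d : ℤ) [X.IsStrictlyGE d] :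
    HasLiftingProperty i p where
  sq_hasLift {t b} sq := by
    have : Mono i := hi.1
    have : QuasiIso i := hi.2
    have sq' (n : ℤ) : CommSq (t.f n) (i.f n) (p.f n) (b.f n) :=
      (sq.map (HomologicalComplex.eval _ _ n))
    have (n : ℤ) : (sq' n).HasLift := by
      have := (hp n).hasLiftingProperty (i.f n)
      infer_instance
    let β : Cocycle (cokernel i) (kernel p) 1 :=
      Lifting.cocycle₁ sq (fun n ↦ { l := (sq' n).lift, fac_left := (sq' n).fac_left, fac_right := (sq' n).fac_right })
        (cokernelIsCokernel i) (kernelIsKernel p) (hπ := by simp) (hι := by simp)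
    have (n : ℤ) : Injective ((kernel p).X n) :=
      Injective.of_iso
        (asIso (kernelComparison p (HomologicalComplex.eval _ _ n))).symm (hp n).2
    have : (kernel p).IsKInjective := by
      have : (kernel p).IsStrictlyGE d := by
        rw [isStrictlyGE_iff]
        intro i hi
        rw [IsZero.iff_id_eq_zero, ← cancel_mono ((kernel.ι p).f i)]
        apply (X.isZero_of_isStrictlyGE d i).eq_of_tgt
      exact isKInjective_of_injective _ d
    obtain ⟨α, hα⟩ : ∃ (α : Cochain (cokernel i) (kernel p) 0), δ 0 1 α = β.1 := by
      refine IsKInjective.eq_δ_of_cocycle β ?_ 0 (by simp)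
      have : (ShortComplex.mk _ _ (cokernel.condition i)).ShortExact :=
        { exact := ShortComplex.exact_cokernel i }
      exact this.acyclic_X₃ (by dsimp; infer_instance)
    exact Lifting.hasLift sq _ (cokernelIsCokernel _) (kernelIsKernel _) α hα

/-- The test class. -/
def testMaps (C : Type u) [Category.{w} C] [Abelian C] :
    MorphismProperty (CochainComplex C ℤ) := fun X Y p =>
  (Injective X ∧ IsZero Y) ∨ (degreewiseEpiWithInjectiveKernel p ∧ ∃ d, X.IsStrictlyGE d)

lemma testMaps_le : testMaps C ≤ (trivCof C).rlp := by
  rintro X Y p (⟨h, h'⟩ | ⟨h, d, hd⟩) A B i hi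
  · have : Mono i := hi.1
    exact ⟨fun {t b} sq => ⟨⟨{ l := Injective.factorThru t i, fac_right := h'.eq_of_tgt _ _ }⟩⟩⟩
  · exact trivCof_lifting i p hi h d

lemma quasiIso_of_acyclic_X₃ {S : ShortComplex (CochainComplex C ℤ)} (hS : S.ShortExact)
    (h : S.X₃.Acyclic) : QuasiIso S.f where
  quasiIsoAt n := by
    have h' (m : ℤ) := (HomologicalComplex.exactAt_iff_isZero_homology _ _).1 (h m)
    rw [quasiIsoAt_iff_isIso_homologyMap]
    have h1 : Mono (HomologicalComplex.homologyMap S.f n) :=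
      (hS.homology_exact₁ (n - 1) n (by simp)).mono_g ((h' _).eq_of_src _ _)
    have h2 : Epi (HomologicalComplex.homologyMap S.f n) :=
      (hS.homology_exact₂ n).epi_f ((h' _).eq_of_tgt _ _)
    exact isIso_of_mono_of_epi _

lemma trivCof_iff {A B : CochainComplex C ℤ} (i : A ⟶ B) :
    trivCof C i ↔ Mono i ∧ (cokernel i).Acyclic := by
  refine and_congr_right fun (h : Mono i) => ?_
  have hS : (ShortComplex.mk _ _ (cokernel.condition i)).ShortExact :=
    { exact := ShortComplex.exact_cokernel i }
  exact ⟨fun h => hS.acyclic_X₃ h, fun h => quasiIso_of_acyclic_X₃ hS h⟩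

lemma llp_testMaps_le [IsGrothendieckAbelian.{w} C] : (testMaps C).llp ≤ trivCof C := by
  intro A B i hi
  have hmono : Mono i := by
    have := hi (0 : Injective.under A ⟶ 0) (Or.inl ⟨inferInstance, isZero_zero _⟩)
    have sq : CommSq (Injective.ι A) i (0 : Injective.under A ⟶ 0) 0 := ⟨by simp⟩
    have h := sq.fac_left
    have : Mono (i ≫ sq.lift) := by rw [h]; infer_instance
    exact mono_of_mono i sq.lift
  rw [trivCof_iff]
  refine ⟨hmono, ?_⟩
  set Q := cokernel i with hQ
  intro n
  rw [HomologicalComplex.exactAt_iff_isZero_homology]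
  let I := Injective.under (Q.homology n)
  let S := (HomologicalComplex.single C (ComplexShape.up ℤ) n).obj I
  let φ₀ : Q.opcycles n ⟶ I := Injective.factorThru (Injective.ι _) (Q.homologyι n)
  have hφ₀ : Q.homologyι n ≫ φ₀ = Injective.ι _ := Injective.comp_factorThru _ _
  let φ : Q ⟶ S := HomologicalComplex.mkHomToSingle (Q.pOpcycles n ≫ φ₀) (by simp)
  obtain ⟨P, _, ι, p, _, _, hp, fac⟩ :=
    Plus.modelCategoryQuillen.cm5a (0 : (0 : CochainComplex C ℤ) ⟶ S) n
  have hP : IsZero (P.homology n) := by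
    have h0 : IsZero ((0 : CochainComplex C ℤ).homology n) :=
      (HomologicalComplex.homologyFunctor C (ComplexShape.up ℤ) n).map_isZero (isZero_zero _)
    exact h0.of_iso (asIso (HomologicalComplex.homologyMap ι n)).symm
  have := hi p (Or.inr ⟨hp, n, inferInstance⟩)
  have sq : CommSq (0 : A ⟶ P) i p (cokernel.π i ≫ φ) := ⟨by simp⟩
  let l : Q ⟶ P := cokernel.desc i sq.lift sq.fac_left
  have hl : l ≫ p = φ := by
    rw [← cancel_epi (cokernel.π i)]
    simp only [l]
    rw [cokernel.π_desc_assoc]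
    exact sq.fac_right
  have hφ : HomologicalComplex.homologyMap φ n = 0 := by
    rw [← hl, HomologicalComplex.homologyMap_comp, hP.eq_of_tgt (HomologicalComplex.homologyMap l n) 0,
      zero_comp]
  have hz : Q.homologyι n ≫ φ₀ = 0 := by
    have h1 := HomologicalComplex.homologyι_naturality φ n
    rw [hφ, zero_comp] at h1
    have h2 : HomologicalComplex.opcyclesMap φ n ≫
        (HomologicalComplex.singleObjOpcyclesSelfIso (ComplexShape.up ℤ) n I).inv = φ₀ := by
      rw [← cancel_epi (Q.pOpcycles n)]
      simp [φ, S]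
    rw [← h2, ← Category.assoc, ← h1, zero_comp]
  rw [hφ₀] at hz
  rw [IsZero.iff_id_eq_zero, ← cancel_mono (Injective.ι (Q.homology n)), hz]
  simp

end CochainComplex

namespace CochainComplex

variable {C : Type u} [Category.{w} C] [Abelian C] [IsGrothendieckAbelian.{w} C]

instance : (trivCof C).RespectsIso := by
  rw [show trivCof C = (testMaps C).llp from
    le_antisymm (fun _ _ _ hf _ _ _ hp => testMaps_le _ hp _ hf) llp_testMaps_le]
  infer_instance

instance : IsGrothendieckAbelian.{w} (CochainComplex C ℤ) :=
  inferInstanceAs (IsGrothendieckAbelian.{w} (HomologicalComplex C (ComplexShape.up ℤ)))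

lemma llp_rlp_le_trivCof {J : MorphismProperty (CochainComplex C ℤ)} (hJ : J ≤ trivCof C) :
    J.rlp.llp ≤ trivCof C :=
  (MorphismProperty.antitone_llp
    (testMaps_le.trans (MorphismProperty.antitone_rlp hJ))).trans llp_testMaps_le

/-- A family of trivial cofibrations which suffices to build all of them. -/
structure GeneratesTrivCof (J : MorphismProperty (CochainComplex C ℤ)) : Prop where
  le : J ≤ trivCof C
  iso : MorphismProperty.isomorphisms _ ≤ J.pushouts
  fac {A X : CochainComplex C ℤ} (i : A ⟶ X) : trivCof C i → ¬ IsIso i →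
    ∃ (A' : CochainComplex C ℤ) (j : A ⟶ A') (p : A' ⟶ X),
      J.pushouts j ∧ ¬ IsIso j ∧ Mono p ∧ j ≫ p = i

namespace GeneratesTrivCof

variable {J : MorphismProperty (CochainComplex C ℤ)}

lemma exists_larger (hJ : GeneratesTrivCof J) {X : CochainComplex C ℤ}
    (A : Subobject X) (hW : trivCof C A.arrow) (hA : A ≠ ⊤) :
    ∃ (A' : Subobject X) (h : A < A'), J.pushouts (Subobject.ofLE A A' h.le) := by
  induction A using Subobject.ind with | _ f
  have hf : trivCof C f := (MorphismProperty.arrow_mk_iso_iff (trivCof C)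
      (Arrow.isoMk (Subobject.underlyingIso f) (Iso.refl X)
        (by simp : (Subobject.underlyingIso f).hom ≫ f = (Subobject.mk f).arrow ≫ 𝟙 X))).1 hW
  obtain ⟨X', i, p', hi, hi', hp', fac⟩ := hJ.fac f hf
    (by simpa only [Subobject.isIso_iff_mk_eq_top] using hA)
  refine ⟨Subobject.mk p', Subobject.mk_lt_mk_of_comm i fac hi',
    (MorphismProperty.arrow_mk_iso_iff _ ?_).2 hi⟩
  refine Arrow.isoMk (Subobject.underlyingIso f) (Subobject.underlyingIso p') ?_
  dsimp
  simp only [← cancel_mono p', Category.assoc, fac,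
    Subobject.underlyingIso_hom_comp_eq_mk, Subobject.ofLE_arrow]

variable (hJ : GeneratesTrivCof J) {X : CochainComplex C ℤ}

open scoped Classical in
/-- Enlarge a subobject. -/
noncomputable def larger (A : Subobject X) : Subobject X :=
  if h : trivCof C A.arrow ∧ A ≠ ⊤ then (hJ.exists_larger A h.1 h.2).choose else ⊤

lemma lt_larger (A : Subobject X) (hA : A ≠ ⊤) : A < hJ.larger A := by
  dsimp only [larger]
  split_ifs with h
  · exact (hJ.exists_larger A h.1 h.2).choose_spec.choose
  · exact lt_top_iff_ne_top.2 hA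

lemma larger_top : hJ.larger (⊤ : Subobject X) = ⊤ := dif_neg (by simp)

lemma le_larger (A : Subobject X) : A ≤ hJ.larger A := by
  by_cases hA : A = ⊤
  · rw [hA, larger_top]
  · exact (hJ.lt_larger A hA).le

lemma pushouts_larger (A : Subobject X) (hW : trivCof C A.arrow) :
    J.pushouts (Subobject.ofLE _ _ (hJ.le_larger A)) := by
  by_cases hA : A = ⊤
  · subst hA
    have := (Subobject.isIso_arrow_iff_eq_top (hJ.larger (⊤ : Subobject X))).2 (hJ.larger_top)
    have := (Subobject.isIso_arrow_iff_eq_top (⊤ : Subobject X)).2 rfl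
    exact (MorphismProperty.arrow_mk_iso_iff _
      (Arrow.isoMk (f := Arrow.mk (Subobject.ofLE _ _ (hJ.le_larger (⊤ : Subobject X))))
        (g := Arrow.mk (𝟙 X)) (asIso (Subobject.arrow (⊤ : Subobject X)))
        (asIso (Subobject.arrow (hJ.larger (⊤ : Subobject X)))) (by simp))).2
        (hJ.iso (𝟙 X) (MorphismProperty.isomorphisms.infer_property _))
  · refine (MorphismProperty.arrow_mk_iso_iff _ ?_).1
      (hJ.exists_larger A hW hA).choose_spec.choose_spec
    have e : (hJ.exists_larger A hW hA).choose = hJ.larger A := by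
      rw [larger, dif_pos ⟨hW, hA⟩]
    exact Arrow.isoMk (Iso.refl _) (Subobject.isoOfEq _ _ e)

section

variable (A₀ : Subobject X) (T : Type w) [LinearOrder T] [OrderBot T] [SuccOrder T]
  [WellFoundedLT T]

/-- The transfinite iteration as a functor. -/
noncomputable def functorToMonoOver : T ⥤ MonoOver X where
  obj j := MonoOver.mk (transfiniteIterate hJ.larger j A₀).arrow
  map {j j'} f := MonoOver.homMk (Subobject.ofLE _ _
      (monotone_transfiniteIterate _ _ (hJ.le_larger) (leOfHom f)))

/-- The transfinite iteration as a functor. -/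
noncomputable abbrev functor : T ⥤ CochainComplex C ℤ :=
  hJ.functorToMonoOver A₀ T ⋙ MonoOver.forget _ ⋙ Over.forget _

instance : (hJ.functor A₀ T).IsWellOrderContinuous where
  nonempty_isColimit m hm := ⟨by
    have := hm.nonempty_Iio.to_subtype
    let c := (Set.principalSegIio m).cocone (hJ.functorToMonoOver A₀ T ⋙ MonoOver.forget _)
    have : Mono c.pt.hom :=
      inferInstanceAs (Mono (transfiniteIterate hJ.larger m A₀).arrow)
    apply IsGrothendieckAbelian.isColimitMapCoconeOfSubobjectMkEqISup
      ((Set.principalSegIio m).monotone.functor ⋙ hJ.functorToMonoOver A₀ T) c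
    refine (Subobject.mk_arrow (transfiniteIterate hJ.larger m A₀)).trans
      ((transfiniteIterate_limit hJ.larger A₀ m hm).trans (iSup_congr fun j => ?_))
    exact (Subobject.mk_arrow (transfiniteIterate hJ.larger j.1 A₀)).symm⟩

variable {T}

lemma pushouts_succ (j : T) (hj : ¬ IsMax j)
    (hW : trivCof C (transfiniteIterate hJ.larger j A₀).arrow) (k : T) (hk : k = Order.succ j)
    (h : transfiniteIterate hJ.larger j A₀ ≤ transfiniteIterate hJ.larger k A₀) :
    J.pushouts (Subobject.ofLE _ _ h) := by
  subst hk
  refine (MorphismProperty.arrow_mk_iso_iff _ ?_).1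
    (hJ.pushouts_larger (transfiniteIterate hJ.larger j A₀) hW)
  have e := (transfiniteIterate_succ hJ.larger A₀ j hj).symm
  exact Arrow.isoMk (f := Arrow.mk (Subobject.ofLE _ _ (hJ.le_larger _)))
    (g := Arrow.mk (Subobject.ofLE _ _ h))
    (Iso.refl (Subobject.underlying.obj (transfiniteIterate hJ.larger j A₀)))
    (Subobject.isoOfEq _ _ e) (by simp [Subobject.isoOfEq])

/-- The transfinite composition. -/
noncomputable def tcomp (j : T)
    (hW : ∀ k < j, trivCof C (transfiniteIterate hJ.larger k A₀).arrow) :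
    J.pushouts.TransfiniteCompositionOfShape (Set.Iic j)
      ((hJ.functor A₀ T).map (homOfLE bot_le : ⊥ ⟶ j)) where
  F := (Set.initialSegIic j).monotone.functor ⋙ hJ.functor A₀ T
  isoBot := Iso.refl _
  incl :=
    { app k := (hJ.functor A₀ T).map (homOfLE k.2)
      naturality k k' h := by
        refine ((hJ.functor A₀ T).map_comp (homOfLE (leOfHom h) : k.1 ⟶ k'.1)
          (homOfLE k'.2)).symm.trans (Eq.trans ?_ (Category.comp_id _).symm)
        rfl }
  isColimit := colimitOfDiagramTerminal isTerminalTop _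
  fac := Category.id_comp _
  map_mem k hk := by
    have hk' : k.1 < j := by
      have : ¬ IsMax k := hk
      by_contra h
      exact this (fun b _ => Subtype.coe_le_coe.1 (b.2.trans (not_lt.1 h)))
    refine hJ.pushouts_succ A₀ k.1 (not_isMax_of_lt hk') (hW _ hk') _ ?_ _
    exact congrArg Subtype.val (Set.Iic.succ_eq_of_not_isMax hk)

lemma trivCof_arrow (h₀ : trivCof C A₀.arrow) (j : T) :
    trivCof C (transfiniteIterate hJ.larger j A₀).arrow := by
  induction j using WellFoundedLT.induction with
  | ind j ih =>
    have h := llp_rlp_le_trivCof hJ.le _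
      (by
      simpa using MorphismProperty.transfiniteCompositionsOfShape_le_llp_rlp J.pushouts _ _
        (hJ.tcomp A₀ j ih).mem)
    have : QuasiIso (transfiniteIterate hJ.larger (⊥ : T) A₀).arrow := by
      rw [transfiniteIterate_bot]
      exact h₀.2
    have h1 : QuasiIso ((hJ.functor A₀ T).map (homOfLE bot_le : ⊥ ⟶ j)) := h.2
    have h2 : (hJ.functor A₀ T).map (homOfLE bot_le : ⊥ ⟶ j) ≫
        (transfiniteIterate hJ.larger j A₀).arrow =
          (transfiniteIterate hJ.larger (⊥ : T) A₀).arrow :=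
      Subobject.ofLE_arrow _
    refine ⟨inferInstanceAs (Mono _), ?_⟩
    have h3 : QuasiIso ((hJ.functor A₀ T).map (homOfLE bot_le : ⊥ ⟶ j) ≫
        (transfiniteIterate hJ.larger j A₀).arrow) := h2.symm ▸ this
    exact @quasiIso_of_comp_left _ _ _ _ _ _ _ _ _ _ _ _ _ h1 h3

end

lemma trivCof_le (hJ : GeneratesTrivCof J) : trivCof C ≤ J.rlp.llp := by
  intro A X i hi
  have : Mono i := hi.1
  let κ := Order.succ (Cardinal.mk (Shrink.{w} (Subobject X)))
  have : Nonempty κ.ord.ToType := by simp [κ]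
  have := WellFoundedLT.toOrderBot κ.ord.ToType
  have hf : trivCof C (Subobject.mk i).arrow := (MorphismProperty.arrow_mk_iso_iff (trivCof C)
      (Arrow.isoMk (Subobject.underlyingIso i) (Iso.refl X)
        (by simp : (Subobject.underlyingIso i).hom ≫ i = (Subobject.mk i).arrow ≫ 𝟙 X))).2 hi
  obtain ⟨j, hj⟩ : ∃ j : κ.ord.ToType, transfiniteIterate hJ.larger j (Subobject.mk i) = ⊤ :=
    top_mem_range_transfiniteIterate hJ.larger _ hJ.lt_larger hJ.larger_top (fun h => by
      have hlt : HasCardinalLT (Subobject X) (Cardinal.mk κ.ord.ToType) := by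
        rw [← hasCardinalLT_iff_of_equiv (equivShrink.{w} _).symm, hasCardinalLT_iff_cardinal_mk_lt]
        exact lt_of_lt_of_le (Order.lt_succ _) (by simp [κ])
      simpa [hasCardinalLT_iff_cardinal_mk_lt] using hlt.of_injective _ h)
  have h := MorphismProperty.transfiniteCompositionsOfShape_le_llp_rlp J.pushouts _ _
    (hJ.tcomp (Subobject.mk i) j (fun k _ => hJ.trivCof_arrow _ hf k)).mem
  rw [MorphismProperty.rlp_pushouts] at h
  refine (MorphismProperty.arrow_mk_iso_iff _ ?_).1 h
  have : IsIso (transfiniteIterate hJ.larger j (Subobject.mk i)).arrow :=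
    (Subobject.isIso_arrow_iff_eq_top _).2 hj
  let e := asIso (transfiniteIterate hJ.larger j (Subobject.mk i)).arrow
  have h2 : (hJ.functor (Subobject.mk i) κ.ord.ToType).map (homOfLE bot_le : ⊥ ⟶ j) ≫
        (transfiniteIterate hJ.larger j (Subobject.mk i)).arrow =
          (transfiniteIterate hJ.larger (⊥ : κ.ord.ToType) (Subobject.mk i)).arrow :=
      Subobject.ofLE_arrow _
  refine Arrow.isoMk (Subobject.isoOfEq _ _ (transfiniteIterate_bot _ _) ≪≫
    Subobject.underlyingIso i) e ?_
  refine Eq.trans ?_ h2.symm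
  change ((Subobject.isoOfEq _ _ (transfiniteIterate_bot _ _)).hom ≫
    (Subobject.underlyingIso i).hom) ≫ i = _
  simp [Subobject.isoOfEq]

end GeneratesTrivCof
end CochainComplex

namespace CochainComplex

variable {C : Type u} [Category.{w} C] [Abelian C]

/-- The cone of an identity is contractible. -/
noncomputable def mappingConeIdHomotopy (A : CochainComplex C ℤ) :
    Homotopy (𝟙 (mappingCone (𝟙 A))) 0 :=
  mappingCone.descHomotopy (𝟙 A) _ _ 0 (mappingCone.inl (𝟙 A)) (by simp) (by simp)

lemma trivCof_inr (A : CochainComplex C ℤ) (hA : A.Acyclic) :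
    trivCof C (mappingCone.inr (𝟙 A)) := by
  have hm : Mono (mappingCone.inr (𝟙 A)) := by
    have : ∀ n, Mono ((mappingCone.inr (𝟙 A)).f n) := fun n =>
      mono_of_mono_fac (mappingCone.inr_f_snd_v (𝟙 A) n)
    exact HomologicalComplex.mono_of_mono_f _ this
  refine ⟨hm, ?_⟩
  have h := mappingConeIdHomotopy A
  refine ⟨fun n => ?_⟩
  rw [quasiIsoAt_iff_isIso_homologyMap]
  have h1 : IsZero (HomologicalComplex.homology (mappingCone (𝟙 A)) n) := by
    rw [IsZero.iff_id_eq_zero, ← HomologicalComplex.homologyMap_id, h.homologyMap_eq,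
      HomologicalComplex.homologyMap_zero]
  have h2 : IsZero (HomologicalComplex.homology A n) :=
    (HomologicalComplex.exactAt_iff_isZero_homology _ _).1 (hA n)
  exact ⟨0, h2.eq_of_src _ _, h1.eq_of_src _ _⟩

variable [IsGrothendieckAbelian.{w} C]

lemma exists_trivCof_isKInjective_of_generates {J : MorphismProperty (CochainComplex C ℤ)}
    [MorphismProperty.IsSmall.{w} J] (hJ : GeneratesTrivCof J) (K : CochainComplex C ℤ) :
    ∃ (I : CochainComplex C ℤ) (i : K ⟶ I), QuasiIso i ∧ I.IsKInjective := by
  have hsmall : MorphismProperty.HasSmallObjectArgument.{w} J := by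
    obtain ⟨ι, A, B, f, rfl⟩ := (MorphismProperty.isSmall_iff_eq_ofHoms.{w} J).1 inferInstance
    obtain ⟨κ, hκ', hκ⟩ := HasCardinalLT.exists_regular_cardinal_forall.{w}
      (fun i : ι => Subobject (A i))
    have : Fact κ.IsRegular := ⟨hκ'⟩
    have : Nonempty κ.ord.ToType := by simpa using hκ'.ne_zero
    have := WellFoundedLT.toOrderBot κ.ord.ToType
    exact ⟨κ, inferInstance, inferInstance,
      { preservesColimit {A B X Y} i hi f hf := by
          let hf' : (MorphismProperty.monomorphisms (CochainComplex C ℤ)).TransfiniteCompositionOfShape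
              κ.ord.ToType f :=
            { toTransfiniteCompositionOfShape := hf.toTransfiniteCompositionOfShape
              map_mem j hj := by
                have := (hf.attachCells j hj).pushouts_coproducts
                simp only [MorphismProperty.ofHoms_homFamily] at this
                refine (?_ : _ ≤ MorphismProperty.monomorphisms (CochainComplex C ℤ)) _ this
                simp only [MorphismProperty.pushouts_le_iff, MorphismProperty.coproducts_le_iff]
                exact fun _ _ _ h => (hJ.le _ h).1 }
          have (j j' : κ.ord.ToType) (φ : j ⟶ j') : Mono (hf'.F.map φ) := hf'.mem_map φ
          apply IsGrothendieckAbelian.preservesColimit_coyoneda_obj_of_mono (Y := hf'.F) (κ := κ)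
          obtain ⟨S⟩ := hi
          exact hκ S }⟩
  let fac := MorphismProperty.factorizationData J.rlp.llp J.rlp (0 : K ⟶ 0)
  refine ⟨fac.Z, fac.i, (llp_rlp_le_trivCof hJ.le _ fac.hi).2, ⟨fun {A} f hA => ?_⟩⟩
  have hZ : (trivCof C).rlp fac.p := by
    intro _ _ i hi
    exact hJ.trivCof_le i hi _ fac.hp
  let g := mappingCone.inr (𝟙 A)
  have := hZ g (trivCof_inr A hA)
  have sq : CommSq f g fac.p 0 := ⟨(isZero_zero _).eq_of_tgt _ _⟩
  have h : g ≫ sq.lift = f := sq.fac_left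
  have e1 : f = g ≫ 𝟙 _ ≫ sq.lift := by rw [Category.id_comp, h]
  have e2 : g ≫ (0 : mappingCone (𝟙 A) ⟶ mappingCone (𝟙 A)) ≫ sq.lift = 0 := by
    rw [zero_comp, comp_zero]
  exact ⟨(Homotopy.ofEq e1).trans
    ((((mappingConeIdHomotopy A).compRight sq.lift).compLeft g).trans (Homotopy.ofEq e2))⟩

end CochainComplex

namespace CochainComplex

section colim

variable {C : Type u} [Category.{w} C] [Abelian C] [IsGrothendieckAbelian.{w} C]
  {T : Type w} [SmallCategory T]

lemma exact_of_evaluation (S : ShortComplex (T ⥤ C))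
    (h : ∀ t, (S.map ((evaluation T C).obj t)).Exact) : S.Exact :=
  (JointlyReflectIsomorphisms.exact_iff
    (F := fun t : T => (evaluation T C).obj t)
    ⟨fun f _ => (NatTrans.isIso_iff_isIso_app f).2 (fun t => inferInstanceAs
      (IsIso (((evaluation T C).obj t).map f)))⟩ S).2 h

variable [IsFiltered T] (F : T ⥤ CochainComplex C ℤ) {c : Cocone F}

lemma toCycles_naturality' {K L : CochainComplex C ℤ} (f : K ⟶ L) (i j : ℤ) :
    f.f i ≫ L.toCycles i j = K.toCycles i j ≫ HomologicalComplex.cyclesMap f j := by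
  rw [← cancel_mono (L.iCycles j)]
  simp

/-- The differentials and cycles as a short complex of functors. -/
noncomputable def cyclesSC (n : ℤ) : ShortComplex (T ⥤ C) where
  X₁ := F ⋙ HomologicalComplex.cyclesFunctor C _ n
  X₂ := F ⋙ HomologicalComplex.eval C _ n
  X₃ := F ⋙ HomologicalComplex.eval C _ (n + 1)
  f := { app t := (F.obj t).iCycles n
         naturality _ _ f := HomologicalComplex.cyclesMap_i (F.map f) n }
  g := { app t := (F.obj t).d n (n + 1)
         naturality _ _ f := (F.map f).comm _ _ }
  zero := by ext t; exact HomologicalComplex.iCycles_d _ _ _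

lemma cyclesSC_exact (n : ℤ) : (cyclesSC F n).Exact :=
  exact_of_evaluation _ (fun t => ShortComplex.exact_of_f_is_kernel _
    ((F.obj t).cyclesIsKernel n (n + 1) (by simp)))

/-- The homology as a short complex of functors. -/
noncomputable def homologySC (n : ℤ) : ShortComplex (T ⥤ C) where
  X₁ := F ⋙ HomologicalComplex.eval C _ (n - 1)
  X₂ := F ⋙ HomologicalComplex.cyclesFunctor C _ n
  X₃ := F ⋙ HomologicalComplex.homologyFunctor C _ n
  f := { app t := (F.obj t).toCycles (n - 1) n
         naturality _ _ f := toCycles_naturality' _ _ _ }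
  g := { app t := (F.obj t).homologyπ n
         naturality _ _ f := (HomologicalComplex.homologyπ_naturality (F.map f) _).symm }
  zero := by ext t; exact HomologicalComplex.toCycles_comp_homologyπ _ _ _

lemma homologySC_exact (n : ℤ) : (homologySC F n).Exact :=
  exact_of_evaluation _ (fun t => ShortComplex.exact_of_g_is_cokernel _
    ((F.obj t).homologyIsCokernel (n - 1) n (by simp)))

/-- Cycles commute with filtered colimits. -/
noncomputable def isColimitCycles (hc : IsColimit c) (n : ℤ) :
    IsColimit ((HomologicalComplex.cyclesFunctor C _ n).mapCocone c) := by
  let cz := colimit.cocone (F ⋙ HomologicalComplex.cyclesFunctor C (ComplexShape.up ℤ) n)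
  let hcz : IsColimit cz := colimit.isColimit _
  let u : cz.pt ⟶ c.pt.cycles n := hcz.desc ((HomologicalComplex.cyclesFunctor C _ n).mapCocone c)
  have hu (t : T) : cz.ι.app t ≫ u = HomologicalComplex.cyclesMap (c.ι.app t) n := hcz.fac _ _
  have hX (m : ℤ) := isColimitOfPreserves (HomologicalComplex.eval C (ComplexShape.up ℤ) m) hc
  have hf (t : T) : cz.ι.app t ≫ u ≫ c.pt.iCycles n = (F.obj t).iCycles n ≫ (c.ι.app t).f n := by
    rw [reassoc_of% hu]; exact HomologicalComplex.cyclesMap_i _ _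
  have hex := colim.exact_mapShortComplex (cyclesSC_exact F n) hcz (hX n)
    (hX (n + 1)) (u ≫ c.pt.iCycles n) (c.pt.d n (n + 1)) hf (fun t => (c.ι.app t).comm n (n + 1))
  have hmono : Mono (u ≫ c.pt.iCycles n) := by
    have : Mono (cyclesSC F n).f := by
      have (t : T) : Mono ((cyclesSC F n).f.app t) :=
        inferInstanceAs (Mono ((F.obj t).iCycles n))
      exact NatTrans.mono_of_mono_app _
    exact colim.map_mono' (cyclesSC F n).f hcz (hX n) _ hf
  have : Mono u := mono_of_mono u (c.pt.iCycles n)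
  have : Epi u := by
    have hex' : (ShortComplex.mk (u ≫ c.pt.iCycles n) (c.pt.d n (n + 1)) (by simp)).Exact := hex
    have : Mono (ShortComplex.mk (u ≫ c.pt.iCycles n) (c.pt.d n (n + 1)) (by simp)).f := hmono
    have h1 := hex'.fIsKernel
    let v : c.pt.cycles n ⟶ cz.pt := h1.lift (KernelFork.ofι (c.pt.iCycles n) (HomologicalComplex.iCycles_d _ _ _))
    have hv : v ≫ u ≫ c.pt.iCycles n = c.pt.iCycles n := h1.fac _ WalkingParallelPair.zero
    have : v ≫ u = 𝟙 _ := by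
      rw [← cancel_mono (c.pt.iCycles n), Category.assoc, hv, Category.id_comp]
    exact epi_of_epi_fac this
  have : IsIso u := isIso_of_mono_of_epi u
  exact IsColimit.ofIsoColimit hcz (Cocone.ext
    (c' := (HomologicalComplex.cyclesFunctor C (ComplexShape.up ℤ) n).mapCocone c)
    (@asIso _ _ _ _ u this) hu)

lemma acyclic_of_homologyMap_zero (hc : IsColimit c) (hz : ∀ (n : ℤ) (t : T), ∃ (t' : T) (f : t ⟶ t'),
    HomologicalComplex.homologyMap (F.map f) n = 0) : c.pt.Acyclic := by
  intro n
  rw [HomologicalComplex.exactAt_iff_isZero_homology, IsZero.iff_id_eq_zero,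
    ← cancel_epi (c.pt.homologyπ n), Category.comp_id, comp_zero]
  refine (isColimitCycles F hc n).hom_ext (fun t => ?_)
  obtain ⟨t', f, hf⟩ := hz n t
  have h1 := HomologicalComplex.homologyπ_naturality (c.ι.app t) n
  have h2 : HomologicalComplex.homologyMap (c.ι.app t) n = 0 := by
    rw [← c.w f, HomologicalComplex.homologyMap_comp, hf, zero_comp]
  rw [h2, comp_zero] at h1
  exact h1.symm.trans comp_zero.symm

lemma exists_homologyMap_zero (hc : IsColimit c) (hA : c.pt.Acyclic) (n : ℤ) {κ : Cardinal.{w}}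
    [Fact κ.IsRegular] [IsCardinalFiltered T κ] (t : T)
    (ht : HasCardinalLT (Subobject ((F.obj t).homology n)) κ) :
    ∃ (t' : T) (f : t ⟶ t'), HomologicalComplex.homologyMap (F.map f) n = 0 := by
  let d := colimit.cocone (F ⋙ HomologicalComplex.homologyFunctor C (ComplexShape.up ℤ) n)
  let hd : IsColimit d := colimit.isColimit _
  have hX := isColimitOfPreserves (HomologicalComplex.eval C (ComplexShape.up ℤ) (n - 1)) hc
  let q : c.pt.cycles n ⟶ d.pt := IsColimit.map (isColimitCycles F hc n) d (homologySC F n).g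
  have hq (t : T) : HomologicalComplex.cyclesMap (c.ι.app t) n ≫ q =
      (F.obj t).homologyπ n ≫ d.ι.app t :=
    IsColimit.ι_map (isColimitCycles F hc n) d (homologySC F n).g t
  have hex := colim.exact_mapShortComplex (homologySC_exact F n) hX
    (isColimitCycles F hc n) hd (c.pt.toCycles (n - 1) n) q (fun t =>
      toCycles_naturality' (c.ι.app t) _ _) hq
  have hepi : Epi (c.pt.toCycles (n - 1) n) := by
    have h0 := (HomologicalComplex.exactAt_iff_isZero_homology _ _).1 (hA n)
    rw [Preadditive.epi_iff_cancel_zero]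
    intro Z g hg
    let φ := (c.pt.homologyIsCokernel (n - 1) n (by simp)).desc (CokernelCofork.ofπ g hg)
    have hφ : c.pt.homologyπ n ≫ φ = g :=
      (c.pt.homologyIsCokernel (n - 1) n (by simp)).fac (CokernelCofork.ofπ g hg)
        WalkingParallelPair.one
    rw [← hφ, h0.eq_of_src φ 0, comp_zero]
  have hq0 : q = 0 := by
    rw [← cancel_epi (c.pt.toCycles (n - 1) n), comp_zero]
    exact (colim.mapShortComplex (homologySC F n) hX
      ((HomologicalComplex.cyclesFunctor C (ComplexShape.up ℤ) n).mapCocone c) d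
      (c.pt.toCycles (n - 1) n) q (fun t => toCycles_naturality' (c.ι.app t) _ _) hq).zero
  have hd0 : d.ι.app t = 0 := by
    have := hq t
    rw [hq0, comp_zero] at this
    exact (cancel_epi ((F.obj t).homologyπ n)).1 (this.symm.trans comp_zero.symm)
  obtain ⟨t', f, hf⟩ := IsGrothendieckAbelian.IsPresentable.injectivity₀ hd ht (𝟙 _)
    ((Category.id_comp _).trans hd0)
  exact ⟨t', f, (Category.id_comp _).symm.trans hf⟩

end colim

end CochainComplex

namespace CochainComplex

section gen

variable {D : Type u} [Category.{w} D] [Abelian D] [IsGrothendieckAbelian.{w} D]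
  {G : D} {X : D}

/-- The subobject generated by a set of generalized elements. -/
noncomputable def genSub (s : Set (G ⟶ X)) : Subobject X :=
  imageSubobject (Limits.Sigma.desc (fun f : s => f.1))

lemma genSub_factors (s : Set (G ⟶ X)) {f : G ⟶ X} (hf : f ∈ s) : (genSub s).Factors f := by
  have := imageSubobject_factors_comp_self (Limits.Sigma.desc (fun f : s => f.1))
    (Limits.Sigma.ι (fun _ : s => G) ⟨f, hf⟩)
  rwa [Limits.Sigma.ι_desc] at this

lemma genSub_le (s : Set (G ⟶ X)) {A : Subobject X} (h : ∀ f ∈ s, A.Factors f) :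
    genSub s ≤ A :=
  imageSubobject_le _ (Limits.Sigma.desc (fun f : s => A.factorThru f.1 (h f.1 f.2))) (by
    apply Limits.Sigma.hom_ext; intro; simp)

lemma genSub_mono {s t : Set (G ⟶ X)} (h : s ⊆ t) : genSub s ≤ genSub t :=
  genSub_le _ (fun _ hf => genSub_factors _ (h hf))

lemma eq_top_of_factors (hG : IsSeparator G) {A : Subobject X} (h : ∀ f : G ⟶ X, A.Factors f) :
    A = ⊤ := by
  rw [← Subobject.isIso_arrow_iff_eq_top]
  have : Epi A.arrow := by
    rw [Preadditive.epi_iff_cancel_zero]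
    intro Z z hz
    refine hG.def _ _ (fun f => ?_)
    rw [← A.factorThru_arrow f (h f), Category.assoc, hz, comp_zero, comp_zero]
  exact isIso_of_mono_of_epi _

lemma exists_epi_genSub (s : Set (G ⟶ X)) {κ : Cardinal.{w}} [Fact κ.IsRegular]
    (hs : HasCardinalLT s κ) :
    ∃ p : (∐ fun _ : κ.ord.ToType => G) ⟶ (genSub s : D), Epi p := by
  have hle : Cardinal.mk s ≤ Cardinal.mk κ.ord.ToType := by
    rw [hasCardinalLT_iff_cardinal_mk_lt] at hs
    simpa using hs.le
  obtain ⟨φ⟩ : Nonempty (s ↪ κ.ord.ToType) := hle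
  let q : (∐ fun _ : κ.ord.ToType => G) ⟶ (∐ fun _ : s => G) :=
    Limits.Sigma.desc (fun k => open scoped Classical in
      if h : ∃ i, φ i = k then Limits.Sigma.ι (fun _ : s => G) h.choose else 0)
  have hq : Epi q := by
    refine ⟨fun a b hab => Limits.Sigma.hom_ext _ _ (fun i => ?_)⟩
    have := Limits.Sigma.ι (fun _ : κ.ord.ToType => G) (φ i) ≫= hab
    have h : ∃ j, φ j = φ i := ⟨i, rfl⟩
    have e : h.choose = i := φ.injective h.choose_spec
    simp only [q, colimit.ι_desc_assoc, Cofan.mk_pt, Cofan.mk_ι_app, dif_pos h] at this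
    rw [e] at this
    exact this
  let r : (∐ fun _ : s => G) ⟶ (genSub s : D) := factorThruImageSubobject _
  have : Epi r := inferInstanceAs (Epi (factorThruImage _ ≫ (imageSubobjectIso _).inv))
  exact ⟨q ≫ r, epi_comp _ _⟩

lemma exists_set_epi (hG : IsSeparator G) {P Q : D} (p : P ⟶ Q) [Epi p] (f : G ⟶ P)
    {κ : Cardinal.{w}} (hκ : Cardinal.aleph0 ≤ κ) (h : HasCardinalLT (G ⟶ Q) κ) :
    ∃ t : Set (G ⟶ P), f ∈ t ∧ HasCardinalLT t κ ∧ Epi ((genSub t).arrow ≫ p) := by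
  classical
  let F : Option (G ⟶ Q) → (G ⟶ P) := fun o => match o with
    | none => f
    | some g => if h : ∃ k, k ≫ p = g then h.choose else f
  refine ⟨Set.range F, ⟨none, rfl⟩, ?_, ?_⟩
  · refine HasCardinalLT.of_surjective ((hasCardinalLT_option_iff _ _ hκ).2 h)
      (Set.rangeFactorization F) Set.rangeFactorization_surjective
  · rw [Preadditive.epi_iff_cancel_zero]
    intro Z z hz
    rw [← cancel_epi p, comp_zero]
    refine hG.def _ _ (fun k => ?_)
    have hk : ∃ k', k' ≫ p = k ≫ p := ⟨k, rfl⟩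
    have hF : F (some (k ≫ p)) ≫ p = k ≫ p := by
      simp only [F, dif_pos hk, hk.choose_spec]
    rw [← Category.assoc, ← hF, ← (genSub (Set.range F)).factorThru_arrow (F (some (k ≫ p)))
      (genSub_factors _ ⟨some (k ≫ p), rfl⟩), Category.assoc, Category.assoc, ← Category.assoc _ p, hz]
    simp

/-- The filtered diagram of the generated subobjects. -/
noncomputable def genFunctor {T : Type w} [Preorder T] (S : T →o Set (G ⟶ X)) : T ⥤ MonoOver X where
  obj t := MonoOver.mk (genSub (S t)).arrow
  map f := MonoOver.homMk (Subobject.ofLE _ _ (genSub_mono (S.monotone (leOfHom f))))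

/-- The cocone of a diagram of generated subobjects. -/
noncomputable def genCocone {T : Type w} [Preorder T] (S : T →o Set (G ⟶ X)) (A : Subobject X)
    (hA : ∀ t, genSub (S t) ≤ A) : Cocone (genFunctor S ⋙ MonoOver.forget _) where
  pt := (MonoOver.mk A.arrow).obj
  ι := { app t := Over.homMk (Subobject.ofLE _ _ (hA t)) (Subobject.ofLE_arrow _)
         naturality _ _ f := by
           apply Over.OverMorphism.ext
           refine (cancel_mono A.arrow).1 ?_
           change (Subobject.ofLE _ _ _ ≫ Subobject.ofLE _ _ _) ≫ A.arrow =
             (Subobject.ofLE _ _ _ ≫ 𝟙 _) ≫ A.arrow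
           simp }

/-- The generated subobjects form a colimit diagram. -/
noncomputable def isColimitGen {T : Type w} [Preorder T] [IsFiltered T]
    (S : T →o Set (G ⟶ X)) (A : Subobject X)
    (hA : ∀ t, genSub (S t) ≤ A) (h : A = ⨆ t, genSub (S t)) :
    IsColimit ((Over.forget _).mapCocone (genCocone S A hA)) := by
  have : Mono (genCocone S A hA).pt.hom := inferInstanceAs (Mono A.arrow)
  apply IsGrothendieckAbelian.isColimitMapCoconeOfSubobjectMkEqISup
  refine (Subobject.mk_arrow A).trans (h.trans (iSup_congr fun j => ?_))
  exact (Subobject.mk_arrow (genSub (S j))).symm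

end gen

end CochainComplex

namespace CochainComplex

section size

/-- A quotient as a cokernel of a subobject. -/
noncomputable def quotIso {D : Type u} [Category.{w} D] [Abelian D] {N B : D} (p : N ⟶ B) [Epi p] :
    cokernel (kernelSubobject p).arrow ≅ B :=
  cokernel.mapIso _ (kernel.ι p) (kernelSubobjectIso p) (Iso.refl N) (by simp) ≪≫
    (by
      have : Epi (Abelian.factorThruCoimage p) := epi_of_epi_fac (Abelian.coimage.fac p)
      have : IsIso (Abelian.factorThruCoimage p) := isIso_of_mono_of_epi _
      exact asIso (Abelian.factorThruCoimage p))

lemma exists_cardinal_of_quotient {D : Type u} [Category.{w} D] [Abelian D]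
    [IsGrothendieckAbelian.{w} D] (N : D) (Φ : D → Type v) [∀ B, Small.{w} (Φ B)]
    (hΦ : ∀ {B B' : D}, (B ≅ B') → Nonempty (Φ B ≃ Φ B')) :
    ∃ κ : Cardinal.{w}, κ.IsRegular ∧ ∀ (B : D) (p : N ⟶ B), Epi p → HasCardinalLT (Φ B) κ := by
  obtain ⟨κ, h1, h2⟩ := HasCardinalLT.exists_regular_cardinal_forall.{w}
    (fun K : Subobject N => Φ (cokernel K.arrow))
  refine ⟨κ, h1, fun B p _ => ?_⟩
  obtain ⟨e'⟩ := hΦ (quotIso p)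
  exact (hasCardinalLT_iff_of_equiv e' κ).1 (h2 _)

variable {C : Type u} [Category.{w} C] [Abelian C] [IsGrothendieckAbelian.{w} C]
  {G : CochainComplex C ℤ}

lemma acyclic_of_iso {K L : CochainComplex C ℤ} (e : K ≅ L) (h : K.Acyclic) : L.Acyclic :=
  fun n => (HomologicalComplex.exactAt_iff_isZero_homology _ _).2
    (((HomologicalComplex.exactAt_iff_isZero_homology _ _).1 (h n)).of_iso
      ((HomologicalComplex.homologyFunctor C _ n).mapIso e.symm))

lemma exists_step (hG : IsSeparator G) (κ : Cardinal.{w}) (hκ : κ.IsRegular) :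
    ∃ κ' : Cardinal.{w}, κ'.IsRegular ∧
      ∀ (Q : CochainComplex C ℤ) (_ : Q.Acyclic) (s : Set (G ⟶ Q)), HasCardinalLT s κ →
        ∃ s' : Set (G ⟶ Q), HasCardinalLT s' κ' ∧ ∃ (h : s ⊆ s'), ∀ n,
          HomologicalComplex.homologyMap (Subobject.ofLE _ _ (genSub_mono h)) n = 0 := by
  have : Fact κ.IsRegular := ⟨hκ⟩
  obtain ⟨κ', h1, h2⟩ := exists_cardinal_of_quotient (∐ fun _ : κ.ord.ToType => G)
    (fun B => (Σ n : ℤ, Subobject (B.homology n)) ⊕ (ℤ ⊕ κ.ord.ToType)) (fun {B B'} e => ⟨by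
      refine Equiv.sumCongr (Equiv.sigmaCongrRight fun n => ?_) (Equiv.refl _)
      exact (Subobject.mapIsoToOrderIso
        ((HomologicalComplex.homologyFunctor C _ n).mapIso e)).toEquiv⟩)
  have : Fact κ'.IsRegular := ⟨h1⟩
  have hZ : HasCardinalLT ℤ κ' := (h2 _ (𝟙 _) inferInstance).of_injective
    (fun n => Sum.inr (Sum.inl n)) (fun _ _ h => by simpa using h)
  have hκ' : κ ≤ κ' := by
    have h := (h2 _ (𝟙 _) inferInstance).of_injective
      (fun n : κ.ord.ToType => Sum.inr (Sum.inr n)) (fun _ _ h => by simpa using h)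
    rw [hasCardinalLT_iff_cardinal_mk_lt] at h
    simpa using h.le
  refine ⟨κ', h1, fun Q hQ s hs => ?_⟩
  let T := {t : Set (G ⟶ Q) // HasCardinalLT t κ'}
  let S : T →o Set (G ⟶ Q) := ⟨Subtype.val, fun _ _ h => h⟩
  have hU {K : Type w} (hK : HasCardinalLT K κ') (t : K → T) :
      HasCardinalLT (⋃ k, (t k).1 : Set (G ⟶ Q)) κ' :=
    hasCardinalLT_iUnion _ hK (fun k => (t k).2)
  have : IsCardinalFiltered T κ' := isCardinalFiltered_preorder _ _ (fun K t hK =>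
    ⟨⟨_, hU ((hasCardinalLT_iff_cardinal_mk_lt _ _).2 hK) t⟩,
      fun k => Set.subset_iUnion (fun k => (t k).1) k⟩)
  have : IsFiltered T := isFiltered_of_isCardinalFiltered T κ'
  have hsup : (⊤ : Subobject Q) = ⨆ t, genSub (S t) := by
    refine (eq_top_of_factors hG (fun f => ?_)).symm
    let t : T := ⟨{f}, hasCardinalLT_of_finite _ _ h1.aleph0_le⟩
    exact Subobject.factors_of_le f (le_iSup (fun t => genSub (S t)) t) (genSub_factors _ rfl)
  have hc := isColimitGen S ⊤ (fun _ => le_top) hsup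
  have hac : (((Over.forget _).mapCocone (genCocone S ⊤ (fun _ => le_top))).pt).Acyclic :=
    acyclic_of_iso (asIso (⊤ : Subobject Q).arrow).symm hQ
  let t : T := ⟨s, hs.of_le hκ'⟩
  obtain ⟨p, hp⟩ := exists_epi_genSub s hs
  have hS (n : ℤ) :
      HasCardinalLT (Subobject ((genSub s : CochainComplex C ℤ).homology n)) κ' :=
    (h2 _ p hp).of_injective
      (Sum.inl ∘ Sigma.mk (β := fun n => Subobject ((genSub s : CochainComplex C ℤ).homology n)) n)
      (Sum.inl_injective.comp sigma_mk_injective)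
  have H (n : ℤ) := exists_homologyMap_zero _ hc hac n (κ := κ') t (hS n)
  choose t' f hf using H
  refine ⟨⋃ n : ULift.{w} ℤ, (t' n.down).1, hU (by simpa using hZ) _,
    Set.Subset.trans (leOfHom (f 0)) (Set.subset_iUnion (fun n : ULift.{w} ℤ => (t' n.down).1) ⟨0⟩),
    fun n => ?_⟩
  have h3 : genSub (t' n).1 ≤ genSub (⋃ n : ULift.{w} ℤ, (t' n.down).1) :=
    genSub_mono (Set.subset_iUnion (fun n : ULift.{w} ℤ => (t' n.down).1) ⟨n⟩)
  rw [← Subobject.ofLE_comp_ofLE _ _ _ (genSub_mono (leOfHom (f n))) h3,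
    HomologicalComplex.homologyMap_comp]
  have h4 : HomologicalComplex.homologyMap
    (Subobject.ofLE (genSub s) (genSub (t' n).1) (genSub_mono (leOfHom (f n)))) n = 0 := hf n
  rw [h4, zero_comp]

lemma exists_acyclic_genSub (hG : IsSeparator G) :
    ∃ κ : Cardinal.{w}, κ.IsRegular ∧ ∀ (Q : CochainComplex C ℤ) (_ : Q.Acyclic) (f : G ⟶ Q),
      ∃ s : Set (G ⟶ Q), f ∈ s ∧ HasCardinalLT s κ ∧
        HomologicalComplex.Acyclic (genSub s : CochainComplex C ℤ) := by
  choose step h1 h2 using exists_step hG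
  let κs : ℕ → {κ : Cardinal.{w} // κ.IsRegular} := fun n =>
    Nat.rec ⟨.aleph0, Cardinal.isRegular_aleph0⟩ (fun _ k => ⟨step k.1 k.2, h1 k.1 k.2⟩) n
  obtain ⟨κ, hκ, h3⟩ := HasCardinalLT.exists_regular_cardinal_forall.{w}
    (fun n => ℕ ⊕ (κs n).1.ord.ToType)
  have : Fact κ.IsRegular := ⟨hκ⟩
  have hle (n : ℕ) : (κs n).1 ≤ κ := by
    have h := (h3 n).of_injective Sum.inr Sum.inr_injective
    rw [hasCardinalLT_iff_cardinal_mk_lt] at h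
    simpa using h.le
  have hN : HasCardinalLT ℕ κ := (h3 0).of_injective Sum.inl Sum.inl_injective
  refine ⟨κ, hκ, fun Q hQ f => ?_⟩
  let sq : ∀ n, {s : Set (G ⟶ Q) // HasCardinalLT s (κs n).1} := fun n =>
    Nat.rec ⟨{f}, hasCardinalLT_of_finite _ _ le_rfl⟩
      (fun n x => ⟨(h2 _ _ Q hQ x.1 x.2).choose, (h2 _ (κs n).2 Q hQ x.1 x.2).choose_spec.1⟩) n
  have hsq (n : ℕ) : ∃ (h : (sq n).1 ⊆ (sq (n + 1)).1), ∀ m,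
      HomologicalComplex.homologyMap (Subobject.ofLE _ _ (genSub_mono h)) m = 0 :=
    (h2 _ (κs n).2 Q hQ (sq n).1 (sq n).2).choose_spec.2
  let S : ULift.{w} ℕ →o Set (G ⟶ Q) := ⟨fun n => (sq n.down).1, fun m n h =>
    monotone_nat_of_le_succ (f := fun n => (sq n).1) (fun n => (hsq n).choose) h⟩
  have hsup : genSub (⋃ t, S t) = ⨆ t, genSub (S t) := by
    refine le_antisymm (genSub_le _ (fun g hg => ?_))
      (iSup_le (fun t => genSub_mono (Set.subset_iUnion _ t)))
    obtain ⟨t, ht⟩ := Set.mem_iUnion.1 hg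
    exact Subobject.factors_of_le g (le_iSup (fun t => genSub (S t)) t) (genSub_factors _ ht)
  have hc := isColimitGen S (genSub (⋃ t, S t)) (fun t => genSub_mono (Set.subset_iUnion _ t)) hsup
  refine ⟨⋃ t, S t, Set.mem_iUnion.2 ⟨⟨0⟩, rfl⟩,
    hasCardinalLT_iUnion _ (by simpa using hN) (fun t => (sq t.down).2.of_le (hle _)),
    acyclic_of_homologyMap_zero _ hc (fun m t => ⟨⟨t.down + 1⟩,
      homOfLE (Nat.le_succ t.down : t.down ≤ t.down + 1), (hsq t.down).choose_spec m⟩)⟩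

end size

end CochainComplex

namespace CochainComplex

variable {C : Type u} [Category.{w} C] [Abelian C] [IsGrothendieckAbelian.{w} C]

/-- The trivial cofibrations between subobjects and quotients of `N`. -/
def smallTrivCof (N : CochainComplex C ℤ) : MorphismProperty (CochainComplex C ℤ) :=
  MorphismProperty.ofHoms
    (fun x : {x : Σ K : Subobject N, Subobject (cokernel K.arrow) // trivCof C x.2.arrow} =>
      x.1.2.arrow)

instance (N : CochainComplex C ℤ) : MorphismProperty.IsSmall.{w} (smallTrivCof N) := by
  dsimp only [smallTrivCof]
  infer_instance

lemma smallTrivCof_le (N : CochainComplex C ℤ) : smallTrivCof N ≤ trivCof C := by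
  rintro _ _ _ ⟨x⟩
  exact x.2

lemma smallTrivCof_exists {N K T : CochainComplex C ℤ} (k : K ⟶ T) (hk : trivCof C k)
    (p : N ⟶ T) (hp : Epi p) : ∃ (K' T' : CochainComplex C ℤ) (k' : K' ⟶ T')
      (e₁ : K ≅ K') (e₂ : T ≅ T'), k ≫ e₂.hom = e₁.hom ≫ k' ∧ smallTrivCof N k' := by
  have : Mono k := hk.1
  let θ : T ≅ cokernel (kernelSubobject p).arrow := (quotIso p).symm
  let S : Subobject (cokernel (kernelSubobject p).arrow) := Subobject.mk (k ≫ θ.hom)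
  let e : Arrow.mk k ≅ Arrow.mk S.arrow :=
    Arrow.isoMk (Subobject.underlyingIso (k ≫ θ.hom)).symm θ (by simp [S])
  exact ⟨_, _, S.arrow, (Subobject.underlyingIso (k ≫ θ.hom)).symm, θ, by simp [S], ⟨(⟨⟨kernelSubobject p, S⟩,
    (MorphismProperty.arrow_mk_iso_iff _ e).1 hk⟩ :
    {x : Σ K : Subobject N, Subobject (cokernel K.arrow) // trivCof C x.2.arrow})⟩⟩

lemma exists_generatesTrivCof (C : Type u) [Category.{w} C] [Abelian C]
    [IsGrothendieckAbelian.{w} C] :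
    ∃ N : CochainComplex C ℤ, GeneratesTrivCof (smallTrivCof N) := by
  let G := separator (CochainComplex C ℤ)
  have hG : IsSeparator G := isSeparator_separator _
  obtain ⟨κ, hκ, h1⟩ := exists_acyclic_genSub hG
  obtain ⟨κ', hκ', h2⟩ := exists_cardinal_of_quotient (∐ fun _ : κ.ord.ToType => G)
    (fun B => G ⟶ B) (fun e => ⟨Iso.homCongr (Iso.refl _) e⟩)
  have : Fact κ.IsRegular := ⟨hκ⟩
  have : Fact κ'.IsRegular := ⟨hκ'⟩
  refine ⟨∐ fun _ : κ'.ord.ToType => G, smallTrivCof_le _, ?_, ?_⟩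
  · refine MorphismProperty.isomorphisms_le_pushouts _ (fun X => ⟨_, _, (⊤ : Subobject (cokernel (⊤ :
      Subobject (∐ fun _ : κ'.ord.ToType => G)).arrow)).arrow, ⟨(⟨⟨⊤, ⊤⟩, ?_⟩ :
      {x : Σ K : Subobject _, Subobject (cokernel K.arrow) // trivCof C x.2.arrow})⟩, 0,
      inferInstance⟩)
    exact ⟨inferInstanceAs (Mono (⊤ : Subobject _).arrow),
      (inferInstance : QuasiIso (⊤ : Subobject _).arrow)⟩
  · intro A X i hi hiso
    have : Mono i := hi.1
    rw [hG.isDetector.isIso_iff_of_mono] at hiso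
    simp only [ObjectProperty.singleton_iff, Function.Surjective, Functor.flip_obj_map, forall_eq',
      not_forall, not_exists] at hiso
    obtain ⟨f, hf⟩ := hiso
    let π := cokernel.π i
    obtain ⟨s, hs, hs', hs''⟩ := h1 (cokernel i) ((trivCof_iff i).1 hi).2 (f ≫ π)
    let B : CochainComplex C ℤ := (genSub s : CochainComplex C ℤ)
    let b : B ⟶ cokernel i := (genSub s).arrow
    obtain ⟨p₀, hp₀⟩ := exists_epi_genSub s hs'
    let P := pullback π b
    let f' : G ⟶ P := pullback.lift f ((genSub s).factorThru _ (genSub_factors s hs))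
      (Subobject.factorThru_arrow _ _ _).symm
    obtain ⟨t, ht, ht', ht''⟩ := exists_set_epi hG (pullback.snd π b) f' hκ'.aleph0_le
      (h2 _ p₀ hp₀)
    obtain ⟨p₁, hp₁⟩ := exists_epi_genSub t ht'
    let T : CochainComplex C ℤ := (genSub t : CochainComplex C ℤ)
    let c : T ⟶ X := (genSub t).arrow ≫ pullback.fst π b
    let q : T ⟶ B := (genSub t).arrow ≫ pullback.snd π b
    have hcq : c ≫ π = q ≫ b := by simp [c, q, pullback.condition]
    let f'' : G ⟶ T := (genSub t).factorThru _ (genSub_factors t ht)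
    have hf'' : f'' ≫ c = f := by
      have e1 : f'' ≫ (genSub t).arrow = f' := Subobject.factorThru_arrow _ _ _
      have e2 : f' ≫ pullback.fst π b = f := pullback.lift_fst _ _ _
      rw [← e2, ← e1, Category.assoc]
    let k : kernel q ⟶ T := kernel.ι q
    have hkc : (k ≫ c) ≫ cokernel.π i = 0 := by
      rw [Category.assoc, hcq, kernel.condition_assoc, zero_comp]
    let a : kernel q ⟶ A := Abelian.monoLift i (k ≫ c) hkc
    have ha : a ≫ i = k ≫ c := Abelian.monoLift_comp i _ hkc
    have hpull : IsPullback a k i c := by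
      refine ⟨⟨ha⟩, ⟨PullbackCone.IsLimit.mk _ (fun s => kernel.lift q s.snd ?_) ?_ ?_ ?_⟩⟩
      · rw [← cancel_mono b, Category.assoc, ← hcq, ← reassoc_of% s.condition]
        simp [π]
      · intro s
        rw [← cancel_mono i, Category.assoc, ha, kernel.lift_ι_assoc, s.condition]
      · intro s
        exact kernel.lift_ι _ _ _
      · intro s m _ h2
        rw [← cancel_mono k, h2, kernel.lift_ι]
    have hk : trivCof C k := by
      rw [trivCof_iff]
      refine ⟨inferInstance, acyclic_of_iso (K := B) ?_ hs''⟩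
      have : Epi q := ht''
      have : Epi (Abelian.factorThruCoimage q) := epi_of_epi_fac (Abelian.coimage.fac q)
      have : IsIso (Abelian.factorThruCoimage q) := isIso_of_mono_of_epi _
      exact (asIso (Abelian.factorThruCoimage q)).symm
    obtain ⟨K', T', k', e₁, e₂, he, hk'⟩ := smallTrivCof_exists k hk p₁ hp₁
    refine ⟨pushout a k, pushout.inl _ _, pushout.desc i c ha, ?_, ?_, ?_, pushout.inl_desc _ _ _⟩
    · refine ⟨_, _, k', e₁.inv ≫ a, e₂.inv ≫ pushout.inr a k, hk', ?_⟩
      exact (IsPushout.of_hasPushout a k).of_iso e₁ (Iso.refl _) e₂ (Iso.refl _)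
        (by simp) he (by simp) (by simp)
    · intro h
      refine hf (f'' ≫ pushout.inr a k ≫ inv (pushout.inl a k)) ?_
      have h3 : inv (pushout.inl a k) ≫ i = pushout.desc i c ha := by
        rw [IsIso.inv_comp_eq]
        exact (pushout.inl_desc _ _ _).symm
      have h4 : pushout.inr a k ≫ pushout.desc i c ha = c := pushout.inr_desc _ _ _
      change (f'' ≫ pushout.inr a k ≫ inv (pushout.inl a k)) ≫ i = f
      rw [Category.assoc, Category.assoc, h3, h4, hf'']
    · exact (IsPushout.of_hasPushout a k).mono_of_isPullback_of_mono hpull _ (pushout.inl_desc _ _ _)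
        (pushout.inr_desc _ _ _)

/-- Every complex in a Grothendieck abelian category has a K-injective resolution. -/
theorem exists_kInjectiveResolution (K : CochainComplex C ℤ) :
    ∃ (I : CochainComplex C ℤ) (i : K ⟶ I), QuasiIso i ∧ I.IsKInjective := by
  obtain ⟨N, hN⟩ := exists_generatesTrivCof C
  exact exists_trivCof_isKInjective_of_generates hN K

end CochainComplex

namespace DerivedCategory

variable (C : Type u) [Category.{w} C] [Abelian C] [IsGrothendieckAbelian.{w} C]
  [HasDerivedCategory.{v} C]

instance : (Qh : HomotopyCategory C (ComplexShape.up ℤ) ⥤ DerivedCategory C).IsLeftAdjoint := by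
  have (Y : DerivedCategory C) :
      HasTerminal (CostructuredArrow (Qh : HomotopyCategory C (ComplexShape.up ℤ) ⥤ _) Y) := by
    obtain ⟨K, ⟨e⟩⟩ := (inferInstance : Q.EssSurj).mem_essImage Y
    obtain ⟨I, i, hi, _⟩ := CochainComplex.exists_kInjectiveResolution K
    let e' : Qh.obj ((HomotopyCategory.quotient _ _).obj I) ≅ Y :=
      (quotientCompQhIso C).app I ≪≫ (asIso (Q.map i)).symm ≪≫ e
    refine IsTerminal.hasTerminal (X := CostructuredArrow.mk e'.hom) ?_
    have hb (L : HomotopyCategory C (ComplexShape.up ℤ)) :=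
      CochainComplex.IsKInjective.Qh_map_bijective L I
    refine IsTerminal.ofUniqueHom (fun Z => CostructuredArrow.homMk
      ((hb Z.left).2 (Z.hom ≫ e'.inv)).choose ?_) ?_
    · rw [((hb Z.left).2 (Z.hom ≫ e'.inv)).choose_spec]
      simp
    · intro Z m
      apply CostructuredArrow.hom_ext
      apply (hb Z.left).1
      refine Eq.trans ?_ ((hb Z.left).2 (Z.hom ≫ e'.inv)).choose_spec.symm
      rw [← cancel_mono e'.hom]
      simpa using CostructuredArrow.w m
  exact isLeftAdjoint_of_costructuredArrowTerminals _

end DerivedCategory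


namespace TotHom

open Opposite

variable {C : Type*} [Category* C] [Preadditive C] {E : Type*} [Category* E] [Preadditive E]
  [HasCountableProducts E] (H : Cᵒᵖ ⥤ C ⥤ E)

/-- The object in degree `n` of the total Hom complex of `F` and `I` with respect to a bifunctor
`H` (which is thought of as a Hom functor): the product of all `H(F^p, I^q)` with `p + n = q`. -/
noncomputable def X (F I : CochainComplex C ℤ) (n : ℤ) : E :=
  ∏ᶜ fun pq : {pq : ℤ × ℤ // pq.1 + n = pq.2} => (H.obj (op (F.X pq.1.1))).obj (I.X pq.1.2)

variable {H}

open scoped Classical in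
/-- The component in `H(F^p, I^q)`, which is zero unless `p + n = q`. -/
noncomputable def proj (F I : CochainComplex C ℤ) (n p q : ℤ) :
    X H F I n ⟶ (H.obj (op (F.X p))).obj (I.X q) :=
  if h : p + n = q then
    Pi.π (fun pq : {pq : ℤ × ℤ // pq.1 + n = pq.2} =>
      (H.obj (op (F.X pq.1.1))).obj (I.X pq.1.2)) ⟨(p, q), h⟩
  else 0

/-- A morphism to the total Hom complex in degree `n`, given by its components. -/
noncomputable def lift {F I : CochainComplex C ℤ} {n : ℤ} {Z : E}
    (f : ∀ p q : ℤ, Z ⟶ (H.obj (op (F.X p))).obj (I.X q)) : Z ⟶ X H F I n :=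
  Pi.lift (fun pq => f pq.1.1 pq.1.2)

lemma proj_eq_zero (F I : CochainComplex C ℤ) (n p q : ℤ) (h : p + n ≠ q) :
    (proj F I n p q : X H F I n ⟶ _) = 0 := dif_neg h

lemma proj_eq_π (F I : CochainComplex C ℤ) (n p q : ℤ) (h : p + n = q) :
    proj F I n p q = Pi.π (fun pq : {pq : ℤ × ℤ // pq.1 + n = pq.2} =>
      (H.obj (op (F.X pq.1.1))).obj (I.X pq.1.2)) ⟨(p, q), h⟩ := dif_pos h

lemma lift_proj_of_eq {F I : CochainComplex C ℤ} {n : ℤ} {Z : E}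
    (f : ∀ p q : ℤ, Z ⟶ (H.obj (op (F.X p))).obj (I.X q)) (p q : ℤ) (h : p + n = q) :
    lift f ≫ proj F I n p q = f p q := by
  rw [proj_eq_π _ _ _ _ _ h]
  exact Pi.lift_π (fun pq : {pq : ℤ × ℤ // pq.1 + n = pq.2} => f pq.1.1 pq.1.2) ⟨(p, q), h⟩

lemma lift_proj {F I : CochainComplex C ℤ} {n : ℤ} {Z : E}
    (f : ∀ p q : ℤ, Z ⟶ (H.obj (op (F.X p))).obj (I.X q)) (p q : ℤ) (h : p + n ≠ q → f p q = 0) :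
    lift f ≫ proj F I n p q = f p q := by
  by_cases hpq : p + n = q
  · exact lift_proj_of_eq f p q hpq
  · rw [h hpq, proj_eq_zero _ _ _ _ _ hpq, comp_zero]

lemma hom_ext {F I : CochainComplex C ℤ} {n : ℤ} {Z : E} {f g : Z ⟶ X H F I n}
    (h : ∀ p q, p + n = q → f ≫ proj F I n p q = g ≫ proj F I n p q) : f = g := by
  refine Pi.hom_ext _ _ (fun pq => ?_)
  have := h _ _ pq.2
  rw [proj_eq_π _ _ _ _ _ pq.2] at this
  exact this

/-- The differential of the total Hom complex: it sends `z` of degree `n` to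
`d_I ∘ z + (-1)^(n+1) z ∘ d_F`. -/
noncomputable def d (F I : CochainComplex C ℤ) (n m : ℤ) : X H F I n ⟶ X H F I m :=
  lift (fun p q => proj F I n p (q - 1) ≫ (H.obj (op (F.X p))).map (I.d (q - 1) q) +
    m.negOnePow • (proj F I n (p + 1) q ≫ (H.map (F.d p (p + 1)).op).app (I.X q)))

lemma d_proj (F I : CochainComplex C ℤ) (n m : ℤ) (h : n + 1 = m) (p p' q q' : ℤ)
    (hp : p + 1 = p') (hq : q' + 1 = q) :
    (d F I n m : X H F I n ⟶ _) ≫ proj F I m p q =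
      proj F I n p q' ≫ (H.obj (op (F.X p))).map (I.d q' q) +
      m.negOnePow • (proj F I n p' q ≫ (H.map (F.d p p').op).app (I.X q)) := by
  subst hp
  obtain rfl : q' = q - 1 := by omega
  refine lift_proj _ _ _ (fun hpq => ?_)
  rw [proj_eq_zero F I n p (q - 1) (by omega), proj_eq_zero F I n (p + 1) q (by omega)]
  simp

variable [H.Additive] [∀ X, (H.obj X).Additive]

/-- The total Hom complex. -/
noncomputable def complex (H : Cᵒᵖ ⥤ C ⥤ E) [H.Additive] [∀ X, (H.obj X).Additive]
    (F I : CochainComplex C ℤ) : CochainComplex E ℤ where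
  X n := X H F I n
  d n m := d F I n m
  shape n m h := by
    refine hom_ext (fun p q hpq => ?_)
    have h : n + 1 ≠ m := h
    rw [d, zero_comp]
    refine (lift_proj_of_eq _ p q hpq).trans ?_
    rw [proj_eq_zero F I n p (q - 1) (by omega), proj_eq_zero F I n (p + 1) q (by omega)]
    simp
  d_comp_d' n m k hnm hmk := by
    obtain rfl : n + 1 = m := hnm
    obtain rfl : n + 1 + 1 = k := hmk
    refine hom_ext (fun p q hpq => ?_)
    have h1 : (H.obj (op (F.X p))).map (I.d (q - 1 - 1) (q - 1)) ≫
        (H.obj (op (F.X p))).map (I.d (q - 1) q) = 0 := by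
      rw [← Functor.map_comp, I.d_comp_d, Functor.map_zero]
    have h2 : (H.map (F.d (p + 1) (p + 1 + 1)).op).app (I.X q) ≫
        (H.map (F.d p (p + 1)).op).app (I.X q) = 0 := by
      rw [← NatTrans.comp_app, ← Functor.map_comp, ← op_comp, F.d_comp_d, op_zero,
        Functor.map_zero, zero_app]
    have h3 := (H.map (F.d p (p + 1)).op).naturality (I.d (q - 1) q)
    rw [Category.assoc, d_proj _ _ _ _ rfl p _ q (q - 1) rfl (by simp), Preadditive.comp_add,
      ← Category.assoc, d_proj _ _ _ _ rfl p _ (q - 1) (q - 1 - 1) rfl (by simp),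
      Linear.comp_units_smul, ← Category.assoc,
      d_proj _ _ _ _ rfl (p + 1) _ q (q - 1) rfl (by simp)]
    simp only [Preadditive.add_comp, Category.assoc, h1, h2, comp_zero, Linear.units_smul_comp,
      smul_zero, zero_add, add_zero, zero_comp, h3]
    rw [Int.negOnePow_succ (n + 1)]
    simp

/-- Functoriality of the total Hom complex in each degree. -/
noncomputable def mapX {F F' I I' : CochainComplex C ℤ} (f : F' ⟶ F) (g : I ⟶ I') (n : ℤ) :
    X H F I n ⟶ X H F' I' n :=
  lift (fun p q => proj F I n p q ≫ (H.map (f.f p).op).app (I.X q) ≫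
    (H.obj (op (F'.X p))).map (g.f q))

lemma mapX_proj {F F' I I' : CochainComplex C ℤ} (f : F' ⟶ F) (g : I ⟶ I') (n p q : ℤ) :
    (mapX f g n : X H F I n ⟶ _) ≫ proj F' I' n p q =
      proj F I n p q ≫ (H.map (f.f p).op).app (I.X q) ≫ (H.obj (op (F'.X p))).map (g.f q) :=
  lift_proj _ _ _ (fun h => by rw [proj_eq_zero _ _ _ _ _ h, zero_comp])

lemma mapX_d {F F' I I' : CochainComplex C ℤ} (f : F' ⟶ F) (g : I ⟶ I') (n m : ℤ)
    (h : n + 1 = m) : (mapX f g n : X H F I n ⟶ _) ≫ d F' I' n m = d F I n m ≫ mapX f g m := by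
  refine hom_ext (fun p q _ => ?_)
  have h1 : (H.obj (op (F'.X p))).map (g.f (q - 1)) ≫ (H.obj (op (F'.X p))).map (I'.d (q - 1) q) =
      (H.obj (op (F'.X p))).map (I.d (q - 1) q) ≫ (H.obj (op (F'.X p))).map (g.f q) := by
    rw [← Functor.map_comp, g.comm, Functor.map_comp]
  have h2 : (H.map (F.d p (p + 1)).op).app (I.X q) ≫ (H.map (f.f p).op).app (I.X q) =
      (H.map (f.f (p + 1)).op).app (I.X q) ≫ (H.map (F'.d p (p + 1)).op).app (I.X q) := by
    rw [← NatTrans.comp_app, ← NatTrans.comp_app, ← Functor.map_comp, ← Functor.map_comp,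
      ← op_comp, ← op_comp, f.comm]
  have h3 := (H.map (F'.d p (p + 1)).op).naturality (g.f q)
  have h4 := (H.map (f.f p).op).naturality (I.d (q - 1) q)
  rw [Category.assoc, Category.assoc, d_proj _ _ _ _ h p _ q (q - 1) rfl (by simp), mapX_proj,
    ← Category.assoc (d F I n m), d_proj _ _ _ _ h p _ q (q - 1) rfl (by simp), Preadditive.comp_add, Linear.comp_units_smul, ← Category.assoc (mapX f g n),
    mapX_proj, ← Category.assoc (mapX f g n), mapX_proj]
  simp only [Preadditive.add_comp, Category.assoc, Linear.units_smul_comp, h1, h3,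
    reassoc_of% h2, reassoc_of% h4]

lemma mapX_id (F I : CochainComplex C ℤ) (n : ℤ) : mapX (𝟙 F) (𝟙 I) n = 𝟙 (X H F I n) := by
  refine hom_ext (fun p q _ => ?_)
  rw [mapX_proj]
  simp

lemma mapX_comp {F F' F'' I I' I'' : CochainComplex C ℤ} (f : F' ⟶ F) (f' : F'' ⟶ F')
    (g : I ⟶ I') (g' : I' ⟶ I'') (n : ℤ) :
    (mapX (f' ≫ f) (g ≫ g') n : X H F I n ⟶ _) = mapX f g n ≫ mapX f' g' n := by
  refine hom_ext (fun p q _ => ?_)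
  rw [mapX_proj, Category.assoc, mapX_proj, ← Category.assoc (mapX f g n), mapX_proj]
  simp

/-- Functoriality of the total Hom complex. -/
noncomputable def map (H : Cᵒᵖ ⥤ C ⥤ E) [H.Additive] [∀ X, (H.obj X).Additive]
    {F F' I I' : CochainComplex C ℤ} (f : F' ⟶ F) (g : I ⟶ I') :
    complex H F I ⟶ complex H F' I' where
  f n := mapX f g n
  comm' n m hnm := mapX_d f g n m hnm

lemma map_id (F I : CochainComplex C ℤ) : map H (𝟙 F) (𝟙 I) = 𝟙 _ := by
  ext n
  exact mapX_id F I n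

lemma map_comp {F F' F'' I I' I'' : CochainComplex C ℤ} (f : F' ⟶ F) (f' : F'' ⟶ F')
    (g : I ⟶ I') (g' : I' ⟶ I'') : map H (f' ≫ f) (g ≫ g') = map H f g ≫ map H f' g' := by
  ext n
  exact mapX_comp f f' g g' n

/-- The homotopy induced by a homotopy in the second variable. -/
noncomputable def homR (F : CochainComplex C ℤ) {I I' : CochainComplex C ℤ}
    {g g' : I ⟶ I'} (h : Homotopy g g') (n m : ℤ) : X H F I n ⟶ X H F I' m :=
  lift (fun p q => proj F I n p (q + 1) ≫ (H.obj (op (F.X p))).map (h.hom (q + 1) q))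

lemma homR_proj (F : CochainComplex C ℤ) {I I' : CochainComplex C ℤ}
    {g g' : I ⟶ I'} (h : Homotopy g g') (n m : ℤ) (hnm : m + 1 = n) (p q q' : ℤ)
    (hq : q + 1 = q') : (homR F h n m : X H F I n ⟶ _) ≫ proj F I' m p q =
      proj F I n p q' ≫ (H.obj (op (F.X p))).map (h.hom q' q) := by
  subst hq
  exact lift_proj _ _ _ (fun h => by rw [proj_eq_zero _ _ _ _ _ (by omega), zero_comp])

lemma homR_zero (F : CochainComplex C ℤ) {I I' : CochainComplex C ℤ}
    {g g' : I ⟶ I'} (h : Homotopy g g') (n m : ℤ) (hnm : m + 1 ≠ n) :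
    (homR F h n m : X H F I n ⟶ _) = 0 :=
  hom_ext (fun p q hpq => (lift_proj_of_eq _ p q hpq).trans
    (by rw [proj_eq_zero _ _ _ _ _ (by omega), zero_comp, zero_comp]))

lemma homR_comm (F : CochainComplex C ℤ) {I I' : CochainComplex C ℤ}
    {g g' : I ⟶ I'} (h : Homotopy g g') (n : ℤ) : (mapX (𝟙 F) g n : X H F I n ⟶ _) =
      d F I n (n + 1) ≫ homR F h (n + 1) n + homR F h n (n - 1) ≫ d F I' (n - 1) n +
        mapX (𝟙 F) g' n := by
  refine hom_ext (fun p q hpq => ?_)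
  have h1 := h.comm q
  rw [dNext_eq _ (show (ComplexShape.up ℤ).Rel q (q + 1) from rfl),
    prevD_eq _ (show (ComplexShape.up ℤ).Rel (q - 1) q from by simp)] at h1
  have h2 := congrArg (H.obj (op (F.X p))).map h1
  simp only [Functor.map_add, Functor.map_comp] at h2
  have h3 := (H.map (F.d p (p + 1)).op).naturality (h.hom (q + 1) q)
  simp only [Preadditive.add_comp, Category.assoc, mapX_proj]
  rw [homR_proj _ _ _ _ rfl p q _ rfl, d_proj _ _ _ _ (by omega) p _ q (q - 1) rfl (by simp),
    ← Category.assoc (d _ _ _ _), d_proj _ _ _ _ rfl p _ (q + 1) q rfl rfl, Preadditive.comp_add,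
    Linear.comp_units_smul, ← Category.assoc (homR _ _ _ _),
    homR_proj _ _ _ _ (by omega) p (q - 1) q (by simp),
    ← Category.assoc (homR _ _ _ _), homR_proj _ _ _ _ (by omega) (p + 1) q _ rfl]
  simp only [Preadditive.add_comp, Category.assoc, Linear.units_smul_comp, h2, h3,
    Preadditive.comp_add, HomologicalComplex.id_f, op_id,
    CategoryTheory.Functor.map_id, NatTrans.id_app, Category.id_comp, Int.negOnePow_succ, Units.neg_smul, Preadditive.neg_comp]
  abel

/-- The homotopy induced by a homotopy in the first variable. -/
noncomputable def homL {F F' : CochainComplex C ℤ} {f f' : F' ⟶ F} (h : Homotopy f f')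
    (I : CochainComplex C ℤ) (n m : ℤ) : X H F I n ⟶ X H F' I m :=
  lift (fun p q => n.negOnePow • (proj F I n (p - 1) q ≫
    (H.map (h.hom p (p - 1)).op).app (I.X q)))

lemma homL_proj {F F' : CochainComplex C ℤ} {f f' : F' ⟶ F} (h : Homotopy f f')
    (I : CochainComplex C ℤ) (n m : ℤ) (hnm : m + 1 = n) (p p' q : ℤ)
    (hp : p' + 1 = p) :
    (homL h I n m : X H F I n ⟶ _) ≫ proj F' I m p q = n.negOnePow • (proj F I n p' q ≫
      (H.map (h.hom p p').op).app (I.X q)) := by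
  obtain rfl : p' = p - 1 := by omega
  exact lift_proj _ _ _ (fun h => by rw [proj_eq_zero _ _ _ _ _ (by omega), zero_comp, smul_zero])

lemma homL_zero {F F' : CochainComplex C ℤ} {f f' : F' ⟶ F} (h : Homotopy f f')
    (I : CochainComplex C ℤ) (n m : ℤ) (hnm : m + 1 ≠ n) :
    (homL h I n m : X H F I n ⟶ _) = 0 :=
  hom_ext (fun p q hpq => (lift_proj_of_eq _ p q hpq).trans
    (by rw [proj_eq_zero _ _ _ _ _ (by omega), zero_comp, zero_comp, smul_zero]))

lemma homL_comm {F F' : CochainComplex C ℤ} {f f' : F' ⟶ F} (h : Homotopy f f')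
    (I : CochainComplex C ℤ) (n : ℤ) : (mapX f (𝟙 I) n : X H F I n ⟶ _) =
      d F I n (n + 1) ≫ homL h I (n + 1) n + homL h I n (n - 1) ≫ d F' I (n - 1) n +
        mapX f' (𝟙 I) n := by
  refine hom_ext (fun p q hpq => ?_)
  have h1 := h.comm p
  rw [dNext_eq _ (show (ComplexShape.up ℤ).Rel p (p + 1) from rfl),
    prevD_eq _ (show (ComplexShape.up ℤ).Rel (p - 1) p from by simp)] at h1
  have h2 : (H.map (f.f p).op).app (I.X q) =
      (H.map (h.hom (p + 1) p).op).app (I.X q) ≫ (H.map (F'.d p (p + 1)).op).app (I.X q) +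
      (H.map (F.d (p - 1) p).op).app (I.X q) ≫ (H.map (h.hom p (p - 1)).op).app (I.X q) +
      (H.map (f'.f p).op).app (I.X q) := by
    rw [h1]
    simp [op_add, Functor.map_add]
  have h3 := (H.map (h.hom p (p - 1)).op).naturality (I.d (q - 1) q)
  simp only [Preadditive.add_comp, Category.assoc, mapX_proj]
  rw [homL_proj _ _ _ _ rfl p (p - 1) q (by simp),
    d_proj _ _ _ _ (by omega) p _ q (q - 1) rfl (by simp), Linear.comp_units_smul,
    ← Category.assoc (d _ _ _ _), d_proj _ _ _ _ rfl (p - 1) p q (q - 1) (by simp) (by simp),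
    Preadditive.comp_add, Linear.comp_units_smul,
    ← Category.assoc (homL _ _ _ _), homL_proj _ _ _ _ (by omega) p (p - 1) (q - 1) (by simp),
    ← Category.assoc (homL _ _ _ _), homL_proj _ _ _ _ (by omega) (p + 1) p q rfl]
  simp only [Preadditive.add_comp, Category.assoc, Linear.units_smul_comp, h2, h3,
    Preadditive.comp_add, HomologicalComplex.id_f,
    CategoryTheory.Functor.map_id, Category.comp_id, Int.negOnePow_succ, Units.neg_smul, smul_add, Preadditive.neg_comp,
    smul_neg, smul_smul, neg_mul, Int.units_mul_self, one_smul, neg_neg]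
  abel

/-- The total Hom complex is compatible with homotopies in the second variable. -/
noncomputable def homotopyRight (F : CochainComplex C ℤ) {I I' : CochainComplex C ℤ}
    {g g' : I ⟶ I'} (h : Homotopy g g') : Homotopy (map H (𝟙 F) g) (map H (𝟙 F) g') where
  hom n m := homR F h n m
  zero n m hnm := homR_zero F h n m hnm
  comm n := (homR_comm F h n).trans (congrArg₂ (· + ·) (congrArg₂ (· + ·)
    (dNext_eq (C := complex H F I) (D := complex H F I') (fun n m => homR F h n m)
      (show (ComplexShape.up ℤ).Rel n (n + 1) from rfl)).symm
    (prevD_eq (C := complex H F I) (D := complex H F I') (fun n m => homR F h n m)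
      (show (ComplexShape.up ℤ).Rel (n - 1) n from by simp)).symm) rfl)

/-- The total Hom complex is compatible with homotopies in the first variable. -/
noncomputable def homotopyLeft {F F' : CochainComplex C ℤ} {f f' : F' ⟶ F} (h : Homotopy f f')
    (I : CochainComplex C ℤ) : Homotopy (map H f (𝟙 I)) (map H f' (𝟙 I)) where
  hom n m := homL h I n m
  zero n m hnm := homL_zero h I n m hnm
  comm n := (homL_comm h I n).trans (congrArg₂ (· + ·) (congrArg₂ (· + ·)
    (dNext_eq (C := complex H F I) (D := complex H F' I) (fun n m => homL h I n m)
      (show (ComplexShape.up ℤ).Rel n (n + 1) from rfl)).symm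
    (prevD_eq (C := complex H F I) (D := complex H F' I) (fun n m => homL h I n m)
      (show (ComplexShape.up ℤ).Rel (n - 1) n from by simp)).symm) rfl)

/-- The total Hom complex as a functor of the second variable. -/
noncomputable def functor (H : Cᵒᵖ ⥤ C ⥤ E) [H.Additive] [∀ X, (H.obj X).Additive]
    (F : CochainComplex C ℤ) : CochainComplex C ℤ ⥤ CochainComplex E ℤ where
  obj I := complex H F I
  map g := map H (𝟙 F) g
  map_id I := map_id F I
  map_comp g g' := by rw [← map_comp, Category.id_comp]

/-- The total Hom complex on the homotopy category, as a functor of the second variable. -/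
noncomputable def functorK (H : Cᵒᵖ ⥤ C ⥤ E) [H.Additive] [∀ X, (H.obj X).Additive]
    (F : CochainComplex C ℤ) :
    HomotopyCategory C (.up ℤ) ⥤ HomotopyCategory E (.up ℤ) :=
  CategoryTheory.Quotient.lift _ (functor H F ⋙ HomotopyCategory.quotient _ _)
    (fun _ _ _ _ ⟨h⟩ => HomotopyCategory.eq_of_homotopy _ _ (homotopyRight F h))

/-- The naturality of `functorK` in the first variable. -/
noncomputable def functorKMap (H : Cᵒᵖ ⥤ C ⥤ E) [H.Additive] [∀ X, (H.obj X).Additive]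
    {F F' : CochainComplex C ℤ} (f : F' ⟶ F) : functorK H F ⟶ functorK H F' where
  app L := (HomotopyCategory.quotient _ _).map (map H f (𝟙 L.as))
  naturality L L' g := by
    obtain ⟨g, rfl⟩ := (HomotopyCategory.quotient _ _).map_surjective g
    refine ((HomotopyCategory.quotient E (.up ℤ)).map_comp (map H (𝟙 F) g)
      (map H f (𝟙 L'.as))).symm.trans (Eq.trans (congrArg _ ?_)
        ((HomotopyCategory.quotient E (.up ℤ)).map_comp (map H f (𝟙 L.as)) (map H (𝟙 F') g)))
    refine (map_comp _ _ _ _).symm.trans (Eq.trans ?_ (map_comp _ _ _ _))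
    exact congrArg₂ (map H) ((Category.comp_id _).trans (Category.id_comp _).symm)
      ((Category.comp_id g).trans (Category.id_comp g).symm)

/-- The total Hom complex on homotopy categories, as a bifunctor. -/
noncomputable def bifunctorK (H : Cᵒᵖ ⥤ C ⥤ E) [H.Additive] [∀ X, (H.obj X).Additive] :
    (HomotopyCategory C (.up ℤ))ᵒᵖ ⥤ HomotopyCategory C (.up ℤ) ⥤ HomotopyCategory E (.up ℤ) :=
  (CategoryTheory.Quotient.lift (homotopic C (.up ℤ))
    { obj := fun F => op (functorK H F)
      map := fun f => (functorKMap H f).op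
      map_id := fun F => congrArg Quiver.Hom.op (by
        ext L
        exact (congrArg _ (map_id F L.as)).trans ((HomotopyCategory.quotient E (.up ℤ)).map_id _))
      map_comp := fun f f' => congrArg Quiver.Hom.op (by
        ext L
        refine Eq.trans ?_ ((HomotopyCategory.quotient E (.up ℤ)).map_comp _ _)
        refine congrArg _ (Eq.trans ?_ (map_comp _ _ _ _))
        rw [Category.id_comp]) }
    (fun _ _ _ _ ⟨h⟩ => congrArg Quiver.Hom.op (by
      ext L
      exact HomotopyCategory.eq_of_homotopy _ _ (homotopyLeft h L.as)))).leftOp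

end TotHom

namespace SheafDuality

open TopologicalSpace Opposite

/-- The category of sheaves of abelian groups on a topological space. -/
abbrev Sh (X : TopCat.{u}) := Sheaf (Opens.grothendieckTopology X) AddCommGrpCat.{u}

section sheafHom

variable {X : TopCat.{u}}

/-- The presheaf `U ↦ Hom(F|_U, G|_U)` of abelian groups. -/
def homPresheaf (F G : (Opens X)ᵒᵖ ⥤ AddCommGrpCat.{u}) : (Opens X)ᵒᵖ ⥤ AddCommGrpCat.{u} where
  obj U := AddCommGrpCat.of ((Over.forget U.unop).op ⋙ F ⟶ (Over.forget U.unop).op ⋙ G)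
  map f := AddCommGrpCat.ofHom
    { toFun := fun φ => Functor.whiskerLeft (Over.map f.unop).op φ
      map_zero' := rfl
      map_add' := fun _ _ => rfl }
  map_id U := AddCommGrpCat.hom_ext (AddMonoidHom.ext fun φ =>
    ConcreteCategory.congr_hom ((presheafHom F G).map_id U) φ)
  map_comp f g := AddCommGrpCat.hom_ext (AddMonoidHom.ext fun φ =>
    ConcreteCategory.congr_hom ((presheafHom F G).map_comp f g) φ)

lemma homPresheaf_isSheaf (F G : (Opens X)ᵒᵖ ⥤ AddCommGrpCat.{u})
    (hG : Presheaf.IsSheaf (Opens.grothendieckTopology X) G) :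
    Presheaf.IsSheaf (Opens.grothendieckTopology X) (homPresheaf F G) := by
  rw [Presheaf.isSheaf_iff_isSheaf_forget _ _ (forget AddCommGrpCat.{u})]
  exact Presheaf.IsSheaf.hom F G hG

/-- The sheaf of homomorphisms from `F` to `G`, with sections `Hom(F|_U, G|_U)` over `U`. -/
def sheafHomObj (F G : Sh X) : Sh X where
  obj := homPresheaf F.obj G.obj
  property := homPresheaf_isSheaf F.obj G.obj G.property

/-- Functoriality of the sheaf of homomorphisms: `φ ↦ g ∘ φ ∘ f`. -/
def sheafHomMap {F F' G G' : Sh X} (f : F' ⟶ F) (g : G ⟶ G') :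
    sheafHomObj F G ⟶ sheafHomObj F' G' where
  hom :=
    { app := fun U => AddCommGrpCat.ofHom
        (X := (Over.forget U.unop).op ⋙ F.obj ⟶ (Over.forget U.unop).op ⋙ G.obj)
        (Y := (Over.forget U.unop).op ⋙ F'.obj ⟶ (Over.forget U.unop).op ⋙ G'.obj)
        { toFun := fun φ => Functor.whiskerLeft _ f.hom ≫ φ ≫ Functor.whiskerLeft _ g.hom
          map_zero' := by simp
          map_add' := by simp }
      naturality := fun _ _ _ => rfl }

lemma sheafHom_ext {F G : Sh X} {H : Sh X} {a b : H ⟶ sheafHomObj F G}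
    (h : ∀ (U : (Opens X)ᵒᵖ) (φ : H.obj.obj U) (V : (Over U.unop)ᵒᵖ),
      NatTrans.app (C := (Over U.unop)ᵒᵖ) (D := AddCommGrpCat.{u})
          (F := (Over.forget U.unop).op ⋙ F.obj) (G := (Over.forget U.unop).op ⋙ G.obj)
          ((a.hom.app U).hom φ) V =
        NatTrans.app (C := (Over U.unop)ᵒᵖ) (D := AddCommGrpCat.{u})
          (F := (Over.forget U.unop).op ⋙ F.obj) (G := (Over.forget U.unop).op ⋙ G.obj)
          ((b.hom.app U).hom φ) V) : a = b :=
  Sheaf.hom_ext (NatTrans.ext (funext fun U => AddCommGrpCat.hom_ext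
    (AddMonoidHom.ext fun φ => NatTrans.ext (funext fun V => h U φ V))))

lemma sheafHomMap_id (F G : Sh X) : sheafHomMap (𝟙 F) (𝟙 G) = 𝟙 _ :=
  sheafHom_ext (fun _ _ _ => (Category.id_comp _).trans (Category.comp_id _))

lemma sheafHomMap_comp {F F' F'' G G' G'' : Sh X} (f : F' ⟶ F) (f' : F'' ⟶ F') (g : G ⟶ G')
    (g' : G' ⟶ G'') : sheafHomMap (f' ≫ f) (g ≫ g') = sheafHomMap f g ≫ sheafHomMap f' g' := by
  refine sheafHom_ext (fun U φ V => ?_)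
  let x : F.obj.obj (op V.unop.left) ⟶ G.obj.obj (op V.unop.left) :=
    NatTrans.app (C := (Over U.unop)ᵒᵖ) (D := AddCommGrpCat.{u})
      (F := (Over.forget U.unop).op ⋙ F.obj) (G := (Over.forget U.unop).op ⋙ G.obj) φ V
  change (f'.hom.app (op V.unop.left) ≫ f.hom.app (op V.unop.left)) ≫ x ≫
    (g.hom.app (op V.unop.left) ≫ g'.hom.app (op V.unop.left)) =
    f'.hom.app (op V.unop.left) ≫ (f.hom.app (op V.unop.left) ≫ x ≫
      g.hom.app (op V.unop.left)) ≫ g'.hom.app (op V.unop.left)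
  simp only [Category.assoc]

/-- The sheaf of homomorphisms as a bifunctor. -/
def sheafHom (X : TopCat.{u}) : (Sh X)ᵒᵖ ⥤ Sh X ⥤ Sh X where
  obj F :=
    { obj := fun G => sheafHomObj F.unop G
      map := fun g => sheafHomMap (𝟙 F.unop) g
      map_id := fun G => sheafHomMap_id F.unop G
      map_comp := fun g g' => by rw [← sheafHomMap_comp, Category.comp_id] }
  map f :=
    { app := fun G => sheafHomMap f.unop (𝟙 G)
      naturality := fun G G' g => by
        rw [← sheafHomMap_comp, ← sheafHomMap_comp]
        simp }
  map_id F := by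
    ext1
    funext G
    exact sheafHomMap_id F.unop G
  map_comp f f' := by
    ext1
    funext G
    exact (congrArg (sheafHomMap (f'.unop ≫ f.unop)) (Category.comp_id (𝟙 G)).symm).trans
      (sheafHomMap_comp f.unop f'.unop (𝟙 G) (𝟙 G))

instance : (sheafHom X).Additive where
  map_add {F F' f g} := by
    ext1
    funext G
    refine sheafHom_ext (fun U φ V => ?_)
    exact Preadditive.add_comp _ _ _ _ _ _

instance (F : (Sh X)ᵒᵖ) : ((sheafHom X).obj F).Additive where
  map_add {G G' f g} := by
    refine sheafHom_ext (fun U φ V => ?_)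
    let x : F.unop.obj.obj (op V.unop.left) ⟶ G.obj.obj (op V.unop.left) :=
      NatTrans.app (C := (Over U.unop)ᵒᵖ) (D := AddCommGrpCat.{u})
        (F := (Over.forget U.unop).op ⋙ F.unop.obj) (G := (Over.forget U.unop).op ⋙ G.obj) φ V
    change 𝟙 _ ≫ x ≫ (f.hom.app (op V.unop.left) + g.hom.app (op V.unop.left)) =
      𝟙 _ ≫ x ≫ f.hom.app (op V.unop.left) + 𝟙 _ ≫ x ≫ g.hom.app (op V.unop.left)
    simp only [Preadditive.comp_add]

end sheafHom

section

variable (X : TopCat.{u})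

noncomputable instance : PreservesFiniteLimits
    (constantSheaf (Opens.grothendieckTopology X) AddCommGrpCat.{u}) := by
  dsimp only [constantSheaf]
  infer_instance

/-- The functor of global sections. -/
abbrev globalSections : Sh X ⥤ AddCommGrpCat.{u} :=
  (sheafSections (Opens.grothendieckTopology X) AddCommGrpCat.{u}).obj (op ⊤)

instance : (globalSections X).Additive where
  map_add := rfl

instance {C : Type u} [Category.{v} C] [Preadditive C] :
    (preadditiveCoyoneda (C := C)).Additive where
  map_add := by
    intro _ _ f g
    ext
    exact Preadditive.add_comp _ _ _ _ _ _

end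
end SheafDuality

namespace DerivedCategory

section

variable (C : Type*) [Category* C] [Abelian C] [HasDerivedCategory C]
  [(Qh : HomotopyCategory C (ComplexShape.up ℤ) ⥤ DerivedCategory C).IsLeftAdjoint]

/-- The K-injective resolution functor `D(C) ⥤ K(C)`, i.e. the right adjoint of the localization
functor `K(C) ⥤ D(C)`. -/
noncomputable def injRes : DerivedCategory C ⥤ HomotopyCategory C (ComplexShape.up ℤ) :=
  Functor.rightAdjoint Qh

variable {C} {E : Type*} [Category* E] [Abelian E] [HasDerivedCategory E]

/-- The right derived functor of an additive functor `Γ` on unbounded derived categories, computed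
with K-injective resolutions. -/
noncomputable def rightDerived (Γ : C ⥤ E) [Γ.Additive] : DerivedCategory C ⥤ DerivedCategory E :=
  injRes C ⋙ Γ.mapHomotopyCategory (ComplexShape.up ℤ) ⋙ Qh

/-- The right derived functor of a bifunctor `H` of Hom type: `(F, G)` is sent to the total
Hom complex of (representatives of) `F` and `G`, the representative of `G` being K-injective. -/
noncomputable def rightDerivedHom [HasCountableProducts E] (H : Cᵒᵖ ⥤ C ⥤ E) [H.Additive]
    [∀ A, (H.obj A).Additive] :
    (DerivedCategory C)ᵒᵖ ⥤ DerivedCategory C ⥤ DerivedCategory E :=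
  (injRes C).op ⋙ TotHom.bifunctorK H ⋙ (Functor.whiskeringLeft _ _ _).obj (injRes C) ⋙
    (Functor.whiskeringRight _ _ _).obj Qh

end

end DerivedCategory

namespace SheafDuality

open TopologicalSpace Opposite DerivedCategory

section

variable (X : TopCat.{u}) [HasDerivedCategory.{v} (Sh X)] [HasDerivedCategory.{w} AddCommGrpCat.{u}]

/-- The functor `π_X⁻¹ : D(ℤ) ⥤ D(X)`, which sends a complex of abelian groups to the
corresponding complex of constant sheaves. -/
noncomputable def piInv : DerivedCategory AddCommGrpCat.{u} ⥤ DerivedCategory (Sh X) :=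
  (constantSheaf (Opens.grothendieckTopology X) AddCommGrpCat.{u}).mapDerivedCategory

/-- The derived functor `RΓ(X, -) : D(X) ⥤ D(ℤ)` of global sections. -/
noncomputable def RΓ : DerivedCategory (Sh X) ⥤ DerivedCategory AddCommGrpCat.{u} :=
  rightDerived (globalSections X)

/-- The derived complex of sheaves of homomorphisms. -/
noncomputable def RHHom :
    (DerivedCategory (Sh X))ᵒᵖ ⥤ DerivedCategory (Sh X) ⥤ DerivedCategory (Sh X) :=
  rightDerivedHom (sheafHom X)

/-- The derived complex of homomorphisms in `D(ℤ)`. -/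
noncomputable def RHom : (DerivedCategory AddCommGrpCat.{u})ᵒᵖ ⥤
    DerivedCategory AddCommGrpCat.{u} ⥤ DerivedCategory AddCommGrpCat.{u} :=
  rightDerivedHom preadditiveCoyoneda

/-- The abelian group `ℤ`. -/
abbrev ZZ : AddCommGrpCat.{u} := AddCommGrpCat.of (ULift.{u} ℤ)

/-- An abelian group as an object of `D(ℤ)`, in degree `0`. -/
noncomputable abbrev single (G : AddCommGrpCat.{u}) : DerivedCategory AddCommGrpCat.{u} :=
  (singleFunctor AddCommGrpCat.{u} 0).obj G

/-- The derived dual `K ↦ RHom(K, ℤ)` on `D(ℤ)`. -/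
noncomputable def dual :
    (DerivedCategory AddCommGrpCat.{u})ᵒᵖ ⥤ DerivedCategory AddCommGrpCat.{u} :=
  RHom.flip.obj (single ZZ)

/-- The derived dual `F ↦ RHHom(F, ℤ)` on `D(X)`. -/
noncomputable def sheafDual : (DerivedCategory (Sh X))ᵒᵖ ⥤ DerivedCategory (Sh X) :=
  (RHHom X).flip.obj ((piInv X).obj (single ZZ))

/-- The cohomology `H^i(X, F)` for `F` in `D(X)`. -/
noncomputable def cohomology (i : ℤ) : DerivedCategory (Sh X) ⥤ AddCommGrpCat.{u} :=
  RΓ X ⋙ homologyFunctor AddCommGrpCat.{u} i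

/-- `X` is cohomologically trivial if `H^i(X, G) = 0` for all `i > 0` and all abelian groups `G`. -/
def IsCohomologicallyTrivial : Prop :=
  ∀ i : ℤ, 0 < i → ∀ G : AddCommGrpCat.{u},
    IsZero ((cohomology X i).obj ((piInv X).obj (single G)))

variable [(piInv X).IsRightAdjoint]

/-- The functor `𝕃(X, -)`, the left adjoint of `π_X⁻¹`. -/
noncomputable def LL : DerivedCategory (Sh X) ⥤ DerivedCategory AddCommGrpCat.{u} :=
  (piInv X).leftAdjoint

/-- The homology `H_i(X, F) = H^{-i}(𝕃(X, F))`. -/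
noncomputable def homology (i : ℤ) : DerivedCategory (Sh X) ⥤ AddCommGrpCat.{u} :=
  LL X ⋙ homologyFunctor AddCommGrpCat.{u} (-i)

end

end SheafDuality

open SheafDuality

/-!
The duality rests on three comparisons of derived functors.

*Derived global sections of derived homomorphisms.* For K-injective complexes of sheaves `F` and `I`,
the global sections of the complex `Hom(F, I)` of sheaves form the complex of homomorphisms from `F`
to `I`. The isomorphism `RΓ(X, RHHom(F, I)) ≅ RHom_X(F, I)` follows once `Hom(F, I)` is known to
compute its own derived global sections (`quasiIso_sections_map`), although it need not be K-injective.
This is proved without flat resolutions. If `P` is a K-projective complex of presheaves whose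
sheafification `aP` is acyclic, then every morphism from `aP` to `Hom(F, I)` is null-homotopic
(`nonempty_homotopy_zero_sheafHom`): exchanging the variables, it suffices to show that every morphism
`F ⟶ Hom(aP, I)` is null-homotopic, and `Hom(aP, I)` is contractible, since its sections over open
subsets are acyclic. An acyclic complex of sheaves which is orthogonal to all such `aP` is acyclic as a
complex of presheaves (`acyclic_toPSh_of_orthogonal`), so that its sections over any open subset are
acyclic. This applies to the mapping cone of a K-injective resolution of `Hom(F, I)`.

*The derived adjunction.* The exact functor `π⁻¹` acts on derived complexes of homomorphisms
(`mapDerivedHom`), and composition with the unit of the adjunction gives a natural transformation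
`RHom(L F, G) ⟶ RHom_X(F, π⁻¹ G)`. The cohomology of a derived complex of homomorphisms in degree `n`
is the group of morphisms to the `n`-th shift in the derived category (`homologyDerivedHom`), and
there the natural transformation is the bijection given by the adjunction. Hence it is an isomorphism.

*Homomorphisms from the constant sheaf `ℤ`.* The complex of homomorphisms from `ℤ` to `I` is the
complex of global sections of `I`.

The universal coefficient sequence is obtained for every complex `K` of abelian groups from a short
exact sequence `0 ⟶ G ⟶ J₀ ⟶ J₁ ⟶ 0` with `J₀` and `J₁` injective. In the derived category,
morphisms from `K` to an injective object placed in degree `n` are morphisms from the cohomology of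
`K` in degree `n` (`homologyToSingle_bijective`), and the long exact sequence of `Hom(K, -)` yields
the result. The sequence splits because the identity of the cohomology in degree `n` is induced by a
morphism from `K` to this cohomology placed in degree `n`.

For the criterion of cohomological triviality, the universal coefficient sequence with coefficients
`G` reduces everything to the vanishing of the extensions of `H₀(X, ℤ)` by `G`. Homomorphisms from
`H₀(X, ℤ)` to an injective group `J` are global sections of the constant sheaf `J`, and a surjection of
groups induces a surjection on global sections of constant sheaves, as it has a set-theoretic section
(`epi_globalSections_map_constantSheaf_map`).
-/

universe w' w''

/-! ### Total Hom complexes -/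

namespace TotHom

open Opposite

section api

variable {C : Type*} [Category* C] [Preadditive C]
  {E : Type*} [Category* E] [Preadditive E] [HasCountableProducts E]
  {H : Cᵒᵖ ⥤ C ⥤ E} [H.Additive] [∀ X, (H.obj X).Additive]

/-- The components of the total Hom complex, as morphisms whose source is a term of the complex. -/
noncomputable def π (F I : CochainComplex C ℤ) (n p q : ℤ) :
    (complex H F I).X n ⟶ (H.obj (op (F.X p))).obj (I.X q) := proj F I n p q

/-- A morphism to a term of the total Hom complex, given by its components. -/
noncomputable def desc {F I : CochainComplex C ℤ} {n : ℤ} {Z : E}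
    (f : ∀ p q : ℤ, Z ⟶ (H.obj (op (F.X p))).obj (I.X q)) : Z ⟶ (complex H F I).X n := lift f

lemma π_eq_zero (F I : CochainComplex C ℤ) (n p q : ℤ) (h : p + n ≠ q) :
    π (H := H) F I n p q = 0 := proj_eq_zero F I n p q h

lemma desc_π {F I : CochainComplex C ℤ} {n : ℤ} {Z : E}
    (f : ∀ p q : ℤ, Z ⟶ (H.obj (op (F.X p))).obj (I.X q)) (p q : ℤ) (h : p + n ≠ q → f p q = 0) :
    (desc f : Z ⟶ (complex H F I).X n) ≫ π F I n p q = f p q := lift_proj f p q h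

lemma desc_π_of_eq {F I : CochainComplex C ℤ} {n : ℤ} {Z : E}
    (f : ∀ p q : ℤ, Z ⟶ (H.obj (op (F.X p))).obj (I.X q)) (p q : ℤ) (h : p + n = q) :
    (desc f : Z ⟶ (complex H F I).X n) ≫ π F I n p q = f p q := lift_proj_of_eq f p q h

lemma ext_π {F I : CochainComplex C ℤ} {n : ℤ} {Z : E} {f g : Z ⟶ (complex H F I).X n}
    (h : ∀ p q, p + n = q → f ≫ π F I n p q = g ≫ π F I n p q) : f = g := hom_ext h

lemma d_π (F I : CochainComplex C ℤ) (n m : ℤ) (h : n + 1 = m) (p p' q q' : ℤ)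
    (hp : p + 1 = p') (hq : q' + 1 = q) :
    (complex H F I).d n m ≫ π F I m p q =
      π F I n p q' ≫ (H.obj (op (F.X p))).map (I.d q' q) +
      m.negOnePow • (π F I n p' q ≫ (H.map (F.d p p').op).app (I.X q)) :=
  d_proj F I n m h p p' q q' hp hq

lemma map_f_π {F I F₁ I₁ : CochainComplex C ℤ} (f : F₁ ⟶ F) (g : I ⟶ I₁) (n p q : ℤ) :
    (map H f g).f n ≫ π F₁ I₁ n p q =
      π F I n p q ≫ (H.map (f.f p).op).app (I.X q) ≫ (H.obj (op (F₁.X p))).map (g.f q) :=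
  mapX_proj f g n p q

end api

section complexMap

variable {C : Type*} [Category* C] [Preadditive C] {C' : Type*} [Category* C'] [Preadditive C']
  {E : Type*} [Category* E] [Preadditive E] [HasCountableProducts E]
  {H : Cᵒᵖ ⥤ C ⥤ E} [H.Additive] [∀ X, (H.obj X).Additive]
  {H' : C'ᵒᵖ ⥤ C' ⥤ E} [H'.Additive] [∀ X, (H'.obj X).Additive]

/-- A morphism between total Hom complexes with respect to two bifunctors, given by a family of
morphisms between their components which is compatible with the differentials. -/
noncomputable def complexMap {F I : CochainComplex C ℤ} {F' I' : CochainComplex C' ℤ}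
    (φ : ∀ p q, (H.obj (op (F.X p))).obj (I.X q) ⟶ (H'.obj (op (F'.X p))).obj (I'.X q))
    (hI : ∀ p q q', (H.obj (op (F.X p))).map (I.d q q') ≫ φ p q' =
      φ p q ≫ (H'.obj (op (F'.X p))).map (I'.d q q'))
    (hF : ∀ p p' q, (H.map (F.d p p').op).app (I.X q) ≫ φ p q =
      φ p' q ≫ (H'.map (F'.d p p').op).app (I'.X q)) :
    complex H F I ⟶ complex H' F' I' where
  f n := desc (fun p q => π F I n p q ≫ φ p q)
  comm' n m hnm := by
    have hL (n p q : ℤ) : (desc (fun p q => π F I n p q ≫ φ p q) :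
        (complex H F I).X n ⟶ (complex H' F' I').X n) ≫ π F' I' n p q = π F I n p q ≫ φ p q :=
      desc_π _ _ _ (fun h => by rw [π_eq_zero _ _ _ _ _ h, zero_comp])
    refine ext_π (fun p q _ => ?_)
    rw [Category.assoc, Category.assoc, d_π _ _ _ _ hnm p _ q (q - 1) rfl (by simp), hL,
      ← Category.assoc ((complex H F I).d n m), d_π _ _ _ _ hnm p _ q (q - 1) rfl (by simp),
      Preadditive.comp_add, Linear.comp_units_smul, ← Category.assoc (desc _), hL,
      ← Category.assoc (desc _), hL]
    simp only [Preadditive.add_comp, Category.assoc, Linear.units_smul_comp, hI, hF]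

variable {F I : CochainComplex C ℤ} {F' I' : CochainComplex C' ℤ}
    (φ : ∀ p q, (H.obj (op (F.X p))).obj (I.X q) ⟶ (H'.obj (op (F'.X p))).obj (I'.X q))
    (hI : ∀ p q q', (H.obj (op (F.X p))).map (I.d q q') ≫ φ p q' =
      φ p q ≫ (H'.obj (op (F'.X p))).map (I'.d q q'))
    (hF : ∀ p p' q, (H.map (F.d p p').op).app (I.X q) ≫ φ p q =
      φ p' q ≫ (H'.map (F'.d p p').op).app (I'.X q))

lemma complexMap_f_π (n p q : ℤ) :
    (complexMap φ hI hF).f n ≫ π F' I' n p q = π F I n p q ≫ φ p q :=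
  desc_π (fun p q => π F I n p q ≫ φ p q) p q
    (fun h => by rw [π_eq_zero _ _ _ _ _ h, zero_comp])

lemma isIso_complexMap (h : ∀ p q, IsIso (φ p q)) : IsIso (complexMap φ hI hF) := by
  refine ⟨complexMap (fun p q => inv (φ p q)) (fun p q q' => ?_) (fun p p' q => ?_), ?_, ?_⟩
  · rw [IsIso.eq_inv_comp, ← Category.assoc, ← hI, Category.assoc, IsIso.hom_inv_id,
      Category.comp_id]
  · rw [IsIso.eq_inv_comp, ← Category.assoc, ← hF, Category.assoc, IsIso.hom_inv_id,
      Category.comp_id]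
  · ext n
    refine ext_π (fun p q _ => ?_)
    rw [HomologicalComplex.comp_f, Category.assoc, complexMap_f_π, ← Category.assoc,
      complexMap_f_π, Category.assoc, IsIso.hom_inv_id, Category.comp_id,
      HomologicalComplex.id_f, Category.id_comp]
  · ext n
    refine ext_π (fun p q _ => ?_)
    rw [HomologicalComplex.comp_f, Category.assoc, complexMap_f_π, ← Category.assoc,
      complexMap_f_π, Category.assoc, IsIso.inv_hom_id, Category.comp_id,
      HomologicalComplex.id_f, Category.id_comp]

lemma complexMap_naturality {F₁ I₁ : CochainComplex C ℤ} {F₁' I₁' : CochainComplex C' ℤ}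
    (φ₁ : ∀ p q, (H.obj (op (F₁.X p))).obj (I₁.X q) ⟶ (H'.obj (op (F₁'.X p))).obj (I₁'.X q))
    (hI₁ : ∀ p q q', (H.obj (op (F₁.X p))).map (I₁.d q q') ≫ φ₁ p q' =
      φ₁ p q ≫ (H'.obj (op (F₁'.X p))).map (I₁'.d q q'))
    (hF₁ : ∀ p p' q, (H.map (F₁.d p p').op).app (I₁.X q) ≫ φ₁ p q =
      φ₁ p' q ≫ (H'.map (F₁'.d p p').op).app (I₁'.X q))
    (f : F₁ ⟶ F) (g : I ⟶ I₁) (f' : F₁' ⟶ F') (g' : I' ⟶ I₁')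
    (h : ∀ p q, (H.map (f.f p).op).app (I.X q) ≫ (H.obj (op (F₁.X p))).map (g.f q) ≫ φ₁ p q =
      φ p q ≫ (H'.map (f'.f p).op).app (I'.X q) ≫ (H'.obj (op (F₁'.X p))).map (g'.f q)) :
    map H f g ≫ complexMap φ₁ hI₁ hF₁ = complexMap φ hI hF ≫ map H' f' g' := by
  ext n
  refine ext_π (fun p q _ => ?_)
  rw [HomologicalComplex.comp_f, HomologicalComplex.comp_f, Category.assoc, Category.assoc,
    complexMap_f_π, map_f_π, ← Category.assoc, map_f_π,
    ← Category.assoc ((complexMap φ hI hF).f n), complexMap_f_π, Category.assoc, Category.assoc,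
    Category.assoc, h]

end complexMap

section postcomp

variable {C : Type*} [Category* C] [Preadditive C]
  {E : Type*} [Category* E] [Preadditive E] [HasCountableProducts E]
  {E' : Type*} [Category* E'] [Preadditive E'] [HasCountableProducts E']
  (H : Cᵒᵖ ⥤ C ⥤ E) [H.Additive] [∀ X, (H.obj X).Additive]
  (Φ : E ⥤ E') [Φ.Additive]

/-- The composition of a bifunctor with a functor. -/
abbrev postcomp : Cᵒᵖ ⥤ C ⥤ E' := H ⋙ (Functor.whiskeringRight _ _ _).obj Φ

instance : (postcomp H Φ).Additive where
  map_add {X Y f g} := by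
    ext A
    dsimp
    rw [H.map_add]
    exact Φ.map_add

instance (X : Cᵒᵖ) : ((postcomp H Φ).obj X).Additive where
  map_add {A B f g} := by
    dsimp
    rw [(H.obj X).map_add, Φ.map_add]

/-- The comparison morphism expressing the compatibility of the total Hom complex with an additive
functor, in each degree. -/
noncomputable def postcompX (F I : CochainComplex C ℤ) (n : ℤ) :
    Φ.obj ((complex H F I).X n) ⟶ (complex (postcomp H Φ) F I).X n :=
  desc (fun p q => Φ.map (π F I n p q))

lemma postcompX_π (F I : CochainComplex C ℤ) (n p q : ℤ) :
    postcompX H Φ F I n ≫ π F I n p q = Φ.map (π F I n p q) :=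
  desc_π (H := postcomp H Φ) (fun p q => Φ.map (π F I n p q)) p q
    (fun h => by rw [π_eq_zero _ _ _ _ _ h, Φ.map_zero])

lemma postcompX_d (F I : CochainComplex C ℤ) (n m : ℤ) (h : n + 1 = m) :
    postcompX H Φ F I n ≫ (complex (postcomp H Φ) F I).d n m =
      Φ.map ((complex H F I).d n m) ≫ postcompX H Φ F I m := by
  refine ext_π (fun p q _ => ?_)
  rw [Category.assoc, Category.assoc, d_π _ _ _ _ h p _ q (q - 1) rfl (by simp), postcompX_π,
    ← Φ.map_comp, d_π _ _ _ _ h p _ q (q - 1) rfl (by simp), Preadditive.comp_add,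
    Linear.comp_units_smul, ← Category.assoc (postcompX _ _ _ _ _), postcompX_π,
    ← Category.assoc (postcompX _ _ _ _ _), postcompX_π, Φ.map_add, Functor.map_units_smul]
  simp

/-- The comparison morphism expressing the compatibility of the total Hom complex with an additive
functor. -/
noncomputable def postcompHom (F I : CochainComplex C ℤ) :
    (Φ.mapHomologicalComplex _).obj (complex H F I) ⟶ complex (postcomp H Φ) F I where
  f n := postcompX H Φ F I n
  comm' n m hnm := postcompX_d H Φ F I n m hnm

lemma postcompX_naturality {F F' I I' : CochainComplex C ℤ} (f : F' ⟶ F) (g : I ⟶ I') (n : ℤ) :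
    Φ.map ((map H f g).f n) ≫ postcompX H Φ F' I' n =
      postcompX H Φ F I n ≫ (map (postcomp H Φ) f g).f n := by
  refine ext_π (fun p q _ => ?_)
  rw [Category.assoc, Category.assoc, map_f_π, postcompX_π, ← Category.assoc, postcompX_π,
    ← Φ.map_comp, map_f_π]
  simp

lemma postcompHom_naturality {F F' I I' : CochainComplex C ℤ} (f : F' ⟶ F) (g : I ⟶ I') :
    (Φ.mapHomologicalComplex _).map (map H f g) ≫ postcompHom H Φ F' I' =
      postcompHom H Φ F I ≫ map (postcomp H Φ) f g := by
  ext n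
  exact postcompX_naturality H Φ f g n

instance isIso_postcompHom [∀ (J : Type) [Countable J], PreservesLimitsOfShape (Discrete J) Φ]
    (F I : CochainComplex C ℤ) : IsIso (postcompHom H Φ F I) := by
  have (n : ℤ) : IsIso ((postcompHom H Φ F I).f n) := by
    let Y := fun pq : {pq : ℤ × ℤ // pq.1 + n = pq.2} => (H.obj (op (F.X pq.1.1))).obj (I.X pq.1.2)
    have h : (postcompHom H Φ F I).f n = (PreservesProduct.iso Φ Y).hom := by
      refine Pi.hom_ext _ _ (fun pq => ?_)
      obtain ⟨⟨p, q⟩, hpq⟩ := pq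
      have h1 := postcompX_π H Φ F I n p q
      rw [π, π, proj_eq_π _ _ _ _ _ hpq, proj_eq_π _ _ _ _ _ hpq] at h1
      refine h1.trans ?_
      rw [PreservesProduct.iso_hom]
      exact (piComparison_comp_π Φ Y ⟨(p, q), hpq⟩).symm
    rw [h]
    exact (PreservesProduct.iso Φ Y).isIso_hom
  exact HomologicalComplex.Hom.isIso_of_components _

end postcomp

section natTrans

variable {C : Type*} [Category* C] [Preadditive C] {C' : Type*} [Category* C'] [Preadditive C']
  {D : Type*} [Category* D]

/-- A natural transformation between bifunctors on homotopy categories, given by its components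
and their naturality with respect to morphisms of complexes. -/
def natTransMk {B₁ B₂ : (HomotopyCategory C (.up ℤ))ᵒᵖ ⥤ HomotopyCategory C' (.up ℤ) ⥤ D}
    (τ : ∀ (F : CochainComplex C ℤ) (I : CochainComplex C' ℤ),
      (B₁.obj (op ((HomotopyCategory.quotient _ _).obj F))).obj
        ((HomotopyCategory.quotient _ _).obj I) ⟶
      (B₂.obj (op ((HomotopyCategory.quotient _ _).obj F))).obj
        ((HomotopyCategory.quotient _ _).obj I))
    (h₁ : ∀ {F F' : CochainComplex C ℤ} (f : F' ⟶ F) (I : CochainComplex C' ℤ),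
      (B₁.map ((HomotopyCategory.quotient _ _).map f).op).app _ ≫ τ F' I =
        τ F I ≫ (B₂.map ((HomotopyCategory.quotient _ _).map f).op).app _)
    (h₂ : ∀ (F : CochainComplex C ℤ) {I I' : CochainComplex C' ℤ} (g : I ⟶ I'),
      (B₁.obj _).map ((HomotopyCategory.quotient _ _).map g) ≫ τ F I' =
        τ F I ≫ (B₂.obj _).map ((HomotopyCategory.quotient _ _).map g)) :
    B₁ ⟶ B₂ where
  app F :=
    { app := fun I => τ F.unop.as I.as
      naturality := fun I I' g => by
        obtain ⟨g, rfl⟩ := (HomotopyCategory.quotient _ _).map_surjective g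
        exact h₂ _ g }
  naturality F F' f := by
    obtain ⟨f, rfl⟩ : ∃ f', f = Quiver.Hom.op f' := ⟨f.unop, rfl⟩
    obtain ⟨f, rfl⟩ := (HomotopyCategory.quotient _ _).map_surjective f
    ext I
    exact h₁ f _

lemma isIso_natTransMk {B₁ B₂ : (HomotopyCategory C (.up ℤ))ᵒᵖ ⥤ HomotopyCategory C' (.up ℤ) ⥤ D}
    (τ h₁ h₂) (h : ∀ F I, IsIso (τ F I)) : IsIso (natTransMk (B₁ := B₁) (B₂ := B₂) τ h₁ h₂) := by
  rw [NatTrans.isIso_iff_isIso_app]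
  intro F
  rw [NatTrans.isIso_iff_isIso_app]
  intro I
  exact h F.unop.as I.as

end natTrans

section coyoneda

open CochainComplex.HomComplex

variable {C : Type u} [Category.{v} C] [Preadditive C]

/-- The components of an element of the total Hom complex for the Hom bifunctor. -/
noncomputable def comp (A B : CochainComplex C ℤ) (n p q : ℤ) :
    (complex (preadditiveCoyoneda (C := C)) A B).X n →+ (A.X p ⟶ B.X q) :=
  (π (H := preadditiveCoyoneda (C := C)) A B n p q).hom

lemma comp_d (A B : CochainComplex C ℤ) (n m : ℤ) (h : n + 1 = m) (p p' q q' : ℤ)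
    (hp : p + 1 = p') (hq : q' + 1 = q)
    (x : (complex (preadditiveCoyoneda (C := C)) A B).X n) :
    comp A B m p q (((complex (preadditiveCoyoneda (C := C)) A B).d n m).hom x) =
      comp A B n p q' x ≫ B.d q' q + m.negOnePow • (A.d p p' ≫ comp A B n p' q x) := by
  have := congrArg (fun f => f.hom x)
    (d_π (H := preadditiveCoyoneda (C := C)) A B n m h p p' q q' hp hq)
  refine this.trans ?_
  rw [Units.smul_def, Units.smul_def]
  rfl

lemma comp_map {A B A' B' : CochainComplex C ℤ} (f : A' ⟶ A) (g : B ⟶ B') (n p q : ℤ)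
    (x : (complex (preadditiveCoyoneda (C := C)) A B).X n) :
    comp A' B' n p q (((map (preadditiveCoyoneda (C := C)) f g).f n).hom x) =
      f.f p ≫ comp A B n p q x ≫ g.f q :=
  (congrArg (fun f => f.hom x)
    (map_f_π (H := preadditiveCoyoneda (C := C)) f g n p q)).trans (Category.assoc _ _ _)

/-- The total Hom complex with respect to the Hom bifunctor is the complex of cochains. -/
noncomputable def homComplexIso (A B : CochainComplex C ℤ) :
    complex (preadditiveCoyoneda (C := C)) A B ≅ CochainComplex.HomComplex A B :=
  HomologicalComplex.Hom.isoOfComponents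
    (fun n =>
      { hom := AddCommGrpCat.ofHom
          { toFun := fun x => Cochain.mk (fun p q _ => comp A B n p q x)
            map_zero' := by ext p q h; exact (comp A B n p q).map_zero
            map_add' := fun x y => by ext p q h; exact (comp A B n p q).map_add x y }
        inv := desc (H := preadditiveCoyoneda (C := C)) (F := A) (I := B)
          (fun p q => AddCommGrpCat.ofHom
            (if h : p + n = q then
              { toFun := fun z : Cochain A B n => z.v p q h
                map_zero' := rfl
                map_add' := fun _ _ => rfl }
            else 0))
        hom_inv_id := by
          refine ext_π (fun p q h => ?_)
          refine (Category.assoc _ _ _).trans ((congrArg _ (desc_π_of_eq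
            (H := preadditiveCoyoneda (C := C)) (F := A) (I := B) _ p q h)).trans ?_)
          rw [dif_pos h]
          rfl
        inv_hom_id := by
          ext z : 2
          refine Cochain.ext _ _ (fun p q h => ?_)
          refine (congrArg (fun f => f.hom z) (desc_π_of_eq (H := preadditiveCoyoneda (C := C))
            (F := A) (I := B) _ p q h)).trans ?_
          rw [dif_pos h]
          rfl })
    (fun n m hnm => by
      ext x : 2
      refine Cochain.ext _ _ (fun p q h => ?_)
      have hnm' : n + 1 = m := hnm
      refine (δ_v n m hnm _ p q h (q - 1) (p + 1) rfl rfl).trans ?_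
      exact (comp_d A B n m hnm p (p + 1) q (q - 1) rfl (by simp) x).symm)

end coyoneda

end TotHom

/-! ### Exchange of variables in total Hom complexes -/

namespace TotHom

open Opposite CochainComplex.HomComplex

/-- A symmetry of an internal Hom bifunctor `H`: natural isomorphisms
`Hom(A, H(B, I)) ≅ Hom(B, H(A, I))`. -/
structure Symmetry {C : Type*} [Category* C] [Preadditive C] (H : Cᵒᵖ ⥤ C ⥤ C) where
  /-- The exchange of the two contravariant variables. -/
  σ {A B I : C} : (A ⟶ (H.obj (op B)).obj I) →+ (B ⟶ (H.obj (op A)).obj I)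
  σ_σ {A B I : C} (f : A ⟶ (H.obj (op B)).obj I) : σ (σ f) = f
  σ_precomp {A A' B I : C} (a : A' ⟶ A) (f : A ⟶ (H.obj (op B)).obj I) :
    σ (a ≫ f) = σ f ≫ (H.map a.op).app I
  σ_map_app {A B B' I : C} (f : A ⟶ (H.obj (op B)).obj I) (b : B' ⟶ B) :
    σ (f ≫ (H.map b.op).app I) = b ≫ σ f
  σ_map {A B I I' : C} (f : A ⟶ (H.obj (op B)).obj I) (g : I ⟶ I') :
    σ (f ≫ (H.obj (op B)).map g) = σ f ≫ (H.obj (op A)).map g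

variable {C : Type*} [Category* C] [Preadditive C] [HasCountableProducts C]
  {H : Cᵒᵖ ⥤ C ⥤ C} [H.Additive] [∀ X, (H.obj X).Additive] (s : Symmetry H)

namespace Symmetry

lemma σ_units_smul {A B I : C} (ε : ℤˣ) (f : A ⟶ (H.obj (op B)).obj I) :
    s.σ (ε • f) = ε • s.σ f := by
  rw [Units.smul_def, Units.smul_def]
  exact map_zsmul _ _ _

variable {P F I : CochainComplex C ℤ}

/-- The exchange of the two contravariant variables for cochains with values in a total Hom
complex; the sign makes it commute with the differentials. -/
noncomputable def swap {n : ℤ} (z : Cochain P (complex H F I) n) : Cochain F (complex H P I) n :=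
  Cochain.mk (fun q _ _ => desc (fun p r =>
    (p * q).negOnePow • s.σ (z.v p (p + n) rfl ≫ π F I (p + n) q r)))

lemma swap_v_π {n : ℤ} (z : Cochain P (complex H F I) n) (q q' : ℤ) (hq : q + n = q') (p p' : ℤ)
    (hp : p + n = p') (r : ℤ) : (s.swap z).v q q' hq ≫ π P I q' p r =
      (p * q).negOnePow • s.σ (z.v p p' hp ≫ π F I p' q r) := by
  subst hp
  refine desc_π (H := H) (F := P) (I := I) (fun p r =>
    (p * q).negOnePow • s.σ (z.v p (p + n) rfl ≫ π F I (p + n) q r)) p r (fun h => ?_)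
  rw [π_eq_zero _ _ _ _ _ (by omega), comp_zero, map_zero, smul_zero]

lemma swap_swap {n : ℤ} (z : Cochain P (complex H F I) n) : s.swap (s.swap z) = z := by
  refine Cochain.ext _ _ (fun p p' hp => ext_π (fun q r _ => ?_))
  rw [swap_v_π _ _ _ _ _ _ _ rfl, swap_v_π _ _ _ _ _ _ _ hp, σ_units_smul, s.σ_σ, smul_smul,
    mul_comm q p, Int.units_mul_self, one_smul]

lemma swap_zero {n : ℤ} : s.swap (0 : Cochain P (complex H F I) n) = 0 := by
  refine Cochain.ext _ _ (fun q q' hq => ext_π (fun p r _ => ?_))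
  rw [swap_v_π _ _ _ _ _ _ _ rfl]
  simp

lemma δ_swap {n m : ℤ} (h : n + 1 = m) (z : Cochain P (complex H F I) n) :
    δ n m (s.swap z) = s.swap (δ n m z) := by
  refine Cochain.ext _ _ (fun q q' hq => ext_π (fun p r _ => ?_))
  rw [swap_v_π s _ q q' hq p (p + m) rfl r, δ_v n m h z p (p + m) rfl (p + n) (p + 1) (by omega) rfl,
    δ_v n m h (s.swap z) q q' hq (q + n) (q + 1) (by omega) rfl, Preadditive.add_comp,
    Preadditive.add_comp, Category.assoc, Category.assoc, Linear.units_smul_comp,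
    Linear.units_smul_comp, Category.assoc, Category.assoc,
    d_π F I (p + n) (p + m) (by omega) q (q + 1) r (r - 1) rfl (by simp),
    d_π P I (q + n) q' (by omega) p (p + 1) r (r - 1) rfl (by simp),
    Preadditive.comp_add, Preadditive.comp_add, Linear.comp_units_smul, Linear.comp_units_smul,
    ← Category.assoc, swap_v_π s z q (q + n) rfl p (p + n) rfl,
    ← Category.assoc (Cochain.v _ _ _ _), swap_v_π s z q (q + n) rfl (p + 1) (p + m) (by omega),
    swap_v_π s z (q + 1) q' (by omega) p (p + n) rfl, map_add, map_add, σ_units_smul,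
    σ_units_smul, Linear.units_smul_comp, Linear.units_smul_comp, Linear.comp_units_smul,
    ← Category.assoc (z.v _ _ _) (π _ _ _ _ _), ← Category.assoc (z.v _ _ _) (π _ _ _ _ _),
    s.σ_map, s.σ_map_app, s.σ_precomp (P.d p (p + 1))]
  subst h
  obtain rfl : q' = q + (n + 1) := by omega
  simp only [smul_add, smul_smul]
  have e1 : (q + (n + 1)).negOnePow * ((p + 1) * q).negOnePow =
      (p * q).negOnePow * (n + 1).negOnePow := by
    simp only [← Int.negOnePow_add]
    rw [Int.negOnePow_eq_iff]
    exact ⟨q, by ring⟩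
  have e2 : (n + 1).negOnePow * (p * (q + 1)).negOnePow =
      (p * q).negOnePow * (p + (n + 1)).negOnePow := by
    simp only [← Int.negOnePow_add]
    rw [Int.negOnePow_eq_iff]
    exact ⟨0, by ring⟩
  rw [e1, e2]
  abel

/-- Null-homotopy of all morphisms is invariant under the exchange of the contravariant
variables. -/
lemma nonempty_homotopy_zero (s : Symmetry H) (h : ∀ f : F ⟶ complex H P I, Nonempty (Homotopy f 0))
    (f : P ⟶ complex H F I) : Nonempty (Homotopy f 0) := by
  have h1 : δ 0 1 (s.swap (Cochain.ofHom f)) = 0 := by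
    rw [δ_swap s (zero_add 1), δ_ofHom, swap_zero]
  obtain ⟨h⟩ := h (Cocycle.homOf (Cocycle.mk (s.swap (Cochain.ofHom f)) 1 (zero_add 1) h1))
  obtain ⟨γ, hγ⟩ := Cochain.equivHomotopy _ _ h
  rw [Cochain.ofHom_zero, add_zero, Cocycle.cochain_ofHom_homOf_eq_coe] at hγ
  refine ⟨(Cochain.equivHomotopy _ _).symm ⟨s.swap γ, ?_⟩⟩
  rw [δ_swap s (neg_add_cancel 1), ← hγ, Cochain.ofHom_zero, add_zero]
  exact (s.swap_swap _).symm

end Symmetry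

end TotHom

/-! ### Sections of the sheaf of homomorphisms -/

namespace SheafDuality

open TopologicalSpace Opposite

variable {X : TopCat.{u}}

section pairing

variable {A B I : (Opens X)ᵒᵖ ⥤ AddCommGrpCat.{u}}

/-- The value of a local section of the presheaf of homomorphisms on a smaller open subset. -/
def evalHom {U : (Opens X)ᵒᵖ} (φ : (homPresheaf B I).obj U) (V : (Over U.unop)ᵒᵖ) :
    B.obj (op V.unop.left) →+ I.obj (op V.unop.left) :=
  (NatTrans.app (C := (Over U.unop)ᵒᵖ) (D := AddCommGrpCat.{u})
    (F := (Over.forget U.unop).op ⋙ B) (G := (Over.forget U.unop).op ⋙ I) φ V).hom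

lemma homPresheaf_ext {U : (Opens X)ᵒᵖ} {φ ψ : (homPresheaf B I).obj U}
    (h : ∀ V b, evalHom φ V b = evalHom ψ V b) : φ = ψ :=
  NatTrans.ext (funext fun V => AddCommGrpCat.hom_ext (AddMonoidHom.ext fun b => h V b))

lemma evalHom_naturality {U : (Opens X)ᵒᵖ} (φ : (homPresheaf B I).obj U) {V V' : (Over U.unop)ᵒᵖ}
    (i : V ⟶ V') (b : B.obj (op V.unop.left)) :
    evalHom φ V' ((B.map i.unop.left.op).hom b) = (I.map i.unop.left.op).hom (evalHom φ V b) :=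
  ConcreteCategory.congr_hom (NatTrans.naturality (C := (Over U.unop)ᵒᵖ) (D := AddCommGrpCat.{u})
    (F := (Over.forget U.unop).op ⋙ B) (G := (Over.forget U.unop).op ⋙ I) φ i) b

/-- The bilinear pairing on sections corresponding to a morphism to the presheaf of
homomorphisms. -/
def pairing (φ : A ⟶ homPresheaf B I) (V : (Opens X)ᵒᵖ) : A.obj V →+ B.obj V →+ I.obj V where
  toFun a := evalHom ((φ.app V).hom a) (op (Over.mk (𝟙 V.unop)))
  map_zero' := by rw [map_zero]; rfl
  map_add' a a' := by rw [map_add]; rfl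

lemma evalHom_eq_pairing (φ : A ⟶ homPresheaf B I) {U : (Opens X)ᵒᵖ} (a : A.obj U)
    (V : (Over U.unop)ᵒᵖ) (b : B.obj (op V.unop.left)) :
    evalHom ((φ.app U).hom a) V b =
      pairing φ (op V.unop.left) ((A.map V.unop.hom.op).hom a) b := by
  have h := ConcreteCategory.congr_hom (φ.naturality V.unop.hom.op) a
  have h' : (φ.app (op V.unop.left)).hom ((A.map V.unop.hom.op).hom a) =
    ((homPresheaf B I).map V.unop.hom.op).hom ((φ.app U).hom a) := h
  change _ = evalHom (U := op V.unop.left) ((φ.app (op V.unop.left)).hom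
    ((A.map V.unop.hom.op).hom a)) (op (Over.mk (𝟙 V.unop.left))) b
  rw [h']
  rfl

lemma pairing_ext {φ ψ : A ⟶ homPresheaf B I} (h : ∀ V a b, pairing φ V a b = pairing ψ V a b) :
    φ = ψ := by
  ext U a
  refine homPresheaf_ext (fun V b => ?_)
  exact (evalHom_eq_pairing φ a V b).trans ((h _ _ _).trans (evalHom_eq_pairing ψ a V b).symm)

lemma pairing_naturality (φ : A ⟶ homPresheaf B I) {V V' : (Opens X)ᵒᵖ} (i : V ⟶ V') (a : A.obj V)
    (b : B.obj V) : pairing φ V' ((A.map i).hom a) ((B.map i).hom b) =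
      (I.map i).hom (pairing φ V a b) := by
  have h := evalHom_eq_pairing φ a (op (Over.mk i.unop)) ((B.map i).hom b)
  refine h.symm.trans ?_
  exact evalHom_naturality ((φ.app V).hom a)
    (Quiver.Hom.op (Over.homMk i.unop : Over.mk i.unop ⟶ Over.mk (𝟙 V.unop))) b

/-- The morphism to the presheaf of homomorphisms corresponding to a bilinear pairing. -/
def ofPairing (β : ∀ V, A.obj V →+ B.obj V →+ I.obj V)
    (hβ : ∀ {V V'} (i : V ⟶ V') a b,
      β V' ((A.map i).hom a) ((B.map i).hom b) = (I.map i).hom (β V a b)) :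
    A ⟶ homPresheaf B I where
  app U := AddCommGrpCat.ofHom
    (Y := (Over.forget U.unop).op ⋙ B ⟶ (Over.forget U.unop).op ⋙ I)
    { toFun := fun a =>
        { app := fun V => AddCommGrpCat.ofHom
            (β (op V.unop.left) ((A.map V.unop.hom.op).hom a))
          naturality := fun V V' i => by
            refine AddCommGrpCat.hom_ext (AddMonoidHom.ext fun b => ?_)
            have h : A.map V'.unop.hom.op = A.map V.unop.hom.op ≫ A.map i.unop.left.op := by
              rw [← A.map_comp]
              rfl
            have h' : (A.map V'.unop.hom.op).hom a =
                (A.map i.unop.left.op).hom ((A.map V.unop.hom.op).hom a) := by rw [h]; rfl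
            change β (op V'.unop.left) ((A.map V'.unop.hom.op).hom a)
              ((B.map i.unop.left.op).hom b) = _
            rw [h']
            exact hβ i.unop.left.op _ b }
      map_zero' := by
        refine NatTrans.ext (funext fun V => AddCommGrpCat.hom_ext ?_)
        change β _ ((A.map V.unop.hom.op).hom 0) = _
        rw [map_zero, map_zero]
        rfl
      map_add' := fun a a' => by
        refine NatTrans.ext (funext fun V => AddCommGrpCat.hom_ext ?_)
        change β _ ((A.map V.unop.hom.op).hom (a + a')) = _
        rw [map_add, map_add]
        rfl }
  naturality U U' f := by
    refine AddCommGrpCat.hom_ext (AddMonoidHom.ext fun a => ?_)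
    refine NatTrans.ext (funext fun V => AddCommGrpCat.hom_ext ?_)
    change β _ ((A.map V.unop.hom.op).hom ((A.map f).hom a)) =
      β _ ((A.map ((Over.map f.unop).obj V.unop).hom.op).hom a)
    have h : A.map ((Over.map f.unop).obj V.unop).hom.op = A.map f ≫ A.map V.unop.hom.op := by
      rw [← A.map_comp]
      rfl
    rw [h]
    rfl

lemma pairing_ofPairing (β : ∀ V, A.obj V →+ B.obj V →+ I.obj V)
    (hβ : ∀ {V V'} (i : V ⟶ V') a b,
      β V' ((A.map i).hom a) ((B.map i).hom b) = (I.map i).hom (β V a b)) (V a b) :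
    pairing (ofPairing β hβ) V a b = β V a b := by
  change β V ((A.map (𝟙 V)).hom a) b = _
  rw [A.map_id]
  rfl

/-- The exchange of variables for morphisms to the presheaf of homomorphisms. -/
def flipHom (φ : A ⟶ homPresheaf B I) : B ⟶ homPresheaf A I :=
  ofPairing (fun V => (pairing φ V).flip) (fun i b a => pairing_naturality φ i a b)

lemma pairing_flipHom (φ : A ⟶ homPresheaf B I) (V a b) :
    pairing (flipHom φ) V b a = pairing φ V a b :=
  pairing_ofPairing _ _ _ _ _

end pairing

/-- The exchange of variables `Hom(A, Hom(B, I)) ≅ Hom(B, Hom(A, I))` for sheaves. -/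
def sheafHomSymmetry (X : TopCat.{u}) : TotHom.Symmetry (sheafHom X) where
  σ {A B I} :=
    { toFun := fun f => ⟨flipHom (A := A.obj) (B := B.obj) (I := I.obj) f.hom⟩
      map_zero' := Sheaf.hom_ext (pairing_ext fun V b a =>
        (pairing_flipHom (A := A.obj) (B := B.obj) (I := I.obj) 0 V a b).trans rfl)
      map_add' := fun f g => Sheaf.hom_ext (pairing_ext fun V b a =>
        (pairing_flipHom (A := A.obj) (B := B.obj) (I := I.obj) (f.hom + g.hom) V a b).trans
          (congrArg₂ (· + ·)
            (pairing_flipHom (A := A.obj) (B := B.obj) (I := I.obj) f.hom V a b).symm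
            (pairing_flipHom (A := A.obj) (B := B.obj) (I := I.obj) g.hom V a b).symm)) }
  σ_σ {A B I} f := Sheaf.hom_ext (pairing_ext fun V a b =>
    (pairing_flipHom (A := B.obj) (B := A.obj) (I := I.obj) _ V b a).trans
      (pairing_flipHom (A := A.obj) (B := B.obj) (I := I.obj) f.hom V a b))
  σ_precomp {A A' B I} a f := Sheaf.hom_ext (pairing_ext fun V y x =>
    (pairing_flipHom (A := A'.obj) (B := B.obj) (I := I.obj) (a ≫ f).hom V x y).trans
      (pairing_flipHom (A := A.obj) (B := B.obj) (I := I.obj) f.hom V ((a.hom.app V).hom x) y).symm)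
  σ_map_app {A B B' I} f b := Sheaf.hom_ext (pairing_ext fun V y x =>
    (pairing_flipHom (A := A.obj) (B := B'.obj) (I := I.obj) _ V x y).trans
      (pairing_flipHom (A := A.obj) (B := B.obj) (I := I.obj) f.hom V x ((b.hom.app V).hom y)).symm)
  σ_map {A B I I'} f g := Sheaf.hom_ext (pairing_ext fun V y x =>
    (pairing_flipHom (A := A.obj) (B := B.obj) (I := I'.obj) _ V x y).trans
      (congrArg (g.hom.app V).hom
        (pairing_flipHom (A := A.obj) (B := B.obj) (I := I.obj) f.hom V x y)).symm)

end SheafDuality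

/-! ### Extension by zero -/

namespace SheafDuality

open TopologicalSpace Opposite

variable {X : TopCat.{u}}

section extZero

variable (U : Opens X)

/-- The sections of a presheaf `A` over `V` which vanish unless `V` is contained in `U`. -/
def extZeroSubgroup (A : (Opens X)ᵒᵖ ⥤ AddCommGrpCat.{u}) (V : (Opens X)ᵒᵖ) :
    AddSubgroup (A.obj V) where
  carrier := {s | V.unop ≤ U ∨ s = 0}
  zero_mem' := Or.inr rfl
  add_mem' := by
    rintro s t (h | rfl) (h' | rfl)
    · exact Or.inl h
    · exact Or.inl h
    · exact Or.inl h'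
    · exact Or.inr (add_zero _)
  neg_mem' := by
    rintro s (h | rfl)
    · exact Or.inl h
    · exact Or.inr neg_zero

variable {U} in
lemma map_mem_extZeroSubgroup {A B : (Opens X)ᵒᵖ ⥤ AddCommGrpCat.{u}} {V V' : (Opens X)ᵒᵖ}
    (f : A.obj V →+ B.obj V') (i : V'.unop ≤ V.unop) {s : A.obj V}
    (hs : s ∈ extZeroSubgroup U A V) : f s ∈ extZeroSubgroup U B V' := by
  obtain h | rfl := hs
  · exact Or.inl (i.trans h)
  · exact Or.inr (map_zero f)

/-- The presheaf extension by zero of the restriction of a presheaf to `U`: its sections over `V`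
are those of the presheaf if `V` is contained in `U`, and zero otherwise. -/
def extZeroObj (A : (Opens X)ᵒᵖ ⥤ AddCommGrpCat.{u}) : (Opens X)ᵒᵖ ⥤ AddCommGrpCat.{u} where
  obj V := AddCommGrpCat.of (extZeroSubgroup U A V)
  map {V V'} i := AddCommGrpCat.ofHom
    (((A.map i).hom.comp (extZeroSubgroup U A V).subtype).codRestrict (extZeroSubgroup U A V')
      (fun s => map_mem_extZeroSubgroup (A.map i).hom (leOfHom i.unop) s.2))
  map_id V := AddCommGrpCat.hom_ext (AddMonoidHom.ext fun s =>
    Subtype.ext (ConcreteCategory.congr_hom (A.map_id V) s.1))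
  map_comp i j := AddCommGrpCat.hom_ext (AddMonoidHom.ext fun s =>
    Subtype.ext (ConcreteCategory.congr_hom (A.map_comp i j) s.1))

/-- The functor of presheaf extension by zero from `U`. -/
def extZero : ((Opens X)ᵒᵖ ⥤ AddCommGrpCat.{u}) ⥤ ((Opens X)ᵒᵖ ⥤ AddCommGrpCat.{u}) where
  obj A := extZeroObj U A
  map {A B} f :=
    { app := fun V => AddCommGrpCat.ofHom
        (((f.app V).hom.comp (extZeroSubgroup U A V).subtype).codRestrict (extZeroSubgroup U B V)
          (fun s => map_mem_extZeroSubgroup (f.app V).hom le_rfl s.2))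
      naturality := fun V V' i => by
        ext s
        exact Subtype.ext (ConcreteCategory.congr_hom (f.naturality i) s.1) }
  map_id A := rfl
  map_comp f g := rfl

instance : (extZero U).Additive where
  map_add := rfl

/-- The inclusion of the extension by zero. -/
def extZeroι : extZero U ⟶ 𝟭 _ where
  app A := { app := fun V => AddCommGrpCat.ofHom (extZeroSubgroup U A V).subtype }

instance (A : (Opens X)ᵒᵖ ⥤ AddCommGrpCat.{u}) : Mono ((extZeroι U).app A) := by
  have (V : (Opens X)ᵒᵖ) : Mono (((extZeroι U).app A).app V) :=
    (AddCommGrpCat.mono_iff_injective _).2 Subtype.val_injective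
  exact NatTrans.mono_of_mono_app _

/-- The extension by zero from `U` is the identity on sections over subsets of `U`. -/
noncomputable def extZeroEvaluationIso (V : (Opens X)ᵒᵖ) (h : V.unop ≤ U) :
    extZero U ⋙ (evaluation _ _).obj V ≅ (evaluation _ AddCommGrpCat.{u}).obj V :=
  NatIso.ofComponents (fun A =>
    { hom := AddCommGrpCat.ofHom (extZeroSubgroup U A V).subtype
      inv := AddCommGrpCat.ofHom ((AddMonoidHom.id _).codRestrict (extZeroSubgroup U A V)
        (fun _ => Or.inl h))
      hom_inv_id := rfl
      inv_hom_id := rfl })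

lemma isZero_extZero_evaluation (V : (Opens X)ᵒᵖ) (h : ¬ V.unop ≤ U)
    (A : (Opens X)ᵒᵖ ⥤ AddCommGrpCat.{u}) : IsZero (((extZero U).obj A).obj V) := by
  rw [IsZero.iff_id_eq_zero]
  ext s
  exact Subtype.ext (s.2.resolve_left h)

lemma exact_iff_evaluation (S : ShortComplex ((Opens X)ᵒᵖ ⥤ AddCommGrpCat.{u})) :
    S.Exact ↔ ∀ V, (S.map ((evaluation _ _).obj V)).Exact :=
  JointlyReflectIsomorphisms.exact_iff
    (F := fun V : (Opens X)ᵒᵖ => (evaluation (Opens X)ᵒᵖ AddCommGrpCat.{u}).obj V)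
    ⟨fun f _ => (NatTrans.isIso_iff_isIso_app f).2 (fun t => inferInstanceAs
      (IsIso (((evaluation (Opens X)ᵒᵖ AddCommGrpCat.{u}).obj t).map f)))⟩ S

instance : (extZero U).PreservesHomology := by
  refine ((extZero U).exact_tfae.out 1 2).1 (fun S hS => ?_)
  rw [exact_iff_evaluation] at hS ⊢
  intro V
  by_cases h : V.unop ≤ U
  · exact ShortComplex.exact_of_iso (S.mapNatIso (extZeroEvaluationIso U V h).symm) (hS V)
  · exact ShortComplex.exact_of_isZero_X₂ _ (isZero_extZero_evaluation U V h S.X₂)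

variable {U}

open scoped Classical in
/-- The extension of a morphism defined on `U` to the extension by zero, on sections. -/
noncomputable def extendApp {A I : (Opens X)ᵒᵖ ⥤ AddCommGrpCat.{u}}
    (φ : (homPresheaf A I).obj (op U)) (V : (Opens X)ᵒᵖ) : extZeroSubgroup U A V →+ I.obj V :=
  if h : V.unop ≤ U then
    (evalHom φ (op (Over.mk (homOfLE h)))).comp (extZeroSubgroup U A V).subtype
  else 0

lemma extendApp_of_le {A I : (Opens X)ᵒᵖ ⥤ AddCommGrpCat.{u}}
    (φ : (homPresheaf A I).obj (op U)) (V : (Opens X)ᵒᵖ) (h : V.unop ≤ U)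
    (s : extZeroSubgroup U A V) :
    extendApp φ V s = evalHom φ (op (Over.mk (homOfLE h))) s.1 := by
  rw [extendApp, dif_pos h]
  rfl

lemma eq_zero_of_not_le {A : (Opens X)ᵒᵖ ⥤ AddCommGrpCat.{u}} {V : (Opens X)ᵒᵖ}
    (h : ¬ V.unop ≤ U) (s : extZeroSubgroup U A V) : s = 0 :=
  Subtype.ext (s.2.resolve_left h)

/-- The extension of a morphism defined on `U` to the extension by zero. -/
noncomputable def extendHom {A I : (Opens X)ᵒᵖ ⥤ AddCommGrpCat.{u}}
    (φ : (homPresheaf A I).obj (op U)) : (extZero U).obj A ⟶ I where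
  app V := AddCommGrpCat.ofHom (extendApp φ V)
  naturality V V' i := by
    refine AddCommGrpCat.hom_ext (AddMonoidHom.ext fun s => ?_)
    by_cases h : V.unop ≤ U
    · have h' : V'.unop ≤ U := (leOfHom i.unop).trans h
      refine (extendApp_of_le φ V' h' _).trans (Eq.trans ?_
        (congrArg (I.map i).hom (extendApp_of_le φ V h s).symm))
      exact evalHom_naturality φ (Quiver.Hom.op
        (Over.homMk i.unop : Over.mk (homOfLE h') ⟶ Over.mk (homOfLE h))) s.1
    · obtain rfl := eq_zero_of_not_le h s
      exact (map_zero _).trans (map_zero _).symm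

/-- Morphisms from the extension by zero from `U` are morphisms defined on `U`. -/
noncomputable def extendHomEquiv (A I : (Opens X)ᵒᵖ ⥤ AddCommGrpCat.{u}) :
    (homPresheaf A I).obj (op U) ≃+ ((extZero U).obj A ⟶ I) where
  toFun φ := extendHom φ
  invFun f :=
    { app := fun V => AddCommGrpCat.ofHom ((f.app (op V.unop.left)).hom.comp
        ((AddMonoidHom.id _).codRestrict (extZeroSubgroup U A (op V.unop.left))
          (fun _ => Or.inl (leOfHom V.unop.hom))))
      naturality := fun V V' i => by
        ext s
        exact ConcreteCategory.congr_hom (f.naturality i.unop.left.op)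
          ⟨s, Or.inl (leOfHom V.unop.hom)⟩ }
  left_inv φ := homPresheaf_ext (fun V b =>
    extendApp_of_le φ (op V.unop.left) (leOfHom V.unop.hom) ⟨b, _⟩)
  right_inv f := by
    refine NatTrans.ext (funext fun V => AddCommGrpCat.hom_ext (AddMonoidHom.ext fun s => ?_))
    by_cases h : V.unop ≤ U
    · exact extendApp_of_le _ V h s
    · obtain rfl := eq_zero_of_not_le h s
      exact (map_zero _).trans (map_zero _).symm
  map_add' φ ψ := by
    refine NatTrans.ext (funext fun V => AddCommGrpCat.hom_ext (AddMonoidHom.ext fun s => ?_))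
    by_cases h : V.unop ≤ U
    · exact (extendApp_of_le _ V h s).trans (congrArg₂ (· + ·)
        (extendApp_of_le φ V h s).symm (extendApp_of_le ψ V h s).symm)
    · obtain rfl := eq_zero_of_not_le h s
      exact (map_zero _).trans (map_zero _).symm

end extZero

end SheafDuality

/-! ### Acyclicity of sections of complexes of homomorphisms -/

namespace CochainComplex

open HomComplex

lemma HomComplex.acyclic_of_isKInjective {C : Type u} [Category.{v} C] [Abelian C]
    {A I : CochainComplex C ℤ} (hA : A.Acyclic) [I.IsKInjective] : (HomComplex A I).Acyclic := by
  intro n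
  rw [HomologicalComplex.exactAt_iff_isZero_homology]
  have : Subsingleton (CohomologyClass A I n) := by
    refine subsingleton_of_forall_eq 0 (fun x => ?_)
    obtain ⟨x, rfl⟩ := x.mk_surjective
    rw [CohomologyClass.mk_eq_zero_iff]
    obtain ⟨α, hα⟩ := IsKInjective.eq_δ_of_cocycle x hA (n - 1) (by simp)
    exact ⟨n - 1, by simp, α, hα⟩
  have := (homologyAddEquiv A I n).injective.subsingleton
  exact AddCommGrpCat.isZero_of_subsingleton _

end CochainComplex

namespace TotHom

lemma acyclic_of_isKInjective {C : Type u} [Category.{v} C] [Abelian C]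
    {A I : CochainComplex C ℤ} (hA : A.Acyclic) [I.IsKInjective] :
    (complex (preadditiveCoyoneda (C := C)) A I).Acyclic :=
  fun n => (CochainComplex.HomComplex.acyclic_of_isKInjective hA n).of_iso (homComplexIso A I).symm

end TotHom

lemma CategoryTheory.Adjunction.homEquiv_symm_add {C : Type*} [Category* C] [Preadditive C]
    {D : Type*} [Category* D] [Preadditive D] {F : C ⥤ D} {G : D ⥤ C} [F.Additive] (adj : F ⊣ G)
    {X : C} {Y : D} (f g : X ⟶ G.obj Y) :
    (adj.homEquiv X Y).symm (f + g) = (adj.homEquiv X Y).symm f + (adj.homEquiv X Y).symm g := by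
  simp [Adjunction.homEquiv_counit]

namespace SheafDuality

open TopologicalSpace Opposite

variable {X : TopCat.{u}}

section

variable (X) in
/-- The functor of sections over an open subset. -/
abbrev sectionsOver (U : Opens X) : Sh X ⥤ AddCommGrpCat.{u} :=
  (sheafSections (Opens.grothendieckTopology X) AddCommGrpCat.{u}).obj (op U)

instance (U : Opens X) : (sectionsOver X U).Additive where
  map_add := rfl

instance (U : Opens X) : PreservesLimits (sectionsOver X U) :=
  inferInstanceAs (PreservesLimits
    (sheafToPresheaf (Opens.grothendieckTopology X) AddCommGrpCat.{u} ⋙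
      (evaluation _ _).obj (op U)))

instance (U : Opens X) (J : Type) : PreservesLimitsOfShape (Discrete J) (sectionsOver X U) :=
  have : PreservesLimitsOfSize.{0, 0} (sectionsOver X U) :=
    preservesLimitsOfSize_shrink.{0, u, 0, u} _
  inferInstance

variable (U : Opens X)

/-- The sheaf extension by zero of the restriction of a sheaf to `U`. -/
noncomputable abbrev shExtZero : Sh X ⥤ Sh X :=
  sheafToPresheaf (Opens.grothendieckTopology X) AddCommGrpCat.{u} ⋙ extZero U ⋙
    presheafToSheaf (Opens.grothendieckTopology X) AddCommGrpCat.{u}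

/-- Extension by zero is exact on sheaves: the presheaf cohomology of an exact complex of sheaves is
killed by sheafification, hence so is its extension by zero, which is a subobject of it. -/
lemma exact_map_shExtZero {S : ShortComplex (Sh X)} (hS : S.Exact) :
    (S.map (shExtZero U)).Exact := by
  let a := presheafToSheaf (Opens.grothendieckTopology X) AddCommGrpCat.{u}
  let T := S.map (sheafToPresheaf (Opens.grothendieckTopology X) AddCommGrpCat.{u})
  have h : IsZero (a.obj T.homology) := by
    have h1 : (T.map a).Exact := ShortComplex.exact_of_iso
      (S.mapNatIso (asIso (sheafificationAdjunction
        (Opens.grothendieckTopology X) AddCommGrpCat.{u}).counit)).symm hS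
    rw [ShortComplex.exact_iff_isZero_homology] at h1
    exact h1.of_iso (T.mapHomologyIso a).symm
  change ((T.map (extZero U)).map a).Exact
  rw [ShortComplex.exact_iff_isZero_homology]
  refine IsZero.of_iso ?_ ((T.map (extZero U)).mapHomologyIso a)
  refine IsZero.of_iso ?_ (a.mapIso (T.mapHomologyIso (extZero U)))
  exact IsZero.of_mono (a.map ((extZeroι U).app T.homology)) h

lemma acyclic_shExtZero {A : CochainComplex (Sh X) ℤ} (hA : A.Acyclic) :
    (((shExtZero U).mapHomologicalComplex _).obj A).Acyclic :=
  fun n => exact_map_shExtZero U (hA n)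

/-- Local sections over `U` of the sheaf of homomorphisms are morphisms from the extension by
zero. -/
noncomputable def sheafHomSectionsEquiv (A I : Sh X) :
    (homPresheaf A.obj I.obj).obj (op U) ≃+ ((shExtZero U).obj A ⟶ I) :=
  (extendHomEquiv (U := U) A.obj I.obj).trans
    { toEquiv := ((sheafificationAdjunction (Opens.grothendieckTopology X)
        AddCommGrpCat.{u}).homEquiv ((extZero U).obj A.obj) I).symm
      map_add' := Adjunction.homEquiv_symm_add (sheafificationAdjunction (Opens.grothendieckTopology X)
        AddCommGrpCat.{u}) }

lemma extendHom_sheafHomMap {A A' I I' : Sh X} (a : A' ⟶ A) (g : I ⟶ I')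
    (φ : (homPresheaf A.obj I.obj).obj (op U)) :
    extendHom (((sheafHomMap a g).hom.app (op U)).hom φ) =
      (extZero U).map a.hom ≫ extendHom φ ≫ g.hom := by
  refine NatTrans.ext (funext fun V => AddCommGrpCat.hom_ext (AddMonoidHom.ext fun s => ?_))
  by_cases h : V.unop ≤ U
  · refine (extendApp_of_le _ V h s).trans ?_
    exact congrArg (g.hom.app V).hom (extendApp_of_le φ V h
      ⟨(a.hom.app V).hom s.1, Or.inl h⟩).symm
  · obtain rfl := eq_zero_of_not_le h s
    exact (map_zero _).trans (map_zero _).symm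

lemma sheafHomSectionsEquiv_sheafHomMap {A A' I I' : Sh X} (a : A' ⟶ A) (g : I ⟶ I')
    (φ : (homPresheaf A.obj I.obj).obj (op U)) :
    sheafHomSectionsEquiv U A' I' (((sheafHomMap a g).hom.app (op U)).hom φ) =
      (shExtZero U).map a ≫ sheafHomSectionsEquiv U A I φ ≫ g := by
  refine (congrArg ((sheafificationAdjunction (Opens.grothendieckTopology X)
        AddCommGrpCat.{u}).homEquiv ((extZero U).obj A'.obj) I').symm
          (extendHom_sheafHomMap U a g φ)).trans ?_
  refine (Adjunction.homEquiv_naturality_left_symm _ _ _).trans ?_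
  exact congrArg (_ ≫ ·) (Adjunction.homEquiv_naturality_right_symm _ _ g)

/-- The component of `sheafHomSectionsEquiv` as a morphism of abelian groups. -/
noncomputable def sheafHomSections (A I : Sh X) :
    ((TotHom.postcomp (sheafHom X) (sectionsOver X U)).obj (op A)).obj I ⟶
      ((preadditiveCoyoneda (C := Sh X)).obj (op ((shExtZero U).obj A))).obj I :=
  AddCommGrpCat.ofHom (X := (homPresheaf A.obj I.obj).obj (op U))
    (sheafHomSectionsEquiv U A I).toAddMonoidHom

instance isIso_sheafHomSections (A I : Sh X) : IsIso (sheafHomSections U A I) :=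
  (AddEquiv.toAddCommGrpIso (X := (homPresheaf A.obj I.obj).obj (op U))
    (Y := AddCommGrpCat.of ((shExtZero U).obj A ⟶ I)) (sheafHomSectionsEquiv U A I)).isIso_hom

/-- The sections over `U` of `Hom(A, I)` form the total Hom complex from the extension by zero of `A`
to `I`, which is acyclic. -/
lemma acyclic_sections_sheafHom {A I : CochainComplex (Sh X) ℤ} (hA : A.Acyclic)
    [I.IsKInjective] :
    (((sectionsOver X U).mapHomologicalComplex _).obj
      (TotHom.complex (sheafHom X) A I)).Acyclic := by
  let c := TotHom.complexMap (H := TotHom.postcomp (sheafHom X) (sectionsOver X U))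
    (H' := preadditiveCoyoneda (C := Sh X)) (F := A) (I := I)
    (F' := ((shExtZero U).mapHomologicalComplex _).obj A) (I' := I)
    (fun p q => sheafHomSections U (A.X p) (I.X q))
    (fun p q q' => AddCommGrpCat.hom_ext (AddMonoidHom.ext fun φ =>
      (sheafHomSectionsEquiv_sheafHomMap U (𝟙 _) (I.d q q') φ).trans (by
        rw [CategoryTheory.Functor.map_id, Category.id_comp]; rfl)))
    (fun p p' q => AddCommGrpCat.hom_ext (AddMonoidHom.ext fun φ =>
      (sheafHomSectionsEquiv_sheafHomMap U (A.d p p') (𝟙 _) φ).trans (by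
        rw [Category.comp_id]; rfl)))
  have hc : IsIso c :=
    TotHom.isIso_complexMap _ _ _ (fun p q => isIso_sheafHomSections U (A.X p) (I.X q))
  exact fun n => (TotHom.acyclic_of_isKInjective (acyclic_shExtZero U hA) n).of_iso
    (asIso (TotHom.postcompHom (sheafHom X) (sectionsOver X U) A I) ≪≫ asIso c).symm

end

end SheafDuality

/-! ### Degreewise adjunctions and K-projective complexes of presheaves -/

namespace CochainComplex

open Opposite

section adjunction

variable {C : Type*} [Category* C] [Preadditive C] {D : Type*} [Category* D] [Preadditive D]
  {F : C ⥤ D} {G : D ⥤ C} [F.Additive] [G.Additive] (adj : F ⊣ G)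
  {K : CochainComplex C ℤ} {L : CochainComplex D ℤ}

/-- The morphism of complexes which is adjoint, in each degree, to a given morphism. -/
def adjHom (g : (F.mapHomologicalComplex _).obj K ⟶ L) :
    K ⟶ (G.mapHomologicalComplex _).obj L where
  f n := adj.homEquiv (K.X n) (L.X n) (g.f n)
  comm' n m _ := by
    refine (adj.homEquiv_naturality_right (g.f n) (L.d n m)).symm.trans
      (Eq.trans ?_ (adj.homEquiv_naturality_left (K.d n m) (g.f m)))
    exact congrArg _ (g.comm n m)

lemma adjHom_surjective (r : K ⟶ (G.mapHomologicalComplex _).obj L) :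
    ∃ g : (F.mapHomologicalComplex _).obj K ⟶ L, adjHom adj g = r :=
  ⟨{ f := fun n => (adj.homEquiv (K.X n) (L.X n)).symm (r.f n)
     comm' := fun n m _ => by
      refine (adj.homEquiv_naturality_right_symm (r.f n) (L.d n m)).symm.trans
        (Eq.trans ?_ (adj.homEquiv_naturality_left_symm (K.d n m) (r.f m)))
      exact congrArg _ (r.comm n m) },
    HomologicalComplex.hom_ext _ _ (fun n =>
      (adj.homEquiv (K.X n) (L.X n)).apply_symm_apply (r.f n))⟩

/-- A morphism is null-homotopic if its adjoint is. -/
def homotopyOfAdjHom {g : (F.mapHomologicalComplex _).obj K ⟶ L}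
    (h : Homotopy (adjHom adj g) 0) : Homotopy g 0 :=
  (Homotopy.ofEq (by
    ext n
    exact ((adj.homEquiv_counit _ _ _).symm.trans
      ((adj.homEquiv (K.X n) (L.X n)).symm_apply_apply (g.f n))).symm)).trans
  (((F.mapHomotopy h).compRight
    (((NatTrans.mapHomologicalComplex adj.counit (ComplexShape.up ℤ)).app L :
      (F.mapHomologicalComplex _).obj ((G.mapHomologicalComplex _).obj L) ⟶ _))).trans
    (Homotopy.ofEq ((congrArg (· ≫ _) (Functor.map_zero _ _ _)).trans zero_comp)))

/-- The adjoint of a null-homotopic morphism is null-homotopic. -/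
def homotopyAdjHom {g : (F.mapHomologicalComplex _).obj K ⟶ L}
    (h : Homotopy g 0) : Homotopy (adjHom adj g) 0 :=
  (Homotopy.ofEq (by
    ext n
    exact adj.homEquiv_unit _ _ _)).trans
  (((G.mapHomotopy h).compLeft
    (((NatTrans.mapHomologicalComplex adj.unit (ComplexShape.up ℤ)).app K :
      _ ⟶ (G.mapHomologicalComplex _).obj ((F.mapHomologicalComplex _).obj K)))).trans
    (Homotopy.ofEq ((congrArg (fun x => ((NatTrans.mapHomologicalComplex adj.unit
      (ComplexShape.up ℤ)).app K : _ ⟶ (G.mapHomologicalComplex _).obj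
        ((F.mapHomologicalComplex _).obj K)) ≫ x)
      ((G.mapHomologicalComplex (ComplexShape.up ℤ)).map_zero _ _)).trans comp_zero)))

end adjunction

section projective

variable {C : Type*} [Category* C] [Abelian C]

/-- The functor in `opEquivalence` sends a cochain complex to the opposite cochain complex, in which
degree `n` corresponds to degree `-n`. -/
lemma quasiIso_of_op {K L : CochainComplex C ℤ} (f : K ⟶ L)
    (hf : QuasiIso ((opEquivalence C).functor.map f.op)) : QuasiIso f where
  quasiIsoAt n := by
    obtain ⟨m, rfl⟩ : ∃ m, n = -m := ⟨-n, by simp⟩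
    have h := hf.quasiIsoAt m
    rw [quasiIsoAt_iff' _ (m - 1) m (m + 1) (by simp) (by simp)] at h
    rw [quasiIsoAt_iff' _ (-(m + 1)) (-m) (-(m - 1)) (by grind [prev]) (by grind [next])]
    exact (ShortComplex.quasiIso_opMap_iff
      ((HomologicalComplex.shortComplexFunctor' C (.up ℤ) (-(m + 1)) (-m) (-(m - 1))).map f)).1 h

/-- Bounded above complexes have K-projective resolutions, by duality with injective resolutions of
bounded below complexes. -/
lemma exists_quasiIso_isKProjective [EnoughProjectives C] (K : CochainComplex C ℤ) (n : ℤ)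
    [K.IsStrictlyLE n] :
    ∃ (P : CochainComplex C ℤ) (q : P ⟶ K), P.IsKProjective ∧ QuasiIso q := by
  let L := (opEquivalence C).functor.obj (op K)
  have : L.IsStrictlyGE (-n) := by
    rw [isStrictlyGE_iff]
    intro i hi
    exact (K.isZero_of_isStrictlyLE n (-i) (by lia)).op
  obtain ⟨L', i, _, _, _⟩ := Plus.modelCategoryQuillen.exists_quasiIso_injective L (-n)
  have : L'.IsKInjective := isKInjective_of_injective L' (-n)
  let e := (opEquivalence C).counitIso.app L'
  let P := ((opEquivalence C).inverse.obj L').unop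
  have : IsKInjective ((opEquivalence C).functor.obj (op P)) :=
    isKInjective_of_iso (L₁ := L') e.symm
  obtain ⟨f, hf⟩ := (opEquivalence C).functor.map_surjective (Y := op P) (i ≫ e.inv)
  refine ⟨P, f.unop, isKProjective_of_op this, quasiIso_of_op _ ?_⟩
  rw [Quiver.Hom.op_unop, hf]
  infer_instance

end projective

end CochainComplex

namespace SheafDuality

open TopologicalSpace Opposite

/-- The morphism `ZZ ⟶ G` which sends `1` to a given element. -/
def ofElement {G : AddCommGrpCat.{u}} (g : G) : ZZ ⟶ G :=
  AddCommGrpCat.ofHom ((zmultiplesHom G g).comp AddEquiv.ulift.toAddMonoidHom)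

lemma ofElement_one {G : AddCommGrpCat.{u}} (g : G) : (ofElement g).hom ⟨1⟩ = g := one_zsmul g

lemma ZZ_hom_ext {G : AddCommGrpCat.{u}} {f g : ZZ ⟶ G} (h : f.hom ⟨1⟩ = g.hom ⟨1⟩) : f = g := by
  ext ⟨n⟩
  have hn : (⟨n⟩ : ULift.{u} ℤ) = n • ⟨1⟩ := by ext; simp
  rw [hn]
  refine (map_zsmul f.hom n _).trans (Eq.trans ?_ (map_zsmul g.hom n _).symm)
  rw [h]

instance : Projective ZZ.{u} where
  factors {E Y} f e _ := by
    obtain ⟨y, hy⟩ := (AddCommGrpCat.epi_iff_surjective e).1 inferInstance (f.hom ⟨1⟩)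
    exact ⟨ofElement y, ZZ_hom_ext ((congrArg e.hom (ofElement_one y)).trans hy)⟩

section

variable {D : Type u} [SmallCategory D]

instance (U : D) : Projective (Presheaf.freeYoneda U ZZ.{u}) where
  factors {E Y} f e _ := by
    have : Epi (e.app (op U)) := inferInstance
    refine ⟨Presheaf.freeYonedaHomEquiv.symm
      (Projective.factorThru (Presheaf.freeYonedaHomEquiv f) (e.app (op U))), ?_⟩
    rw [Presheaf.freeYonedaHomEquiv_symm_comp, Projective.factorThru_comp,
      Equiv.symm_apply_apply]

/-- A presheaf `F` is covered by the free presheaves on all its sections. -/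
instance : EnoughProjectives (Dᵒᵖ ⥤ AddCommGrpCat.{u}) where
  presentation F := by
    let p (U : D) (s : F.obj (op U)) : Presheaf.freeYoneda U ZZ.{u} ⟶ F :=
      Presheaf.freeYonedaHomEquiv.symm (ofElement s)
    let q : (∐ fun x : Σ U : D, F.obj (op U) => Presheaf.freeYoneda x.1 ZZ.{u}) ⟶ F :=
      Sigma.desc (fun x => p x.1 x.2)
    have (U : Dᵒᵖ) : Epi (q.app U) := by
      rw [AddCommGrpCat.epi_iff_surjective]
      intro s
      have h1 := Presheaf.freeYonedaHomEquiv.apply_symm_apply (ofElement s)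
      have h2 : p U.unop s = Sigma.ι (fun x : Σ U : D, F.obj (op U) =>
          Presheaf.freeYoneda x.1 ZZ.{u}) ⟨U.unop, s⟩ ≫ q := by simp [q]
      change Presheaf.freeYonedaHomEquiv (p U.unop s) = _ at h1
      rw [h2, Presheaf.freeYonedaHomEquiv_comp] at h1
      exact ⟨_, (ConcreteCategory.congr_hom h1 ⟨1⟩).trans (ofElement_one s)⟩
    exact ⟨{ p := _, f := q, epi := NatTrans.epi_of_epi_app q }⟩

end

end SheafDuality

/-! ### Orthogonality and acyclicity of complexes of presheaves -/

namespace SheafDuality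

open TopologicalSpace Opposite

variable {X : TopCat.{u}}

variable (X) in
/-- The underlying presheaf of a sheaf of abelian groups. -/
abbrev toPSh : Sh X ⥤ ((Opens X)ᵒᵖ ⥤ AddCommGrpCat.{u}) :=
  sheafToPresheaf (Opens.grothendieckTopology X) AddCommGrpCat.{u}

variable (X) in
/-- The sheafification functor. -/
noncomputable abbrev toSh : ((Opens X)ᵒᵖ ⥤ AddCommGrpCat.{u}) ⥤ Sh X :=
  presheafToSheaf (Opens.grothendieckTopology X) AddCommGrpCat.{u}

lemma acyclic_toPSh_iff (D : CochainComplex (Sh X) ℤ) :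
    (((toPSh X).mapHomologicalComplex _).obj D).Acyclic ↔
      ∀ U, (((sectionsOver X U).mapHomologicalComplex _).obj D).Acyclic :=
  ⟨fun h U n => (exact_iff_evaluation _).1 (h n) (op U),
    fun h n => (exact_iff_evaluation _).2 (fun V => h V.unop n)⟩

lemma isZero_toSh_homology_iff (D : CochainComplex (Sh X) ℤ) (n : ℤ) :
    IsZero ((toSh X).obj ((((toPSh X).mapHomologicalComplex _).obj D).homology n)) ↔
      D.ExactAt n := by
  let S := (D.sc n).map (toPSh X)
  have e : S.map (toSh X) ≅ D.sc n := (D.sc n).mapNatIso (asIso (sheafificationAdjunction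
    (Opens.grothendieckTopology X) AddCommGrpCat.{u}).counit)
  rw [HomologicalComplex.exactAt_iff, ← ShortComplex.exact_iff_of_iso e,
    ShortComplex.exact_iff_isZero_homology]
  exact (S.mapHomologyIso (toSh X)).symm.isZero_iff

lemma exactAt_toSh {K : CochainComplex ((Opens X)ᵒᵖ ⥤ AddCommGrpCat.{u}) ℤ} {n : ℤ}
    (h : IsZero ((toSh X).obj (K.homology n))) :
    (((toSh X).mapHomologicalComplex _).obj K).ExactAt n := by
  rw [HomologicalComplex.exactAt_iff, ShortComplex.exact_iff_isZero_homology]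
  exact h.of_iso ((K.sc n).mapHomologyIso (toSh X))

lemma acyclic_of_acyclic_toPSh {D : CochainComplex (Sh X) ℤ}
    (h : (((toPSh X).mapHomologicalComplex _).obj D).Acyclic) : D.Acyclic := fun n => by
  rw [← isZero_toSh_homology_iff]
  exact (toSh X).map_isZero ((HomologicalComplex.exactAt_iff_isZero_homology _ _).1 (h n))

/-- When `A` is an acyclic complex of sheaves and `I` is K-injective, `Hom(A, I)` is acyclic even as a
complex of presheaves. -/
lemma acyclic_toPSh_sheafHom {A I : CochainComplex (Sh X) ℤ} (hA : A.Acyclic) [I.IsKInjective] :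
    (((toPSh X).mapHomologicalComplex _).obj (TotHom.complex (sheafHom X) A I)).Acyclic :=
  (acyclic_toPSh_iff _).2 (fun U => acyclic_sections_sheafHom U hA)

variable {P : CochainComplex ((Opens X)ᵒᵖ ⥤ AddCommGrpCat.{u}) ℤ}

lemma nonempty_homotopy_zero_of_acyclic_toPSh [P.IsKProjective] {D : CochainComplex (Sh X) ℤ}
    (hD : (((toPSh X).mapHomologicalComplex _).obj D).Acyclic)
    (g : ((toSh X).mapHomologicalComplex _).obj P ⟶ D) : Nonempty (Homotopy g 0) := by
  obtain ⟨h⟩ := CochainComplex.IsKProjective.nonempty_homotopy_zero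
    (CochainComplex.adjHom (sheafificationAdjunction _ _) g) hD
  exact ⟨CochainComplex.homotopyOfAdjHom _ h⟩

/-- If a K-projective complex of presheaves `P` becomes acyclic after sheafification, then the
complexes `Hom(F, I)` with `I` K-injective are orthogonal to the sheafification of `P`. -/
lemma nonempty_homotopy_zero_sheafHom [P.IsKProjective]
    (hP : (((toSh X).mapHomologicalComplex _).obj P).Acyclic)
    {F I : CochainComplex (Sh X) ℤ} [I.IsKInjective]
    (f : ((toSh X).mapHomologicalComplex _).obj P ⟶ TotHom.complex (sheafHom X) F I) :
    Nonempty (Homotopy f 0) := by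
  refine (sheafHomSymmetry X).nonempty_homotopy_zero (fun f => ?_) f
  -- `Hom(aP, I)` is acyclic and K-injective, hence contractible
  obtain ⟨h⟩ : Nonempty (Homotopy (𝟙 (TotHom.complex (sheafHom X)
      (((toSh X).mapHomologicalComplex _).obj P) I)) 0) := by
    refine (sheafHomSymmetry X).nonempty_homotopy_zero (fun f => ?_) _
    exact nonempty_homotopy_zero_of_acyclic_toPSh (acyclic_toPSh_sheafHom
      (acyclic_of_acyclic_toPSh (acyclic_toPSh_sheafHom hP))) f
  exact ⟨(Homotopy.ofEq (Category.comp_id f).symm).trans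
    ((h.compLeft f).trans (Homotopy.ofEq comp_zero))⟩

/-- An acyclic complex of sheaves is acyclic as a complex of presheaves as soon as it is orthogonal
to the sheafifications of those K-projective complexes of presheaves which become acyclic after
sheafification. -/
lemma acyclic_toPSh_of_orthogonal {D : CochainComplex (Sh X) ℤ} (hD : D.Acyclic)
    (h : ∀ (P : CochainComplex ((Opens X)ᵒᵖ ⥤ AddCommGrpCat.{u}) ℤ), P.IsKProjective →
      (((toSh X).mapHomologicalComplex _).obj P).Acyclic →
      ∀ g : ((toSh X).mapHomologicalComplex _).obj P ⟶ D, Nonempty (Homotopy g 0)) :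
    (((toPSh X).mapHomologicalComplex _).obj D).Acyclic := by
  intro n
  let K : CochainComplex ((Opens X)ᵒᵖ ⥤ AddCommGrpCat.{u}) ℤ :=
    ((toPSh X).mapHomologicalComplex (.up ℤ)).obj D
  -- a K-projective resolution of the truncation detects the cohomology in degree `n`
  obtain ⟨P, q, hP, _⟩ := CochainComplex.exists_quasiIso_isKProjective (K.truncLE n) n
  have hi (k : ℤ) (hk : k ≤ n) : QuasiIsoAt (q ≫ K.ιTruncLE n) k := by
    have := K.quasiIsoAt_ιTruncLE n k hk
    infer_instance
  have hP' : (((toSh X).mapHomologicalComplex _).obj P).Acyclic := by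
    intro k
    refine exactAt_toSh ?_
    by_cases hk : k ≤ n
    · have := hi k hk
      exact ((isZero_toSh_homology_iff D k).2 (hD k)).of_iso
        ((toSh X).mapIso (isoOfQuasiIsoAt (q ≫ K.ιTruncLE n) k))
    · have h0 : IsZero ((K.truncLE n).homology k) :=
        (HomologicalComplex.exactAt_iff_isZero_homology _ _).1
          ((K.truncLE n).exactAt_of_isLE n k (by lia))
      exact (toSh X).map_isZero (h0.of_iso (isoOfQuasiIsoAt q k))
  obtain ⟨g, hg⟩ := CochainComplex.adjHom_surjective (F := toSh X) (G := toPSh X) (K := P) (L := D)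
    (sheafificationAdjunction _ _) (q ≫ K.ιTruncLE n)
  obtain ⟨h₀⟩ := h P hP hP' g
  have h₁ : Homotopy (q ≫ K.ιTruncLE n) 0 :=
    (Homotopy.ofEq hg.symm).trans (CochainComplex.homotopyAdjHom _ h₀)
  have := hi n le_rfl
  have h₂ : HomologicalComplex.homologyMap (q ≫ K.ιTruncLE n) n = 0 := by
    rw [h₁.homologyMap_eq, HomologicalComplex.homologyMap_zero]
  have h₃ : IsIso (HomologicalComplex.homologyMap (q ≫ K.ιTruncLE n) n) := inferInstance
  rw [HomologicalComplex.exactAt_iff_isZero_homology]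
  rw [h₂] at h₃
  exact ((isIsoZero_iff_source_target_isZero _ _).1 h₃).2
end SheafDuality

/-! ### K-injective resolutions and sections of complexes of homomorphisms -/

lemma CochainComplex.acyclic_mappingCone_iff {C : Type u} [Category.{v} C] [Abelian C]
    {K L : CochainComplex C ℤ} (f : K ⟶ L) :
    (CochainComplex.mappingCone f).Acyclic ↔ QuasiIso f := by
  rw [← HomotopyCategory.quotient_obj_mem_subcategoryAcyclic_iff_acyclic,
    ← HomologicalComplex.mem_quasiIso_iff, ← HomotopyCategory.quotient_map_mem_quasiIso_iff,
    HomotopyCategory.quasiIso_eq_trW_subcategoryAcyclic]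
  exact ((HomotopyCategory.subcategoryAcyclic C).trW_iff_of_distinguished _
    (HomotopyCategory.mappingCone_triangleh_distinguished f)).symm

namespace DerivedCategory

open Pretriangulated

variable (C : Type u) [Category.{v} C] [Abelian C] [HasDerivedCategory.{w} C]
  [(Qh : HomotopyCategory C (ComplexShape.up ℤ) ⥤ DerivedCategory C).IsLeftAdjoint]

/-- The adjunction between the localization functor and the K-injective resolution functor. -/
noncomputable def injResAdj : (Qh : HomotopyCategory C (ComplexShape.up ℤ) ⥤ _) ⊣ injRes C :=
  Adjunction.ofIsLeftAdjoint Qh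

/-- The right adjoint of a localization functor is fully faithful. -/
instance : IsIso (injResAdj C).counit := by
  let adj := injResAdj C
  -- the unit of the adjunction factors through the localization functor
  obtain ⟨τ, hτ⟩ := ((Functor.whiskeringLeft _ _ (DerivedCategory C)).obj (Qh (C := C))).map_surjective
    (X := 𝟭 _) (Y := injRes C ⋙ Qh) (Functor.whiskerRight adj.unit Qh)
  have hτ' (K) : τ.app (Qh.obj K) = Qh.map (adj.unit.app K) := congrArg (fun α => α.app K) hτ
  refine ⟨τ, ?_, ?_⟩
  · ext M
    have h := τ.naturality (adj.counit.app M)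
    have h' := adj.right_triangle_components M
    change adj.counit.app M ≫ τ.app M = 𝟙 _
    refine h.trans ?_
    change τ.app (Qh.obj ((injRes C).obj M)) ≫ Qh.map ((injRes C).map (adj.counit.app M)) = _
    rw [hτ']
    exact (Qh.map_comp _ _).symm.trans ((congrArg Qh.map h').trans (Qh.map_id _))
  · refine ((Functor.whiskeringLeft _ _ (DerivedCategory C)).obj (Qh (C := C))).map_injective ?_
    ext K
    change τ.app (Qh.obj K) ≫ adj.counit.app (Qh.obj K) = 𝟙 _
    rw [hτ']
    exact adj.left_triangle_components K

instance (K : HomotopyCategory C (ComplexShape.up ℤ)) :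
    IsIso (Qh.map ((injResAdj C).unit.app K)) := by
  have h := (injResAdj C).left_triangle_components K
  rw [← IsIso.eq_comp_inv] at h
  rw [h]
  exact inferInstanceAs (IsIso (𝟙 (Qh.obj K) ≫ inv ((injResAdj C).counit.app (Qh.obj K))))

variable {C}

lemma isIso_Qh_map_quotient_map_iff {K L : CochainComplex C ℤ} (f : K ⟶ L) :
    IsIso (Qh.map ((HomotopyCategory.quotient C (.up ℤ)).map f)) ↔ QuasiIso f :=
  (NatIso.isIso_map_iff (quotientCompQhIso C) f).trans (isIso_Q_map_iff_quasiIso C f)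

lemma isZero_Q_obj {K : CochainComplex C ℤ} (hK : K.Acyclic) : IsZero (Q.obj K) := by
  have : QuasiIso (0 : K ⟶ 0) :=
    ⟨fun n => (quasiIsoAt_iff_exactAt _ _ (hK n)).2
      ((HomologicalComplex.exactAt_iff_isZero_homology _ _).2
        ((HomologicalComplex.homologyFunctor C _ n).map_isZero (isZero_zero _)))⟩
  exact (Q.map_isZero (isZero_zero _)).of_iso (asIso (Q.map (0 : K ⟶ 0)))

/-- A morphism from an acyclic complex to a complex in the image of the right adjoint of the
localization functor corresponds to a morphism from a zero object. -/
instance isKInjective_injRes (M : DerivedCategory C) :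
    CochainComplex.IsKInjective ((injRes C).obj M).as where
  nonempty_homotopy_zero {K} f hK := by
    refine ⟨HomotopyCategory.homotopyOfEq _ _ ?_⟩
    exact ((injResAdj C).homEquiv ((HomotopyCategory.quotient _ _).obj K) M).symm.injective
      (((isZero_Q_obj hK).of_iso ((quotientCompQhIso C).app K)).eq_of_src _ _)

end DerivedCategory

namespace SheafDuality

open TopologicalSpace Opposite DerivedCategory

variable {X : TopCat.{u}}

section

open Pretriangulated HomotopyCategory

/-- The orthogonality of `Hom(F, I)` to the sheafification of `P` holds up to a shift, as the shift
can be moved to `P`. -/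
lemma quotient_map_eq_zero_sheafHom_shift
    {P : CochainComplex ((Opens X)ᵒᵖ ⥤ AddCommGrpCat.{u}) ℤ} [P.IsKProjective]
    (hP : (((toSh X).mapHomologicalComplex _).obj P).Acyclic)
    {F I : CochainComplex (Sh X) ℤ} [I.IsKInjective]
    (f : (quotient _ _).obj (((toSh X).mapHomologicalComplex _).obj P) ⟶
      ((quotient _ _).obj (TotHom.complex (sheafHom X) F I))⟦(1 : ℤ)⟧) : f = 0 := by
  let aP' := ((toSh X).mapHomologicalComplex (.up ℤ)).obj (P⟦(-1 : ℤ)⟧)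
  let e : (quotient _ _).obj aP' ≅
      ((quotient _ _).obj (((toSh X).mapHomologicalComplex (.up ℤ)).obj P))⟦(-1 : ℤ)⟧ :=
    (quotient _ _).mapIso ((((toSh X).mapHomologicalComplex (.up ℤ)).commShiftIso (-1 : ℤ)).app P) ≪≫
      ((quotient (Sh X) (.up ℤ)).commShiftIso (-1 : ℤ)).app _
  have haP' : aP'.Acyclic := by
    rw [← quotient_obj_mem_subcategoryAcyclic_iff_acyclic] at hP ⊢
    exact (subcategoryAcyclic (Sh X)).prop_of_iso e.symm
      ((subcategoryAcyclic (Sh X)).le_shift (-1 : ℤ) _ hP)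
  let g : (quotient _ _).obj aP' ⟶ (quotient _ _).obj (TotHom.complex (sheafHom X) F I) :=
    e.hom ≫ f⟦(-1 : ℤ)⟧' ≫ (shiftShiftNeg _ (1 : ℤ)).hom
  have hg : g = 0 := by
    obtain ⟨g', hg'⟩ := (quotient _ _).map_surjective g
    obtain ⟨h⟩ := nonempty_homotopy_zero_sheafHom haP' g'
    rw [← hg', eq_of_homotopy _ _ h, Functor.map_zero]
  have hf : f⟦(-1 : ℤ)⟧' = 0 := by
    rw [← cancel_epi e.hom, ← cancel_mono (shiftShiftNeg _ (1 : ℤ)).hom, Category.assoc]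
    exact hg.trans (by rw [comp_zero, zero_comp])
  exact (shiftFunctor (HomotopyCategory (Sh X) (.up ℤ)) (-1 : ℤ)).map_injective
    (hf.trans (Functor.map_zero _ _ _).symm)

/-- The functor of sections over `U` sends quasi-isomorphisms from `Hom(F, I)` to a K-injective
complex to quasi-isomorphisms, when `I` is K-injective. -/
lemma quasiIso_sections_map (U : Opens X) {F I J : CochainComplex (Sh X) ℤ} [I.IsKInjective]
    [J.IsKInjective] (j : TotHom.complex (sheafHom X) F I ⟶ J) [QuasiIso j] :
    QuasiIso (((sectionsOver X U).mapHomologicalComplex (.up ℤ)).map j) := by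
  refine (CochainComplex.acyclic_mappingCone_iff _).1 ?_
  refine CochainComplex.acyclic_of_iso
    (CochainComplex.mappingCone.mapHomologicalComplexIso j (sectionsOver X U)) ?_
  have hj : (CochainComplex.mappingCone j).Acyclic :=
    (CochainComplex.acyclic_mappingCone_iff j).2 inferInstance
  refine (acyclic_toPSh_iff _).1 (acyclic_toPSh_of_orthogonal hj (fun P _ hP g => ?_)) U
  refine ⟨homotopyOfEq _ _ ?_⟩
  -- use the long exact sequence of the triangle given by the mapping cone of `j`
  obtain ⟨g', hg'⟩ := Triangle.coyoneda_exact₃ _ (mappingCone_triangleh_distinguished j)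
    ((quotient _ _).map g) (quotient_map_eq_zero_sheafHom_shift hP _)
  obtain ⟨g', rfl⟩ := (quotient _ _).map_surjective g'
  have h0 : (quotient (Sh X) (.up ℤ)).map g' = 0 :=
    (eq_of_homotopy _ _ (CochainComplex.IsKInjective.homotopyZero (L := J) g' hP)).trans
      (Functor.map_zero _ _ _)
  exact hg'.trans ((congrArg (· ≫ _) h0).trans (zero_comp.trans (Functor.map_zero _ _ _).symm))

end

end SheafDuality

/-! ### Derived global sections of derived homomorphisms -/

namespace DerivedCategory

variable {C : Type u} [Category.{v} C] [Abelian C] [HasDerivedCategory.{w} C]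
  [HasDerivedCategory.{w'} AddCommGrpCat.{v}]
  [(Qh : HomotopyCategory C (ComplexShape.up ℤ) ⥤ DerivedCategory C).IsLeftAdjoint]

/-- The derived complex of homomorphisms of an abelian category. -/
noncomputable def derivedHom :
    (DerivedCategory C)ᵒᵖ ⥤ DerivedCategory C ⥤ DerivedCategory AddCommGrpCat.{v} :=
  rightDerivedHom preadditiveCoyoneda

end DerivedCategory

namespace SheafDuality

open TopologicalSpace Opposite DerivedCategory

variable (X : TopCat.{u})

section

/-- Global sections of the sheaf of homomorphisms are morphisms. -/
noncomputable def globalHom (A I : Sh X) :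
    ((TotHom.postcomp (sheafHom X) (globalSections X)).obj (op A)).obj I ⟶
      ((preadditiveCoyoneda (C := Sh X)).obj (op A)).obj I :=
  AddCommGrpCat.ofHom (X := (homPresheaf A.obj I.obj).obj (op ⊤)) (Y := A ⟶ I)
    { toFun := fun φ => ⟨
        { app := fun V => AddCommGrpCat.ofHom (evalHom φ (op (Over.mk (homOfLE le_top))))
          naturality := fun V V' i => AddCommGrpCat.hom_ext (AddMonoidHom.ext fun s =>
            evalHom_naturality φ (Quiver.Hom.op (Over.homMk i.unop :
              Over.mk (homOfLE (le_top : V'.unop ≤ ⊤)) ⟶ Over.mk (homOfLE le_top))) s) }⟩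
      map_zero' := rfl
      map_add' := fun _ _ => rfl }

lemma isIso_globalHom (A I : Sh X) : IsIso (globalHom X A I) := by
  refine (ConcreteCategory.isIso_iff_bijective _).2 ⟨fun φ ψ h => ?_, fun f => ?_⟩
  · refine homPresheaf_ext (B := A.obj) (I := I.obj) (fun V b => ?_)
    exact ConcreteCategory.congr_hom
      (congrArg (fun f : A ⟶ I => f.hom.app (op V.unop.left)) h) b
  · exact ⟨Functor.whiskerLeft (Over.forget _).op f.hom, rfl⟩

/-- Global sections of the total Hom complex with respect to the sheaf of homomorphisms form the
total Hom complex of abelian groups. -/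
noncomputable def globalSectionsComplex (F I : CochainComplex (Sh X) ℤ) :
    ((globalSections X).mapHomologicalComplex _).obj (TotHom.complex (sheafHom X) F I) ⟶
      TotHom.complex (preadditiveCoyoneda (C := Sh X)) F I :=
  TotHom.postcompHom (sheafHom X) (globalSections X) F I ≫
    TotHom.complexMap (fun _ _ => globalHom X _ _)
      (fun _ _ _ => rfl) (fun _ _ _ => rfl)

instance (F I : CochainComplex (Sh X) ℤ) : IsIso (globalSectionsComplex X F I) :=
  have : IsIso (TotHom.postcompHom (sheafHom X) (globalSections X) F I) :=
    TotHom.isIso_postcompHom (sheafHom X) (sectionsOver X ⊤) F I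
  IsIso.comp_isIso' this (TotHom.isIso_complexMap _ _ _ (fun _ _ => isIso_globalHom X _ _))

lemma globalSectionsComplex_naturality {F F' I I' : CochainComplex (Sh X) ℤ} (f : F' ⟶ F)
    (g : I ⟶ I') :
    ((globalSections X).mapHomologicalComplex _).map (TotHom.map (sheafHom X) f g) ≫
        globalSectionsComplex X F' I' =
      globalSectionsComplex X F I ≫ TotHom.map (preadditiveCoyoneda (C := Sh X)) f g := by
  refine (Category.assoc _ _ _).symm.trans ((congrArg (· ≫ _)
    (TotHom.postcompHom_naturality (sheafHom X) (globalSections X) f g)).trans ?_)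
  refine (Category.assoc _ _ _).trans (Eq.trans (congrArg (_ ≫ ·) ?_) (Category.assoc _ _ _).symm)
  exact TotHom.complexMap_naturality _ _ _ _ _ _ f g f g (fun p q => rfl)

/-- Global sections of the total Hom complex, as bifunctors on homotopy categories. -/
noncomputable def globalSectionsBifunctor :
    TotHom.bifunctorK (sheafHom X) ⋙
      (Functor.whiskeringRight _ _ _).obj ((globalSections X).mapHomotopyCategory _) ⟶
    TotHom.bifunctorK (preadditiveCoyoneda (C := Sh X)) :=
  TotHom.natTransMk
    (fun F I => (HomotopyCategory.quotient _ _).map (globalSectionsComplex X F I))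
    (fun {F F'} f I => by
      refine ((HomotopyCategory.quotient _ _).map_comp _ _).symm.trans
        (Eq.trans ?_ ((HomotopyCategory.quotient _ _).map_comp _ _))
      exact congrArg _ (globalSectionsComplex_naturality X f (𝟙 I)))
    (fun F {I I'} g => by
      refine ((HomotopyCategory.quotient _ _).map_comp _ _).symm.trans
        (Eq.trans ?_ ((HomotopyCategory.quotient _ _).map_comp _ _))
      exact congrArg _ (globalSectionsComplex_naturality X (𝟙 F) g))

instance : IsIso (globalSectionsBifunctor X) :=
  TotHom.isIso_natTransMk _ _ _ (fun F I =>
    Functor.map_isIso (HomotopyCategory.quotient _ (.up ℤ)) (globalSectionsComplex X F I))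

end

section

variable [HasDerivedCategory.{v} (Sh X)] [HasDerivedCategory.{w} AddCommGrpCat.{u}]

/-- The comparison between the global sections of a complex of sheaves and its derived global
sections. -/
noncomputable def toRΓ : (globalSections X).mapHomotopyCategory (.up ℤ) ⋙ Qh ⟶ Qh ⋙ RΓ X :=
  Functor.whiskerRight (injResAdj (Sh X)).unit ((globalSections X).mapHomotopyCategory (.up ℤ) ⋙ Qh)

/-- The total Hom complex with values in sheaves from `F` to a K-injective complex need not be
K-injective, but its global sections compute its derived global sections. -/
lemma isIso_toRΓ_app (F M : DerivedCategory (Sh X)) :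
    IsIso ((toRΓ X).app (((TotHom.bifunctorK (sheafHom X)).obj (op ((injRes _).obj F))).obj
      ((injRes _).obj M))) := by
  let K := TotHom.complex (sheafHom X) ((injRes _).obj F).as ((injRes _).obj M).as
  let J := ((injRes (Sh X)).obj (Qh.obj ((HomotopyCategory.quotient _ _).obj K))).as
  obtain ⟨j, hj⟩ := (HomotopyCategory.quotient (Sh X) (.up ℤ)).map_surjective (X := K) (Y := J)
    ((injResAdj (Sh X)).unit.app ((HomotopyCategory.quotient _ _).obj K))
  have hj' : QuasiIso j := by
    rw [← isIso_Qh_map_quotient_map_iff, hj]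
    exact inferInstanceAs (IsIso (Qh.map ((injResAdj (Sh X)).unit.app
      ((HomotopyCategory.quotient _ _).obj K))))
  have : CochainComplex.IsKInjective J := isKInjective_injRes _
  have : CochainComplex.IsKInjective ((injRes _).obj M).as := isKInjective_injRes _
  have h := quasiIso_sections_map ⊤ j
  rw [← isIso_Qh_map_quotient_map_iff] at h
  change IsIso (Qh.map (((globalSections X).mapHomotopyCategory (.up ℤ)).map
    ((injResAdj (Sh X)).unit.app ((HomotopyCategory.quotient _ _).obj K))))
  rw [← hj]
  exact h

/-- Derived global sections of the derived sheaf of homomorphisms. -/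
noncomputable def RΓRHHomIso :
    RHHom X ⋙ (Functor.whiskeringRight _ _ _).obj (RΓ X) ≅
      derivedHom (C := Sh X) := by
  let B := (injRes (Sh X)).op ⋙ TotHom.bifunctorK (sheafHom X) ⋙
    (Functor.whiskeringLeft _ _ _).obj (injRes (Sh X))
  let τ : B ⋙ (Functor.whiskeringRight _ _ _).obj
      ((globalSections X).mapHomotopyCategory (.up ℤ) ⋙ Qh) ⟶
      B ⋙ (Functor.whiskeringRight _ _ _).obj (Qh ⋙ RΓ X) :=
    Functor.whiskerLeft B ((Functor.whiskeringRight _ _ _).map (toRΓ X))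
  have hτ : IsIso τ := by
    rw [NatTrans.isIso_iff_isIso_app]
    intro F
    rw [NatTrans.isIso_iff_isIso_app]
    exact fun M => isIso_toRΓ_app X F.unop M
  exact (asIso τ).symm ≪≫ Functor.isoWhiskerLeft (injRes (Sh X)).op
    (Functor.isoWhiskerRight (asIso (globalSectionsBifunctor X))
      ((Functor.whiskeringLeft _ _ _).obj (injRes (Sh X)) ⋙ (Functor.whiskeringRight _ _ _).obj Qh))

end

end SheafDuality

/-! ### Cohomology of total Hom complexes -/

namespace TotHom

open CochainComplex HomComplex Opposite

section

variable {C : Type u} [Category.{v} C] [Abelian C]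

/-- The cocycle corresponding to a cycle of the total Hom complex. -/
noncomputable def cocycleOf {A B : CochainComplex C ℤ} {n : ℤ}
    (y : (complex (preadditiveCoyoneda (C := C)) A B).cycles n) : Cocycle A B n :=
  Cocycle.mk (((homComplexIso A B).hom.f n).hom
    (((complex (preadditiveCoyoneda (C := C)) A B).iCycles n).hom y)) (n + 1) rfl (by
      have h := ConcreteCategory.congr_hom ((homComplexIso A B).hom.comm n (n + 1))
        (((complex (preadditiveCoyoneda (C := C)) A B).iCycles n).hom y)
      refine h.trans ?_
      have h' := ConcreteCategory.congr_hom
        ((complex (preadditiveCoyoneda (C := C)) A B).iCycles_d n (n + 1)) y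
      refine (congrArg ((homComplexIso A B).hom.f (n + 1)).hom h').trans ?_
      exact map_zero _)

/-- The cohomology of the total Hom complex consists of homotopy classes of morphisms to shifted
complexes. -/
noncomputable def homologyHomEquiv (A B : CochainComplex C ℤ) (n : ℤ) :
    (complex (preadditiveCoyoneda (C := C)) A B).homology n ≃+
      ((HomotopyCategory.quotient C (.up ℤ)).obj A ⟶
        ((HomotopyCategory.quotient C (.up ℤ)).obj B)⟦n⟧) :=
  ((((HomologicalComplex.homologyFunctor _ _ n).mapIso (homComplexIso A B)).addCommGroupIsoToAddEquiv.trans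
    (homologyAddEquiv A B n)).trans CohomologyClass.homAddEquiv).trans
    { toEquiv := Iso.homToEquiv (((HomotopyCategory.quotient C (.up ℤ)).commShiftIso n).app B)
      map_add' := fun _ _ => Preadditive.add_comp _ _ _ _ _ _ }

lemma homologyHomEquiv_homologyπ {A B : CochainComplex C ℤ} {n : ℤ}
    (y : (complex (preadditiveCoyoneda (C := C)) A B).cycles n) :
    homologyHomEquiv A B n (((complex (preadditiveCoyoneda (C := C)) A B).homologyπ n).hom y) =
      (HomotopyCategory.quotient C (.up ℤ)).map (Cocycle.equivHomShift.symm (cocycleOf y)) ≫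
        ((HomotopyCategory.quotient C (.up ℤ)).commShiftIso n).hom.app B := by
  have h₁ := ConcreteCategory.congr_hom (HomologicalComplex.homologyπ_naturality
    (homComplexIso A B).hom n) y
  have h₂ := ConcreteCategory.congr_hom ((leftHomologyData A B n).homologyπ_comp_homologyIso_hom)
    (HomologicalComplex.cyclesMap (homComplexIso A B).hom n y)
  have h₃ : (leftHomologyData A B n).cyclesIso.hom.hom
      ((HomologicalComplex.cyclesMap (homComplexIso A B).hom n).hom y) = cocycleOf y := by
    refine Subtype.ext ?_
    refine (ConcreteCategory.congr_hom ((leftHomologyData A B n).cyclesIso_hom_comp_i)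
      ((HomologicalComplex.cyclesMap (homComplexIso A B).hom n).hom y)).trans ?_
    exact ConcreteCategory.congr_hom (HomologicalComplex.cyclesMap_i (homComplexIso A B).hom n) y
  refine congrArg (· ≫ ((HomotopyCategory.quotient C (.up ℤ)).commShiftIso n).hom.app B)
    (?_ : CohomologyClass.toHom ((leftHomologyData A B n).homologyIso.hom.hom
    ((HomologicalComplex.homologyMap (homComplexIso A B).hom n).hom
      (((complex (preadditiveCoyoneda (C := C)) A B).homologyπ n).hom y))) = _)
  refine (congrArg (fun z => CohomologyClass.toHom ((leftHomologyData A B n).homologyIso.hom.hom z))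
    h₁).trans ?_
  refine (congrArg CohomologyClass.toHom h₂).trans ?_
  refine (congrArg (fun z => CohomologyClass.toHom (CohomologyClass.mk z)) h₃).trans ?_
  rfl

lemma homologyπ_surjective {A B : CochainComplex C ℤ} {n : ℤ}
    (x : (complex (preadditiveCoyoneda (C := C)) A B).homology n) :
    ∃ y, ((complex (preadditiveCoyoneda (C := C)) A B).homologyπ n).hom y = x :=
  (AddCommGrpCat.epi_iff_surjective _).1 inferInstance x

lemma cocycleOf_cyclesMap {A B A' B' : CochainComplex C ℤ} (a : A' ⟶ A) (b : B ⟶ B') {n : ℤ}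
    (y : (complex (preadditiveCoyoneda (C := C)) A B).cycles n) :
    cocycleOf ((HomologicalComplex.cyclesMap (map preadditiveCoyoneda a b) n).hom y) =
      ((cocycleOf y).precomp a).postcomp b := by
  ext p q hpq
  refine (congrArg (comp A' B' n p q) (ConcreteCategory.congr_hom
    (HomologicalComplex.cyclesMap_i (map (preadditiveCoyoneda (C := C)) a b) n) y)).trans ?_
  refine (comp_map a b n p q _).trans ?_
  simp only [Cocycle.postcomp_coe, Cocycle.precomp_coe, Cochain.comp_zero_cochain_v,
    Cochain.zero_cochain_comp_v, Cochain.ofHom_v, Category.assoc]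
  rfl

/-- The identification of the cohomology of total Hom complexes is natural. -/
lemma homologyHomEquiv_map {A B A' B' : CochainComplex C ℤ} (a : A' ⟶ A) (b : B ⟶ B') {n : ℤ}
    (x : (complex (preadditiveCoyoneda (C := C)) A B).homology n) :
    homologyHomEquiv A' B' n
        ((HomologicalComplex.homologyMap (map preadditiveCoyoneda a b) n).hom x) =
      (HomotopyCategory.quotient C (.up ℤ)).map a ≫ homologyHomEquiv A B n x ≫
        ((HomotopyCategory.quotient C (.up ℤ)).map b)⟦n⟧' := by
  obtain ⟨y, rfl⟩ := homologyπ_surjective x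
  refine (congrArg (homologyHomEquiv A' B' n) (ConcreteCategory.congr_hom
    (HomologicalComplex.homologyπ_naturality (map preadditiveCoyoneda a b) n) y)).trans ?_
  refine (homologyHomEquiv_homologyπ _).trans ?_
  refine (congrArg (fun z => (HomotopyCategory.quotient C (.up ℤ)).map
    (Cocycle.equivHomShift.symm z) ≫ ((HomotopyCategory.quotient C (.up ℤ)).commShiftIso n).hom.app
      B') (cocycleOf_cyclesMap a b y)).trans ?_
  rw [Cocycle.equivHomShift_symm_postcomp, Cocycle.equivHomShift_symm_precomp,
    homologyHomEquiv_homologyπ, Functor.map_comp, Functor.map_comp, Category.assoc, Category.assoc,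
    Category.assoc]
  exact congrArg (fun z => _ ≫ _ ≫ z)
    ((HomotopyCategory.quotient C (.up ℤ)).commShiftIso_hom_naturality b n)

variable {C' : Type u} [Category.{v} C'] [Abelian C'] (Φ : C ⥤ C') [Φ.Additive]

/-- The action of an additive functor on total Hom complexes. -/
noncomputable def mapComplex (A B : CochainComplex C ℤ) :
    complex (preadditiveCoyoneda (C := C)) A B ⟶
      complex (preadditiveCoyoneda (C := C')) ((Φ.mapHomologicalComplex _).obj A)
        ((Φ.mapHomologicalComplex _).obj B) :=
  complexMap (fun p q => AddCommGrpCat.ofHom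
      (X := A.X p ⟶ B.X q) (Y := Φ.obj (A.X p) ⟶ Φ.obj (B.X q)) Φ.mapAddHom)
    (fun _ _ _ => AddCommGrpCat.hom_ext (AddMonoidHom.ext fun _ => Φ.map_comp _ _))
    (fun _ _ _ => AddCommGrpCat.hom_ext (AddMonoidHom.ext fun _ => Φ.map_comp _ _))

lemma mapComplex_naturality {A B A' B' : CochainComplex C ℤ} (a : A' ⟶ A) (b : B ⟶ B') :
    map preadditiveCoyoneda a b ≫ mapComplex Φ A' B' =
      mapComplex Φ A B ≫ map preadditiveCoyoneda ((Φ.mapHomologicalComplex _).map a)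
        ((Φ.mapHomologicalComplex _).map b) :=
  complexMap_naturality _ _ _ _ _ _ _ _ _ _ (fun _ _ => AddCommGrpCat.hom_ext
    (AddMonoidHom.ext fun _ => (Φ.map_comp _ _).trans (congrArg (· ≫ _) (Φ.map_comp _ _))))

lemma mapComplex_f_π (A B : CochainComplex C ℤ) (n p q : ℤ) :
    (mapComplex Φ A B).f n ≫ π _ _ n p q = π A B n p q ≫ AddCommGrpCat.ofHom
      (X := A.X p ⟶ B.X q) (Y := Φ.obj (A.X p) ⟶ Φ.obj (B.X q)) Φ.mapAddHom :=
  complexMap_f_π _ _ _ n p q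

lemma comp_mapComplex (A B : CochainComplex C ℤ) (n p q : ℤ)
    (x : (complex (preadditiveCoyoneda (C := C)) A B).X n) :
    comp _ _ n p q (((mapComplex Φ A B).f n).hom x) = Φ.map (comp A B n p q x) :=
  ConcreteCategory.congr_hom (mapComplex_f_π Φ A B n p q) x

lemma equivHomShift_symm_f {A B : CochainComplex C ℤ} {n : ℤ} (z : Cocycle A B n) (p : ℤ) :
    (Cocycle.equivHomShift.symm z).f p = z.1.v p (p + n) rfl := by
  rw [Cocycle.equivHomShift_symm_apply]
  exact (Cochain.rightShift_v z.1 n 0 (zero_add n) p p (add_zero p) _ rfl).trans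
    (Category.comp_id _)

lemma equivHomShift_symm_map {A B : CochainComplex C ℤ} {n : ℤ} (z : Cocycle A B n)
    (z' : Cocycle ((Φ.mapHomologicalComplex _).obj A) ((Φ.mapHomologicalComplex _).obj B) n)
    (h : ∀ p q hpq, z'.1.v p q hpq = Φ.map (z.1.v p q hpq)) :
    Cocycle.equivHomShift.symm z' = (Φ.mapHomologicalComplex _).map (Cocycle.equivHomShift.symm z) ≫
      ((Φ.mapHomologicalComplex (.up ℤ)).commShiftIso n).hom.app B := by
  ext p
  refine (equivHomShift_symm_f z' p).trans ((h _ _ _).trans ?_)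
  refine (congrArg Φ.map (equivHomShift_symm_f z p).symm).trans ?_
  exact (Category.comp_id _).symm

lemma quotient_map_commShiftIso_hom_app (B : CochainComplex C ℤ) (n : ℤ) :
    (HomotopyCategory.quotient C' (.up ℤ)).map
        (((Φ.mapHomologicalComplex (.up ℤ)).commShiftIso n).hom.app B) ≫
      ((HomotopyCategory.quotient C' (.up ℤ)).commShiftIso n).hom.app
        ((Φ.mapHomologicalComplex (.up ℤ)).obj B) =
    (Φ.mapHomotopyCategory (.up ℤ)).map
        (((HomotopyCategory.quotient C (.up ℤ)).commShiftIso n).hom.app B) ≫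
      ((Φ.mapHomotopyCategory (.up ℤ)).commShiftIso n).hom.app
        ((HomotopyCategory.quotient C (.up ℤ)).obj B) := by
  have h := NatTrans.shift_app_comm (Φ.mapHomotopyCategoryFactors (.up ℤ)).hom n B
  rw [Functor.commShiftIso_comp_hom_app, Functor.commShiftIso_comp_hom_app] at h
  refine (Category.id_comp _).symm.trans (h.symm.trans ?_)
  refine Eq.trans (congrArg (_ ≫ ·) ?_) (Category.comp_id _)
  exact (CategoryTheory.shiftFunctor (HomotopyCategory C' (.up ℤ)) n).map_id _

/-- The identification of the cohomology of total Hom complexes is compatible with additive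
functors. -/
lemma homologyHomEquiv_mapComplex {A B : CochainComplex C ℤ} {n : ℤ}
    (x : (complex (preadditiveCoyoneda (C := C)) A B).homology n) :
    homologyHomEquiv _ _ n ((HomologicalComplex.homologyMap (mapComplex Φ A B) n).hom x) =
      (Φ.mapHomotopyCategory (.up ℤ)).map (homologyHomEquiv A B n x) ≫
        ((Φ.mapHomotopyCategory (.up ℤ)).commShiftIso n).hom.app
          ((HomotopyCategory.quotient _ _).obj B) := by
  obtain ⟨y, rfl⟩ := homologyπ_surjective x
  refine (congrArg (homologyHomEquiv _ _ n) (ConcreteCategory.congr_hom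
    (HomologicalComplex.homologyπ_naturality (mapComplex Φ A B) n) y)).trans ?_
  refine (homologyHomEquiv_homologyπ _).trans ?_
  have h := equivHomShift_symm_map Φ (cocycleOf y)
    (cocycleOf ((HomologicalComplex.cyclesMap (mapComplex Φ A B) n).hom y)) (fun p q hpq =>
      (congrArg (comp _ _ n p q) (ConcreteCategory.congr_hom
        (HomologicalComplex.cyclesMap_i (mapComplex Φ A B) n) y)).trans
          (comp_mapComplex Φ A B n p q _))
  refine (congrArg (fun f => (HomotopyCategory.quotient C' (.up ℤ)).map f ≫
    ((HomotopyCategory.quotient C' (.up ℤ)).commShiftIso n).hom.app _) h).trans ?_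
  refine Eq.trans ?_ (congrArg (fun f => (Φ.mapHomotopyCategory (.up ℤ)).map f ≫
    ((Φ.mapHomotopyCategory (.up ℤ)).commShiftIso n).hom.app
          ((HomotopyCategory.quotient _ _).obj B)) (homologyHomEquiv_homologyπ y).symm)
  refine (congrArg (· ≫ _) ((HomotopyCategory.quotient C' (.up ℤ)).map_comp _ _)).trans ?_
  refine (Category.assoc _ _ _).trans ?_
  refine (congrArg (_ ≫ ·) (quotient_map_commShiftIso_hom_app Φ B n)).trans ?_
  refine (Category.assoc _ _ _).symm.trans (congrArg (· ≫ _) ?_)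
  exact ((Φ.mapHomotopyCategory (.up ℤ)).map_comp
    ((HomotopyCategory.quotient C (.up ℤ)).map (Cocycle.equivHomShift.symm (cocycleOf y)))
    (((HomotopyCategory.quotient C (.up ℤ)).commShiftIso n).hom.app B)).symm

end

end TotHom

/-! ### Cohomology of derived complexes of homomorphisms -/

namespace DerivedCategory

open CochainComplex HomComplex Opposite TotHom

section

variable {C : Type u} [Category.{v} C] [Abelian C] [HasDerivedCategory.{w} C]

/-- The cohomology of the image of a complex in the derived category. -/
noncomputable def homologyQhIso (L : CochainComplex C ℤ) (n : ℤ) :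
    (homologyFunctor C n).obj (Qh.obj ((HomotopyCategory.quotient C (.up ℤ)).obj L)) ≅
      L.homology n :=
  (homologyFunctorFactorsh C n).app _ ≪≫ (HomotopyCategory.homologyFunctorFactors C (.up ℤ) n).app L

lemma homologyQhIso_naturality {L L' : CochainComplex C ℤ} (f : L ⟶ L') (n : ℤ) :
    (homologyFunctor C n).map (Qh.map ((HomotopyCategory.quotient C (.up ℤ)).map f)) ≫
        (homologyQhIso L' n).hom =
      (homologyQhIso L n).hom ≫ HomologicalComplex.homologyMap f n := by
  refine (Category.assoc _ _ _).symm.trans ?_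
  refine (congrArg (· ≫ _) ((homologyFunctorFactorsh C n).hom.naturality
    ((HomotopyCategory.quotient C (.up ℤ)).map f))).trans ?_
  refine (Category.assoc _ _ _).trans (Eq.trans ?_ (Category.assoc _ _ _).symm)
  exact congrArg (_ ≫ ·) ((HomotopyCategory.homologyFunctorFactors C (.up ℤ) n).hom.naturality f)

end

section

variable {C : Type u} [Category.{v} C] [Abelian C] [HasDerivedCategory.{w} C]
  [HasDerivedCategory.{w'} AddCommGrpCat.{v}]

/-- The morphism in the derived category which corresponds to an element of the cohomology of a
total Hom complex. -/
noncomputable def toHom (A B : CochainComplex C ℤ) (n : ℤ) :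
    (homologyFunctor AddCommGrpCat.{v} n).obj (Qh.obj ((HomotopyCategory.quotient _ (.up ℤ)).obj
      (complex (preadditiveCoyoneda (C := C)) A B))) →+
    (Qh.obj ((HomotopyCategory.quotient C (.up ℤ)).obj A) ⟶
      (Qh.obj ((HomotopyCategory.quotient C (.up ℤ)).obj B))⟦n⟧) where
  toFun x := Qh.map (homologyHomEquiv A B n ((homologyQhIso (complex preadditiveCoyoneda A B) n).hom.hom x)) ≫
    (Qh.commShiftIso n).hom.app ((HomotopyCategory.quotient C (.up ℤ)).obj B)
  map_zero' := by rw [map_zero, map_zero, Functor.map_zero, zero_comp]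
  map_add' x y := by rw [map_add, map_add, Functor.map_add, Preadditive.add_comp]

lemma toHom_apply (A B : CochainComplex C ℤ) (n : ℤ)
    (x : (homologyFunctor AddCommGrpCat.{v} n).obj (Qh.obj
      ((HomotopyCategory.quotient _ (.up ℤ)).obj (complex (preadditiveCoyoneda (C := C)) A B)))) :
    toHom A B n x = Qh.map (homologyHomEquiv A B n ((homologyQhIso (complex preadditiveCoyoneda A B) n).hom.hom x)) ≫
      (Qh.commShiftIso n).hom.app ((HomotopyCategory.quotient C (.up ℤ)).obj B) := rfl

lemma toHom_map {A B A' B' : CochainComplex C ℤ} (a : A' ⟶ A) (b : B ⟶ B') (n : ℤ)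
    (x : (homologyFunctor AddCommGrpCat.{v} n).obj (Qh.obj
      ((HomotopyCategory.quotient _ (.up ℤ)).obj (complex (preadditiveCoyoneda (C := C)) A B)))) :
    toHom A' B' n (((homologyFunctor _ n).map (Qh.map ((HomotopyCategory.quotient _ _).map
        (map (preadditiveCoyoneda (C := C)) a b)))).hom x) =
      Qh.map ((HomotopyCategory.quotient _ _).map a) ≫ toHom A B n x ≫
        (Qh.map ((HomotopyCategory.quotient _ _).map b))⟦n⟧' := by
  rw [toHom_apply, toHom_apply]
  refine (congrArg (fun z => Qh.map (homologyHomEquiv A' B' n z) ≫ _) (ConcreteCategory.congr_hom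
    (homologyQhIso_naturality (map (preadditiveCoyoneda (C := C)) a b) n) x)).trans ?_
  refine (congrArg (fun z => Qh.map z ≫ _) (homologyHomEquiv_map a b _)).trans ?_
  rw [Functor.map_comp, Functor.map_comp, Category.assoc, Category.assoc, Category.assoc]
  exact congrArg (fun z => _ ≫ _ ≫ z) (Qh.commShiftIso_hom_naturality _ n)

/-- Morphisms in the derived category to a K-injective complex are homotopy classes of morphisms of
complexes. -/
lemma toHom_bijective (A B : CochainComplex C ℤ) [B.IsKInjective] (n : ℤ) :
    Function.Bijective (toHom A B n) := by
  have h := ((HomotopyCategory.subcategoryAcyclic C).rightOrthogonal.le_shift n _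
    (IsKInjective.rightOrthogonal B)).map_bijective_of_isTriangulated
      Qh ((HomotopyCategory.quotient C (.up ℤ)).obj A)
  exact (Iso.homToEquiv ((Qh.commShiftIso n).app ((HomotopyCategory.quotient C (.up ℤ)).obj B))
    ).bijective.comp (h.comp ((homologyHomEquiv A B n).bijective.comp
      (ConcreteCategory.bijective_of_isIso (homologyQhIso _ n).hom)))

variable {C' : Type u} [Category.{v} C'] [Abelian C'] [HasDerivedCategory.{w''} C']
  (Φ : C ⥤ C') [Φ.Additive] [PreservesFiniteLimits Φ] [PreservesFiniteColimits Φ]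

/-- The functor induced on derived categories by an exact functor is computed by applying this
functor to complexes. -/
noncomputable def mapQhIso (A : CochainComplex C ℤ) :
    Φ.mapDerivedCategory.obj (Qh.obj ((HomotopyCategory.quotient _ (.up ℤ)).obj A)) ≅
      Qh.obj ((HomotopyCategory.quotient _ (.up ℤ)).obj ((Φ.mapHomologicalComplex _).obj A)) :=
  Φ.mapDerivedCategoryFactorsh.app ((HomotopyCategory.quotient _ _).obj A)

lemma toHom_mapComplex (A B : CochainComplex C ℤ) (n : ℤ)
    (x : (homologyFunctor AddCommGrpCat.{v} n).obj (Qh.obj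
      ((HomotopyCategory.quotient _ (.up ℤ)).obj (complex (preadditiveCoyoneda (C := C)) A B)))) :
    toHom _ _ n (((homologyFunctor _ n).map (Qh.map ((HomotopyCategory.quotient _ _).map
        (mapComplex Φ A B)))).hom x) =
      (mapQhIso Φ A).inv ≫
        Φ.mapDerivedCategory.map (toHom A B n x) ≫
        (Φ.mapDerivedCategory.commShiftIso n).hom.app _ ≫
        (mapQhIso Φ B).hom⟦n⟧' := by
  rw [toHom_apply, toHom_apply]
  refine (congrArg (fun z => Qh.map (homologyHomEquiv _ _ n z) ≫ _) (ConcreteCategory.congr_hom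
    (homologyQhIso_naturality (mapComplex Φ A B) n) x)).trans ?_
  refine (congrArg (fun z => Qh.map z ≫ _) (homologyHomEquiv_mapComplex Φ _)).trans ?_
  have h := NatTrans.shift_app_comm Φ.mapDerivedCategoryFactorsh.hom n
    ((HomotopyCategory.quotient _ _).obj B)
  rw [Functor.commShiftIso_comp_hom_app, Functor.commShiftIso_comp_hom_app] at h
  refine Eq.symm ((Iso.inv_comp_eq (Φ.mapDerivedCategoryFactorsh.app
    ((HomotopyCategory.quotient _ _).obj A))).2 ?_)
  rw [Functor.map_comp, Category.assoc]
  refine (congrArg (_ ≫ ·) ((Category.assoc _ _ _).symm.trans h)).trans ?_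
  refine ((Category.assoc _ _ _).symm.trans ((congrArg (· ≫ _)
    (Φ.mapDerivedCategoryFactorsh.hom.naturality _)).trans (Category.assoc _ _ _))).trans ?_
  exact congrArg (_ ≫ ·) ((Category.assoc _ _ _).symm.trans
    (congrArg (· ≫ _) (Qh.map_comp _ _).symm))

end

section

variable {C : Type u} [Category.{v} C] [Abelian C] [HasDerivedCategory.{w} C]
  [HasDerivedCategory.{w'} AddCommGrpCat.{v}]
  [(Qh : HomotopyCategory C (ComplexShape.up ℤ) ⥤ DerivedCategory C).IsLeftAdjoint]

/-- The K-injective resolution of an object of the derived category, as a complex. -/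
noncomputable def injComplex (M : DerivedCategory C) : CochainComplex C ℤ := ((injRes C).obj M).as

instance (M : DerivedCategory C) : (injComplex M).IsKInjective := isKInjective_injRes M

/-- The K-injective resolution of an object represents this object. -/
noncomputable def injComplexIso (M : DerivedCategory C) :
    Qh.obj ((HomotopyCategory.quotient C (.up ℤ)).obj (injComplex M)) ≅ M :=
  (asIso (injResAdj C).counit).app M

/-- The morphism between K-injective resolutions which is induced by a morphism in the derived
category is represented by a morphism of complexes. -/
lemma exists_injRes_map {M N : DerivedCategory C} (f : M ⟶ N) :
    ∃ a : injComplex M ⟶ injComplex N,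
      (HomotopyCategory.quotient C (.up ℤ)).map a = (injRes C).map f ∧
      Qh.map ((HomotopyCategory.quotient C (.up ℤ)).map a) ≫ (injComplexIso N).hom =
        (injComplexIso M).hom ≫ f := by
  obtain ⟨a, ha⟩ := (HomotopyCategory.quotient C (.up ℤ)).map_surjective
    (X := injComplex M) (Y := injComplex N) ((injRes C).map f)
  refine ⟨a, ha, ?_⟩
  rw [ha]
  exact (injResAdj C).counit.naturality f

/-- The cohomology of the derived complex of homomorphisms consists of the morphisms to shifted
objects in the derived category. -/
noncomputable def homologyDerivedHom (K G : DerivedCategory C) (n : ℤ) :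
    (homologyFunctor AddCommGrpCat.{v} n).obj ((derivedHom.obj (op K)).obj G) →+ (K ⟶ G⟦n⟧) :=
  (((Preadditive.leftComp _ (injComplexIso K).inv).comp
    (Preadditive.rightComp _ ((injComplexIso G).hom⟦n⟧'))).comp
      (toHom (injComplex K) (injComplex G) n) :)

lemma homologyDerivedHom_apply (K G : DerivedCategory C) (n : ℤ)
    (x : (homologyFunctor AddCommGrpCat.{v} n).obj ((derivedHom.obj (op K)).obj G)) :
    homologyDerivedHom K G n x = (injComplexIso K).inv ≫
      toHom (injComplex K) (injComplex G) n x ≫ (injComplexIso G).hom⟦n⟧' := rfl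

lemma homologyDerivedHom_bijective (K G : DerivedCategory C) (n : ℤ) :
    Function.Bijective (homologyDerivedHom K G n) :=
  (Iso.homCongr (injComplexIso K) ((CategoryTheory.shiftFunctor _ n).mapIso (injComplexIso G))).bijective.comp
    (toHom_bijective _ _ n)

lemma homologyDerivedHom_map {K K' G G' : DerivedCategory C} (k : K' ⟶ K) (g : G ⟶ G') (n : ℤ)
    (x : (homologyFunctor AddCommGrpCat.{v} n).obj ((derivedHom.obj (op K)).obj G)) :
    homologyDerivedHom K' G' n (((homologyFunctor _ n).map
      ((derivedHom.map k.op).app G ≫ (derivedHom.obj (op K')).map g)).hom x) =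
      k ≫ homologyDerivedHom K G n x ≫ g⟦n⟧' := by
  obtain ⟨a, ha, ha'⟩ := exists_injRes_map k
  obtain ⟨b, hb, hb'⟩ := exists_injRes_map g
  have h : (derivedHom.map k.op).app G ≫ (derivedHom.obj (op K')).map g =
      Qh.map ((HomotopyCategory.quotient _ (.up ℤ)).map (map (preadditiveCoyoneda (C := C)) a b)) := by
    have h₁ : (derivedHom.map k.op).app G = Qh.map ((HomotopyCategory.quotient _ (.up ℤ)).map
        (map (preadditiveCoyoneda (C := C)) a (𝟙 (injComplex G)))) :=
      congrArg (fun z => Qh.map (((bifunctorK (preadditiveCoyoneda (C := C))).map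
        (Quiver.Hom.op z)).app ((injRes C).obj G))) ha.symm
    have h₂ : (derivedHom.obj (op K')).map g = Qh.map ((HomotopyCategory.quotient _ (.up ℤ)).map
        (map (preadditiveCoyoneda (C := C)) (𝟙 (injComplex K')) b)) :=
      congrArg (fun z => Qh.map (((bifunctorK (preadditiveCoyoneda (C := C))).obj
        (op ((injRes C).obj K'))).map z)) hb.symm
    rw [h₁, h₂]
    refine (Qh.map_comp _ _).symm.trans (congrArg Qh.map ?_)
    refine ((HomotopyCategory.quotient _ _).map_comp _ _).symm.trans (congrArg _ ?_)
    refine (map_comp _ _ _ _).symm.trans ?_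
    rw [Category.id_comp, Category.id_comp]
  have h₁ : (injComplexIso K').inv ≫ Qh.map ((HomotopyCategory.quotient _ _).map a) =
      k ≫ (injComplexIso K).inv := by
    rw [Iso.inv_comp_eq, ← Category.assoc, Iso.eq_comp_inv]
    exact ha'
  rw [homologyDerivedHom_apply, homologyDerivedHom_apply, h]
  refine (congrArg (fun z => _ ≫ z ≫ _) (toHom_map a b n x)).trans ?_
  rw [Category.assoc, Category.assoc, ← Functor.map_comp, hb', Functor.map_comp, ← Category.assoc,
    h₁]
  simp only [Category.assoc]

end

end DerivedCategory

/-! ### Derived homomorphisms and exact functors -/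

section

variable {D : Type*} [Category* D] [HasShift D ℤ] {D' : Type*} [Category* D'] [HasShift D' ℤ]
  (P : D ⥤ D') [P.CommShift ℤ]

/-- Transport of a morphism to a shifted object along isomorphisms, compared with its image under a
functor which commutes with shifts. -/
lemma CategoryTheory.Functor.map_conj_comp_commShiftIso {A B K G : D} {A₁ B₁ A' B' : D'}
    (εK : A ≅ K) (εG : B ≅ G) (mA : P.obj A ≅ A₁) (mB : P.obj B ≅ B₁) (c : A₁ ⟶ A') (e : B₁ ⟶ B')
    (εK' : A' ≅ P.obj K) (εG' : B' ≅ P.obj G) (hc : c ≫ εK'.hom = mA.inv ≫ P.map εK.hom)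
    (he : e ≫ εG'.hom = mB.inv ≫ P.map εG.hom) (n : ℤ) (s : A ⟶ B⟦n⟧) (t : A' ⟶ B'⟦n⟧)
    (h : c ≫ t = (mA.inv ≫ P.map s ≫ (P.commShiftIso n).hom.app B ≫ mB.hom⟦n⟧') ≫ e⟦n⟧') :
    εK'.inv ≫ t ≫ εG'.hom⟦n⟧' =
      P.map (εK.inv ≫ s ≫ εG.hom⟦n⟧') ≫ (P.commShiftIso n).hom.app G := by
  have h₁ : εK'.inv = P.map εK.inv ≫ mA.hom ≫ c := by
    rw [← cancel_mono εK'.hom, Iso.inv_hom_id, Category.assoc, Category.assoc, hc,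
      Iso.hom_inv_id_assoc, ← Functor.map_comp, Iso.inv_hom_id, CategoryTheory.Functor.map_id]
  have h₂ : e⟦n⟧' ≫ εG'.hom⟦n⟧' = mB.inv⟦n⟧' ≫ (P.map εG.hom)⟦n⟧' := by
    rw [← Functor.map_comp, he, Functor.map_comp]
  have h₃ : mB.hom⟦n⟧' ≫ mB.inv⟦n⟧' = 𝟙 _ := by
    rw [← Functor.map_comp, Iso.hom_inv_id, CategoryTheory.Functor.map_id]
  rw [h₁, Category.assoc, Category.assoc, reassoc_of% h]
  simp only [Category.assoc, h₂, P.map_comp, Iso.hom_inv_id_assoc, reassoc_of% h₃]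
  rw [← P.commShiftIso_hom_naturality]

end

namespace DerivedCategory

open CochainComplex HomComplex Opposite TotHom

section

variable {C : Type u} [Category.{v} C] [Abelian C] [HasDerivedCategory.{w} C]
  [HasDerivedCategory.{w'} AddCommGrpCat.{v}]

lemma isIso_Qh_map_totHom_map {A A' : CochainComplex C ℤ} (c : A' ⟶ A) (J : CochainComplex C ℤ)
    [J.IsKInjective] (hc : IsIso (Qh.map ((HomotopyCategory.quotient C (.up ℤ)).map c))) :
    IsIso (Qh.map ((HomotopyCategory.quotient _ (.up ℤ)).map
      (map (preadditiveCoyoneda (C := C)) c (𝟙 J)))) := by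
  refine (DerivedCategory.isIso_iff _ _).2 (fun n => (ConcreteCategory.isIso_iff_bijective _).2 ?_)
  refine (Function.Bijective.of_comp_iff' (toHom_bijective A' J n) _).1 ?_
  have h : Function.Bijective (fun f => Qh.map ((HomotopyCategory.quotient C (.up ℤ)).map c) ≫
      toHom A J n f) :=
    (asIso (Qh.map ((HomotopyCategory.quotient C (.up ℤ)).map c))).symm.homFromEquiv.bijective.comp
      (toHom_bijective A J n)
  refine (congrArg Function.Bijective (funext fun x => ?_)).mpr h
  refine (toHom_map c (𝟙 J) n x).trans ?_
  simp only [CategoryTheory.Functor.map_id, Category.comp_id]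

end

section

variable {C : Type u} [Category.{v} C] [Abelian C] [HasDerivedCategory.{w} C]
  {C' : Type u} [Category.{v} C'] [Abelian C'] [HasDerivedCategory.{w''} C']
  [(Qh : HomotopyCategory C (ComplexShape.up ℤ) ⥤ DerivedCategory C).IsLeftAdjoint]
  [(Qh : HomotopyCategory C' (ComplexShape.up ℤ) ⥤ DerivedCategory C').IsLeftAdjoint]
  (Φ : C ⥤ C') [Φ.Additive] [PreservesFiniteLimits Φ] [PreservesFiniteColimits Φ]

/-- The comparison between the image of a K-injective resolution under an exact functor and the
K-injective resolution of the image. -/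
noncomputable def injResComparison :
    injRes C ⋙ Φ.mapHomotopyCategory (.up ℤ) ⟶ Φ.mapDerivedCategory ⋙ injRes C' :=
  Functor.whiskerLeft (injRes C ⋙ Φ.mapHomotopyCategory (.up ℤ)) (injResAdj C').unit ≫
    Functor.whiskerRight (Functor.whiskerLeft (injRes C) Φ.mapDerivedCategoryFactorsh.inv ≫
      Functor.whiskerRight (injResAdj C).counit Φ.mapDerivedCategory) (injRes C')

/-- The comparison of K-injective resolutions is represented by a morphism of complexes which is
compatible with the identifications in the derived category. -/
lemma exists_injResComparison_app (M : DerivedCategory C) :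
    ∃ c : (Φ.mapHomologicalComplex (.up ℤ)).obj (injComplex M) ⟶
        injComplex (Φ.mapDerivedCategory.obj M),
      (HomotopyCategory.quotient C' (.up ℤ)).map c = (injResComparison Φ).app M ∧
      Qh.map ((HomotopyCategory.quotient C' (.up ℤ)).map c) ≫ (injComplexIso _).hom =
        (mapQhIso Φ (injComplex M)).inv ≫ Φ.mapDerivedCategory.map (injComplexIso M).hom := by
  obtain ⟨c, hc⟩ := (HomotopyCategory.quotient C' (.up ℤ)).map_surjective
    (X := (Φ.mapHomologicalComplex (.up ℤ)).obj (injComplex M))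
    (Y := injComplex (Φ.mapDerivedCategory.obj M)) ((injResComparison Φ).app M)
  refine ⟨c, hc, ?_⟩
  rw [hc]
  refine (congrArg (Qh.map · ≫ (injResAdj C').counit.app _)
    ((injResAdj C').homEquiv_unit (f := Φ.mapDerivedCategoryFactorsh.inv.app
      ((injRes C).obj M) ≫ Φ.mapDerivedCategory.map ((injResAdj C).counit.app M))).symm).trans ?_
  exact ((injResAdj C').homEquiv_counit _ _ _).symm.trans
    (((injResAdj C').homEquiv _ _).symm_apply_apply _)

/-- The action of an additive functor on total Hom complexes, as bifunctors on homotopy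
categories. -/
noncomputable def mapComplexBifunctor :
    TotHom.bifunctorK (preadditiveCoyoneda (C := C)) ⟶
      (Φ.mapHomotopyCategory (.up ℤ)).op ⋙ TotHom.bifunctorK (preadditiveCoyoneda (C := C')) ⋙
        (Functor.whiskeringLeft _ _ _).obj (Φ.mapHomotopyCategory (.up ℤ)) :=
  TotHom.natTransMk
    (fun A B => (HomotopyCategory.quotient _ _).map (mapComplex Φ A B))
    (fun {A A'} f B => by
      refine ((HomotopyCategory.quotient _ _).map_comp _ _).symm.trans
        (Eq.trans (congrArg _ ?_) ((HomotopyCategory.quotient _ _).map_comp _ _))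
      refine (mapComplex_naturality Φ f (𝟙 B)).trans (congrArg (_ ≫ ·) ?_)
      exact congrArg (map preadditiveCoyoneda _) ((Φ.mapHomologicalComplex _).map_id B))
    (fun A {B B'} g => by
      refine ((HomotopyCategory.quotient _ _).map_comp _ _).symm.trans
        (Eq.trans (congrArg _ ?_) ((HomotopyCategory.quotient _ _).map_comp _ _))
      refine (mapComplex_naturality Φ (𝟙 A) g).trans (congrArg (_ ≫ ·) ?_)
      exact congrArg (map preadditiveCoyoneda · _) ((Φ.mapHomologicalComplex _).map_id A))

variable [HasDerivedCategory.{w'} AddCommGrpCat.{v}]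

/-- The total Hom complexes from the image of a K-injective resolution to a K-injective resolution
of the image. -/
noncomputable def derivedHomAux : (DerivedCategory C)ᵒᵖ ⥤ DerivedCategory C ⥤
    DerivedCategory AddCommGrpCat.{v} :=
  (injRes C).op ⋙ (Φ.mapHomotopyCategory (.up ℤ)).op ⋙
    TotHom.bifunctorK (preadditiveCoyoneda (C := C')) ⋙
      (Functor.whiskeringLeft _ _ _).obj (Φ.mapDerivedCategory ⋙ injRes C') ⋙
        (Functor.whiskeringRight _ _ _).obj Qh

/-- The functor `Φ` maps the derived complex of homomorphisms to `derivedHomAux`. -/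
noncomputable def toDerivedHomAux : derivedHom (C := C) ⟶ derivedHomAux Φ :=
  Functor.whiskerLeft (injRes C).op (Functor.whiskerRight (mapComplexBifunctor Φ)
      ((Functor.whiskeringLeft _ _ _).obj (injRes C) ⋙ (Functor.whiskeringRight _ _ _).obj Qh)) ≫
    Functor.whiskerLeft ((injRes C).op ⋙ (Φ.mapHomotopyCategory (.up ℤ)).op ⋙
      TotHom.bifunctorK (preadditiveCoyoneda (C := C')))
        (Functor.whiskerRight ((Functor.whiskeringLeft _ _ _).map (injResComparison Φ))
          ((Functor.whiskeringRight _ _ _).obj Qh))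

/-- The derived complex of homomorphisms between images under `Φ` maps to `derivedHomAux`. -/
noncomputable def derivedHomToAux : Φ.mapDerivedCategory.op ⋙ derivedHom (C := C') ⋙
    (Functor.whiskeringLeft _ _ _).obj Φ.mapDerivedCategory ⟶ derivedHomAux Φ :=
  Functor.whiskerRight (NatTrans.op (injResComparison Φ))
    (TotHom.bifunctorK (preadditiveCoyoneda (C := C')) ⋙
      (Functor.whiskeringLeft _ _ _).obj (Φ.mapDerivedCategory ⋙ injRes C') ⋙
        (Functor.whiskeringRight _ _ _).obj Qh)

/-- The comparison of K-injective resolutions becomes an isomorphism in the derived category, so that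
it may be used to compute derived homomorphisms in the first variable. -/
lemma isIso_derivedHomToAux : IsIso (derivedHomToAux Φ) := by
  rw [NatTrans.isIso_iff_isIso_app]
  intro K
  rw [NatTrans.isIso_iff_isIso_app]
  intro G
  obtain ⟨c, hc, hc'⟩ := exists_injResComparison_app Φ K.unop
  have h : ((derivedHomToAux Φ).app K).app G = Qh.map ((HomotopyCategory.quotient _ (.up ℤ)).map
        (map (preadditiveCoyoneda (C := C')) c (𝟙 (injComplex (Φ.mapDerivedCategory.obj G))))) :=
      congrArg (fun z => Qh.map (((bifunctorK (preadditiveCoyoneda (C := C'))).map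
        (Quiver.Hom.op z)).app ((injRes C').obj (Φ.mapDerivedCategory.obj G)))) hc.symm
  rw [h]
  refine isIso_Qh_map_totHom_map c _ ?_
  rw [← Iso.eq_comp_inv] at hc'
  rw [hc']
  infer_instance

/-- The action of the functor induced by an exact functor on derived complexes of homomorphisms. -/
noncomputable def mapDerivedHom : derivedHom (C := C) ⟶ Φ.mapDerivedCategory.op ⋙
    derivedHom (C := C') ⋙ (Functor.whiskeringLeft _ _ _).obj Φ.mapDerivedCategory :=
  have := isIso_derivedHomToAux Φ
  toDerivedHomAux Φ ≫ inv (derivedHomToAux Φ)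

/-- The components of `mapDerivedHom`. -/
noncomputable def mapDerivedHomApp (K G : DerivedCategory C) :
    (derivedHom.obj (op K)).obj G ⟶
      (derivedHom.obj (op (Φ.mapDerivedCategory.obj K))).obj (Φ.mapDerivedCategory.obj G) :=
  ((mapDerivedHom Φ).app (op K)).app G

/-- The components of `mapDerivedHom` in terms of total Hom complexes of K-injective resolutions. -/
lemma exists_mapDerivedHomApp (K G : DerivedCategory C) :
    ∃ (c : (Φ.mapHomologicalComplex (.up ℤ)).obj (injComplex K) ⟶
        injComplex (Φ.mapDerivedCategory.obj K))
      (e : (Φ.mapHomologicalComplex (.up ℤ)).obj (injComplex G) ⟶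
        injComplex (Φ.mapDerivedCategory.obj G)),
      Qh.map ((HomotopyCategory.quotient C' (.up ℤ)).map c) ≫ (injComplexIso _).hom =
        (mapQhIso Φ (injComplex K)).inv ≫ Φ.mapDerivedCategory.map (injComplexIso K).hom ∧
      Qh.map ((HomotopyCategory.quotient C' (.up ℤ)).map e) ≫ (injComplexIso _).hom =
        (mapQhIso Φ (injComplex G)).inv ≫ Φ.mapDerivedCategory.map (injComplexIso G).hom ∧
      (mapDerivedHomApp Φ K G :
          Qh.obj ((HomotopyCategory.quotient _ (.up ℤ)).obj (complex (preadditiveCoyoneda (C := C))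
            (injComplex K) (injComplex G))) ⟶
          Qh.obj ((HomotopyCategory.quotient _ (.up ℤ)).obj (complex (preadditiveCoyoneda (C := C'))
            (injComplex (Φ.mapDerivedCategory.obj K)) (injComplex (Φ.mapDerivedCategory.obj G))))) ≫
        Qh.map ((HomotopyCategory.quotient _ (.up ℤ)).map
        (map (preadditiveCoyoneda (C := C')) c (𝟙 (injComplex (Φ.mapDerivedCategory.obj G))))) =
      Qh.map ((HomotopyCategory.quotient _ (.up ℤ)).map (mapComplex Φ (injComplex K) (injComplex G))) ≫
      Qh.map ((HomotopyCategory.quotient _ (.up ℤ)).map (map (preadditiveCoyoneda (C := C'))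
        (𝟙 ((Φ.mapHomologicalComplex (.up ℤ)).obj (injComplex K))) e)) := by
  obtain ⟨c, hc, hc'⟩ := exists_injResComparison_app Φ K
  obtain ⟨e, he, he'⟩ := exists_injResComparison_app Φ G
  refine ⟨c, e, hc', he', ?_⟩
  have h₁ : ((derivedHomToAux Φ).app (op K)).app G =
      Qh.map ((HomotopyCategory.quotient _ (.up ℤ)).map
        (map (preadditiveCoyoneda (C := C')) c (𝟙 (injComplex (Φ.mapDerivedCategory.obj G))))) :=
      congrArg (fun z => Qh.map (((bifunctorK (preadditiveCoyoneda (C := C'))).map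
        (Quiver.Hom.op z)).app ((injRes C').obj (Φ.mapDerivedCategory.obj G)))) hc.symm
  have h₂ : ((toDerivedHomAux Φ).app (op K)).app G =
      Qh.map ((HomotopyCategory.quotient _ (.up ℤ)).map (mapComplex Φ (injComplex K) (injComplex G))) ≫
      Qh.map ((HomotopyCategory.quotient _ (.up ℤ)).map (map (preadditiveCoyoneda (C := C'))
        (𝟙 ((Φ.mapHomologicalComplex (.up ℤ)).obj (injComplex K))) e)) :=
    congrArg (fun z => Qh.map ((HomotopyCategory.quotient _ (.up ℤ)).map
      (mapComplex Φ (injComplex K) (injComplex G))) ≫ Qh.map (((bifunctorK (preadditiveCoyoneda (C := C'))).obj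
        (op ((Φ.mapHomotopyCategory (.up ℤ)).obj ((injRes C).obj K)))).map z)) he.symm
  have := isIso_derivedHomToAux Φ
  have h : mapDerivedHom Φ ≫ derivedHomToAux Φ = toDerivedHomAux Φ := by
    rw [mapDerivedHom, Category.assoc, IsIso.inv_hom_id, Category.comp_id]
  refine (congrArg (mapDerivedHomApp Φ K G ≫ ·) h₁.symm).trans (Eq.trans ?_ h₂)
  exact congrArg (fun α => (α.app (op K)).app G) h

/-- On cohomology, `mapDerivedHom` is the action of the induced functor on morphisms. -/
lemma homologyDerivedHom_mapDerivedHom (K G : DerivedCategory C) (n : ℤ)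
    (x : (homologyFunctor AddCommGrpCat.{v} n).obj ((derivedHom.obj (op K)).obj G)) :
    homologyDerivedHom (Φ.mapDerivedCategory.obj K) (Φ.mapDerivedCategory.obj G) n
        (((homologyFunctor _ n).map (mapDerivedHomApp Φ K G)).hom x) =
      Φ.mapDerivedCategory.map (homologyDerivedHom K G n x) ≫
        (Φ.mapDerivedCategory.commShiftIso n).hom.app G := by
  obtain ⟨c, e, hc, he, h⟩ := exists_mapDerivedHomApp Φ K G
  have h' := ConcreteCategory.congr_hom (((homologyFunctor _ n).map_comp _ _).symm.trans
    ((congrArg (homologyFunctor _ n).map h).trans ((homologyFunctor _ n).map_comp _ _))) x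
  have h₁ := toHom_map c (𝟙 (injComplex (Φ.mapDerivedCategory.obj G))) n
    (((homologyFunctor _ n).map (mapDerivedHomApp Φ K G)).hom x)
  have h₂ := toHom_map (𝟙 ((Φ.mapHomologicalComplex (.up ℤ)).obj (injComplex K))) e n
    (((homologyFunctor _ n).map (Qh.map ((HomotopyCategory.quotient _ (.up ℤ)).map
      (mapComplex Φ (injComplex K) (injComplex G))))).hom x)
  have h₃ := h₁.symm.trans ((congrArg (toHom _ _ n) h').trans h₂)
  rw [CategoryTheory.Functor.map_id, CategoryTheory.Functor.map_id,
    CategoryTheory.Functor.map_id, CategoryTheory.Functor.map_id, CategoryTheory.Functor.map_id,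
    Category.comp_id, Category.id_comp] at h₃
  exact Φ.mapDerivedCategory.map_conj_comp_commShiftIso _ _ _ _ _ _ _ _ hc he n _ _
    (h₃.trans (congrArg (· ≫ _) (toHom_mapComplex Φ (injComplex K) (injComplex G) n x)))

end

end DerivedCategory

/-! ### The duality isomorphism -/

namespace DerivedCategory

open Opposite

section

variable {C : Type u} [Category.{v} C] [Abelian C] [HasDerivedCategory.{w} C]
  {C' : Type u} [Category.{v} C'] [Abelian C'] [HasDerivedCategory.{w''} C']
  [(Qh : HomotopyCategory C (ComplexShape.up ℤ) ⥤ DerivedCategory C).IsLeftAdjoint]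
  [(Qh : HomotopyCategory C' (ComplexShape.up ℤ) ⥤ DerivedCategory C').IsLeftAdjoint]
  [HasDerivedCategory.{w'} AddCommGrpCat.{v}]
  (Φ : C ⥤ C') [Φ.Additive] [PreservesFiniteLimits Φ] [PreservesFiniteColimits Φ]
  {L : DerivedCategory C' ⥤ DerivedCategory C} (adj : L ⊣ Φ.mapDerivedCategory)

/-- The derived form of the bijection between morphisms which is given by an adjunction. -/
noncomputable def derivedAdjunctionHom : L.op ⋙ derivedHom (C := C) ⟶
    derivedHom (C := C') ⋙ (Functor.whiskeringLeft _ _ _).obj Φ.mapDerivedCategory :=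
  Functor.whiskerLeft L.op (mapDerivedHom Φ) ≫
    Functor.whiskerRight (NatTrans.op adj.unit)
      (derivedHom (C := C') ⋙ (Functor.whiskeringLeft _ _ _).obj Φ.mapDerivedCategory)

/-- In cohomology of degree `n`, `derivedAdjunctionHom` is the bijection
`Hom(L F, G⟦n⟧) ≃ Hom(F, Φ G⟦n⟧)` given by the adjunction. -/
lemma isIso_derivedAdjunctionHom : IsIso (derivedAdjunctionHom Φ adj) := by
  rw [NatTrans.isIso_iff_isIso_app]
  intro F
  rw [NatTrans.isIso_iff_isIso_app]
  intro G
  let P := Φ.mapDerivedCategory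
  refine (isIso_iff _ _).2 (fun n => (ConcreteCategory.isIso_iff_bijective _).2 ?_)
  refine (Function.Bijective.of_comp_iff' (homologyDerivedHom_bijective F.unop (P.obj G) n) _).1 ?_
  have h : Function.Bijective (fun x => adj.homEquiv F.unop (G⟦n⟧)
      (homologyDerivedHom (L.obj F.unop) G n x) ≫ (P.commShiftIso n).hom.app G) :=
    ((P.commShiftIso n).app G).homToEquiv.bijective.comp
      ((adj.homEquiv _ _).bijective.comp (homologyDerivedHom_bijective _ _ n))
  refine (congrArg Function.Bijective (funext fun x => ?_)).mpr h
  have h₁ := homologyDerivedHom_map (adj.unit.app F.unop) (𝟙 (P.obj G)) n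
    (((homologyFunctor _ n).map (mapDerivedHomApp Φ (L.obj F.unop) G)).hom x)
  have h₂ := homologyDerivedHom_mapDerivedHom Φ (L.obj F.unop) G n x
  have h₃ : ((derivedAdjunctionHom Φ adj).app F).app G = mapDerivedHomApp Φ (L.obj F.unop) G ≫
      (derivedHom.map (adj.unit.app F.unop).op).app (P.obj G) ≫
        (derivedHom.obj (op F.unop)).map (𝟙 (P.obj G)) := by
    refine Eq.symm (congrArg (mapDerivedHomApp Φ (L.obj F.unop) G ≫ ·) ?_)
    exact (congrArg (_ ≫ ·) ((derivedHom.obj (op F.unop)).map_id _)).trans (Category.comp_id _)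
  refine (congrArg (homologyDerivedHom F.unop (P.obj G) n) (ConcreteCategory.congr_hom
    ((congrArg (homologyFunctor _ n).map h₃).trans ((homologyFunctor _ n).map_comp _ _)) x)).trans ?_
  refine h₁.trans ?_
  refine (congrArg (fun z => adj.unit.app F.unop ≫ z ≫ (𝟙 (P.obj G))⟦n⟧') h₂).trans ?_
  refine Eq.trans ?_ (congrArg (· ≫ (P.commShiftIso n).hom.app G)
    (adj.homEquiv_unit (f := homologyDerivedHom (L.obj F.unop) G n x)).symm)
  rw [CategoryTheory.Functor.map_id, Category.comp_id]
  exact (Category.assoc _ _ _).symm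

end

end DerivedCategory

namespace SheafDuality

open DerivedCategory

variable (X : TopCat.{u}) [HasDerivedCategory.{v} (Sh X)] [HasDerivedCategory.{w} AddCommGrpCat.{u}]
  [(piInv X).IsRightAdjoint]

/-- The derived adjunction between `𝕃(X, -)` and the constant sheaf functor. -/
noncomputable def derivedAdjunctionIso : (LL X).op ⋙ RHom ≅
    derivedHom (C := Sh X) ⋙ (Functor.whiskeringLeft _ _ _).obj (piInv X) :=
  @asIso _ _ _ _ (derivedAdjunctionHom (constantSheaf (Opens.grothendieckTopology X)
      AddCommGrpCat.{u}) (Adjunction.ofIsRightAdjoint (piInv X)))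
    (isIso_derivedAdjunctionHom _ _)

/-- The duality between homology and cohomology. -/
noncomputable def dualityIso : (LL X).op ⋙ RHom ≅ RHHom X ⋙
    (Functor.whiskeringLeft _ _ _).obj (piInv X) ⋙ (Functor.whiskeringRight _ _ _).obj (RΓ X) :=
  derivedAdjunctionIso X ≪≫
    Functor.isoWhiskerRight (RΓRHHomIso X).symm ((Functor.whiskeringLeft _ _ _).obj (piInv X))

end SheafDuality

/-! ### Derived homomorphisms from the constant sheaf `ℤ` -/

namespace SheafDuality

open TopologicalSpace Opposite DerivedCategory CochainComplex HomComplex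

variable (X : TopCat.{u})

/-- The constant sheaf functor is left adjoint to the functor of global sections. -/
noncomputable def constAdj :
    constantSheaf (Opens.grothendieckTopology X) AddCommGrpCat.{u} ⊣ globalSections X :=
  constantSheafAdj _ _ isTerminalTop

/-- The complex of constant sheaves `ℤ` in degree `0`. -/
noncomputable def constComplex : CochainComplex (Sh X) ℤ :=
  ((constantSheaf (Opens.grothendieckTopology X) AddCommGrpCat.{u}).mapHomologicalComplex _).obj
    ((HomologicalComplex.single AddCommGrpCat.{u} (.up ℤ) 0).obj ZZ)

lemma isZero_constComplex_X {p : ℤ} (hp : p ≠ 0) : IsZero ((constComplex X).X p) :=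
  Functor.map_isZero (constantSheaf (Opens.grothendieckTopology X) AddCommGrpCat.{u})
    (HomologicalComplex.isZero_single_obj_X _ _ _ _ hp)

/-- The canonical section of the constant sheaf `ℤ`. -/
noncomputable def constSection : (globalSections X).obj ((constComplex X).X 0) :=
  (((HomologicalComplex.singleObjXSelf (.up ℤ) 0 ZZ).inv ≫ (constAdj X).unit.app _).hom ⟨1⟩ :)

/-- Morphisms from the constant sheaf `ℤ` are global sections. -/
noncomputable def evalConst (J : Sh X) :
    ((constComplex X).X 0 ⟶ J) →+ (globalSections X).obj J where
  toFun f := ((globalSections X).map f).hom (constSection X)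
  map_zero' := rfl
  map_add' _ _ := rfl

lemma evalConst_comp {J J' : Sh X} (f : (constComplex X).X 0 ⟶ J) (g : J ⟶ J') :
    evalConst X J' (f ≫ g) = ((globalSections X).map g).hom (evalConst X J f) := rfl

lemma evalConst_bijective (J : Sh X) : Function.Bijective (evalConst X J) := by
  have h₁ : Function.Bijective (fun f : ZZ ⟶ (globalSections X).obj J => f.hom ⟨1⟩) :=
    ⟨fun _ _ h => ZZ_hom_ext h, fun g => ⟨ofElement g, ofElement_one g⟩⟩
  exact h₁.comp ((HomologicalComplex.singleObjXSelf (.up ℤ) 0 ZZ).homFromEquiv.bijective.comp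
    ((constAdj X).homEquiv _ J).bijective)

/-- The total Hom complex from the constant sheaf `ℤ` is the complex of global sections. -/
noncomputable def evalComplex (J : CochainComplex (Sh X) ℤ) :
    TotHom.complex (preadditiveCoyoneda (C := Sh X)) (constComplex X) J ⟶
      ((globalSections X).mapHomologicalComplex _).obj J where
  f n := AddCommGrpCat.ofHom ((evalConst X (J.X n)).comp (TotHom.comp (constComplex X) J n 0 n))
  comm' n m hnm := by
    ext x : 2
    have hnm' : n + 1 = m := hnm
    have h := TotHom.comp_d (constComplex X) J n m hnm 0 1 m n (by simp) hnm' x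
    rw [(isZero_constComplex_X X one_ne_zero).eq_of_tgt ((constComplex X).d 0 1) 0, zero_comp,
      smul_zero, add_zero] at h
    exact ((congrArg (evalConst X (J.X m)) h).trans (evalConst_comp X _ _)).symm

lemma isIso_evalComplex (J : CochainComplex (Sh X) ℤ) : IsIso (evalComplex X J) := by
  have (n : ℤ) : IsIso ((evalComplex X J).f n) := by
    refine (ConcreteCategory.isIso_iff_bijective _).2 ((evalConst_bijective X (J.X n)).comp ?_)
    have h := ConcreteCategory.bijective_of_isIso
      ((TotHom.homComplexIso (constComplex X) J).hom.f n)
    refine ⟨fun x y hxy => h.1 (Cochain.ext _ _ (fun p q hpq => ?_)), fun f => ?_⟩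
    · by_cases hp : p = 0
      · subst hp
        obtain rfl : n = q := by omega
        exact hxy
      · exact (isZero_constComplex_X X hp).eq_of_src _ _
    · obtain ⟨x, hx⟩ := h.2 (Cochain.single f n)
      exact ⟨x, (congrArg (fun z : Cochain (constComplex X) J n => z.v 0 n (zero_add n)) hx).trans
        (Cochain.single_v f n (zero_add n))⟩
  exact HomologicalComplex.Hom.isIso_of_components _

lemma evalComplex_naturality {J J' : CochainComplex (Sh X) ℤ} (g : J ⟶ J') :
    TotHom.map (preadditiveCoyoneda (C := Sh X)) (𝟙 (constComplex X)) g ≫ evalComplex X J' =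
      evalComplex X J ≫ ((globalSections X).mapHomologicalComplex _).map g := by
  ext n x : 3
  refine (congrArg (evalConst X (J'.X n))
    (TotHom.comp_map (𝟙 (constComplex X)) g n 0 n x)).trans ?_
  exact (congrArg (evalConst X (J'.X n)) (Category.id_comp _)).trans (evalConst_comp X _ _)

/-- The total Hom complex from the constant sheaf `ℤ`, as a functor on homotopy categories. -/
noncomputable def evalFunctor :
    (TotHom.bifunctorK (preadditiveCoyoneda (C := Sh X))).obj
        (op ((HomotopyCategory.quotient _ _).obj (constComplex X))) ⟶
      (globalSections X).mapHomotopyCategory (.up ℤ) where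
  app J := (HomotopyCategory.quotient _ _).map (evalComplex X J.as)
  naturality J J' g := by
    obtain ⟨g, rfl⟩ := (HomotopyCategory.quotient _ _).map_surjective g
    refine ((HomotopyCategory.quotient _ _).map_comp _ _).symm.trans
      (Eq.trans ?_ ((HomotopyCategory.quotient _ _).map_comp _ _))
    exact congrArg _ (evalComplex_naturality X g)

lemma isIso_evalFunctor : IsIso (evalFunctor X) := by
  rw [NatTrans.isIso_iff_isIso_app]
  exact fun J => @Functor.map_isIso _ _ _ _ _ _ (HomotopyCategory.quotient _ (.up ℤ))
    (evalComplex X J.as) (isIso_evalComplex X J.as)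

section

variable [HasDerivedCategory.{v} (Sh X)] [HasDerivedCategory.{w} AddCommGrpCat.{u}]

/-- Derived homomorphisms from the constant sheaf `ℤ` are derived global sections. -/
noncomputable def derivedHomConstIso :
    (derivedHom (C := Sh X)).obj (op ((piInv X).obj (single ZZ))) ≅ RΓ X := by
  let Φ := constantSheaf (Opens.grothendieckTopology X) AddCommGrpCat.{u}
  let e : Qh.obj ((HomotopyCategory.quotient _ (.up ℤ)).obj (constComplex X)) ≅
      (piInv X).obj (single ZZ) :=
    (mapQhIso Φ ((HomologicalComplex.single AddCommGrpCat.{u} (.up ℤ) 0).obj ZZ)).symm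
  let a : (HomotopyCategory.quotient _ (.up ℤ)).obj (constComplex X) ⟶
      (injRes (Sh X)).obj ((piInv X).obj (single ZZ)) := (injResAdj (Sh X)).homEquiv _ _ e.hom
  have ha : IsIso (Qh.map a) := by
    have h₁ : Qh.map a ≫ (injResAdj (Sh X)).counit.app _ = e.hom :=
      ((injResAdj (Sh X)).homEquiv_counit _ _ _).symm.trans
        (((injResAdj (Sh X)).homEquiv _ _).symm_apply_apply _)
    have h₂ : IsIso (Qh.map a ≫ (injResAdj (Sh X)).counit.app ((piInv X).obj (single ZZ))) := by
      rw [h₁]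
      infer_instance
    have h₃ : IsIso ((injResAdj (Sh X)).counit.app ((piInv X).obj (single ZZ))) :=
      inferInstanceAs (IsIso ((asIso (injResAdj (Sh X)).counit).app _).hom)
    exact IsIso.of_isIso_comp_right _ ((injResAdj (Sh X)).counit.app ((piInv X).obj (single ZZ)))
  let τ : (derivedHom (C := Sh X)).obj (op ((piInv X).obj (single ZZ))) ⟶
      injRes (Sh X) ⋙ (TotHom.bifunctorK (preadditiveCoyoneda (C := Sh X))).obj
        (op ((HomotopyCategory.quotient _ _).obj (constComplex X))) ⋙ Qh :=
    Functor.whiskerLeft (injRes (Sh X)) (Functor.whiskerRight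
      ((TotHom.bifunctorK (preadditiveCoyoneda (C := Sh X))).map a.op) Qh)
  have hτ : IsIso τ := by
    rw [NatTrans.isIso_iff_isIso_app]
    intro M
    obtain ⟨a', ha'⟩ := (HomotopyCategory.quotient (Sh X) (.up ℤ)).map_surjective
      (X := constComplex X) (Y := injComplex ((piInv X).obj (single ZZ))) a
    have h := isIso_Qh_map_totHom_map a' (injComplex M) (ha' ▸ ha)
    have h' : τ.app M = Qh.map ((HomotopyCategory.quotient _ (.up ℤ)).map
        (TotHom.map (preadditiveCoyoneda (C := Sh X)) a' (𝟙 (injComplex M)))) :=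
      congrArg (fun z => Qh.map (((TotHom.bifunctorK (preadditiveCoyoneda (C := Sh X))).map
        (Quiver.Hom.op z)).app ((injRes (Sh X)).obj M))) ha'.symm
    exact h' ▸ h
  have := isIso_evalFunctor X
  exact asIso τ ≪≫ Functor.isoWhiskerLeft (injRes (Sh X))
    (Functor.isoWhiskerRight (asIso (evalFunctor X)) Qh)

variable [(piInv X).IsRightAdjoint]

/-- The homology complex of `X` computes its cohomology with constant coefficients. -/
noncomputable def RHomConstIso :
    RHom.obj (Opposite.op ((LL X).obj ((piInv X).obj (single ZZ)))) ≅ piInv X ⋙ RΓ X :=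
  (derivedAdjunctionIso X).app (op ((piInv X).obj (single ZZ))) ≪≫
    Functor.isoWhiskerLeft (piInv X) (derivedHomConstIso X)

/-- The dual of the homology complex is the cohomology of the dual. -/
noncomputable def dualIso : (LL X).op ⋙ dual ≅ sheafDual X ⋙ RΓ X :=
  Functor.isoWhiskerRight (dualityIso X) ((evaluation _ _).obj (single ZZ))

end

end SheafDuality

/-! ### Morphisms to an object placed in a single degree -/

namespace CochainComplex

open HomComplex HomologicalComplex

variable {C : Type u} [Category.{v} C] [Abelian C]

/-- A morphism to an object `G` in degree `m` is given by a morphism `g` from the opcycles to `G`, whose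
restriction to the homology is the induced morphism. -/
lemma homologyMap_toSingle {L : CochainComplex C ℤ} {m : ℤ} {G : C}
    (f : L ⟶ (single C (.up ℤ) m).obj G) (g : L.opcycles m ⟶ G)
    (h : L.pOpcycles m ≫ g = f.f m ≫ (singleObjXSelf (.up ℤ) m G).hom) :
    homologyMap f m ≫ (singleObjHomologySelfIso (.up ℤ) m G).hom = L.homologyι m ≫ g := by
  have h₁ : opcyclesMap f m ≫ (singleObjOpcyclesSelfIso (.up ℤ) m G).inv = g := by
    rw [← cancel_epi (L.pOpcycles m), h]
    simp
  rw [← h₁, ← homologyι_naturality_assoc, homologyι_singleObjOpcyclesSelfIso_inv]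

/-- A morphism from the homology to an injective object extends to the opcycles. -/
lemma exists_toSingle {L : CochainComplex C ℤ} {m : ℤ} {J : C} [Injective J]
    (φ : L.homology m ⟶ J) : ∃ f : L ⟶ (single C (.up ℤ) m).obj J,
      homologyMap f m ≫ (singleObjHomologySelfIso (.up ℤ) m J).hom = φ := by
  let g : L.opcycles m ⟶ J := Injective.factorThru φ (L.homologyι m)
  let f : L ⟶ (single C (.up ℤ) m).obj J := mkHomToSingle (L.pOpcycles m ≫ g) (by simp)
  exact ⟨f, (homologyMap_toSingle f g (by simp [f])).trans (Injective.comp_factorThru _ _)⟩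

/-- A morphism to an injective object, in a single degree, is homotopic to zero if it vanishes in
homology. -/
lemma nonempty_homotopy_zero_toSingle {L : CochainComplex C ℤ} {m : ℤ} {J : C} [Injective J]
    (f : L ⟶ (single C (.up ℤ) m).obj J) (hf : homologyMap f m = 0) :
    Nonempty (Homotopy f 0) := by
  let g : L.opcycles m ⟶ J := L.descOpcycles (f.f m ≫ (singleObjXSelf (.up ℤ) m J).hom) (m - 1)
    (by simp) (by rw [← f.comm_assoc, single_obj_d, zero_comp, comp_zero])
  have hg : L.homologyι m ≫ g = 0 := by
    rw [← homologyMap_toSingle f g (L.p_descOpcycles _ _ _ _), hf, zero_comp]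
  have hex : (ShortComplex.mk _ _ (L.homologyι_comp_fromOpcycles m (m + 1))).Exact :=
    ShortComplex.exact_of_f_is_kernel _ (L.homologyIsKernel m (m + 1) (by simp))
  let h := hex.descToInjective g hg
  have hh : L.fromOpcycles m (m + 1) ≫ h = g := hex.comp_descToInjective g hg
  have hf' : f.f m = L.d m (m + 1) ≫ h ≫ (singleObjXSelf (.up ℤ) m J).inv := by
    rw [← L.p_fromOpcycles m (m + 1), Category.assoc, reassoc_of% hh, p_descOpcycles_assoc,
      Category.assoc, Iso.hom_inv_id, Category.comp_id]
  refine ⟨(Cochain.equivHomotopy _ _).symm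
    ⟨Cochain.single (h ≫ (singleObjXSelf (.up ℤ) m J).inv) (-1), ?_⟩⟩
  rw [Cochain.δ_single _ (-1) 0 (by simp) m (m + 1) rfl rfl]
  refine Cochain.ext _ _ (fun p q hpq => ?_)
  obtain rfl : p = q := by omega
  by_cases hp : p = m
  · subst hp
    simp [hf']
  · exact (isZero_single_obj_X (.up ℤ) m J p hp).eq_of_tgt _ _

end CochainComplex

namespace DerivedCategory

open Opposite Pretriangulated

section

variable {C : Type u} [Category.{v} C] [Abelian C] [HasDerivedCategory.{w} C]

/-- The morphism on cohomology in degree `n` which is induced by a morphism to an object placed in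
degree `n`. -/
noncomputable def homologyToSingle (n : ℤ) (K : DerivedCategory C) (G : C) :
    (K ⟶ (singleFunctor C n).obj G) →+ ((homologyFunctor C n).obj K ⟶ G) where
  toFun f := (homologyFunctor C n).map f ≫ (singleFunctorCompHomologyFunctorIso C n).hom.app G
  map_zero' := by rw [Functor.map_zero, zero_comp]
  map_add' f g := by rw [Functor.map_add, Preadditive.add_comp]

lemma homologyToSingle_apply (n : ℤ) {K : DerivedCategory C} {G : C}
    (f : K ⟶ (singleFunctor C n).obj G) : homologyToSingle n K G f =
      (homologyFunctor C n).map f ≫ (singleFunctorCompHomologyFunctorIso C n).hom.app G := rfl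

lemma homologyToSingle_precomp (n : ℤ) {K K' : DerivedCategory C} {G : C} (k : K' ⟶ K)
    (f : K ⟶ (singleFunctor C n).obj G) :
    homologyToSingle n K' G (k ≫ f) =
      (homologyFunctor C n).map k ≫ homologyToSingle n K G f := by
  rw [homologyToSingle_apply, homologyToSingle_apply, Functor.map_comp, Category.assoc]

lemma homologyToSingle_postcomp (n : ℤ) {K : DerivedCategory C} {G G' : C}
    (f : K ⟶ (singleFunctor C n).obj G) (g : G ⟶ G') :
    homologyToSingle n K G' (f ≫ (singleFunctor C n).map g) =
      homologyToSingle n K G f ≫ g := by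
  rw [homologyToSingle_apply, homologyToSingle_apply, Functor.map_comp, Category.assoc,
    Category.assoc]
  exact congrArg (_ ≫ ·) ((singleFunctorCompHomologyFunctorIso C n).hom.naturality g)

lemma homologyToSingle_Q_map (n : ℤ) {L : CochainComplex C ℤ} {G : C}
    (f : L ⟶ (HomologicalComplex.single C (.up ℤ) n).obj G) :
    homologyToSingle n (Q.obj L) G (Q.map f) = (homologyFunctorFactors C n).hom.app L ≫
      HomologicalComplex.homologyMap f n ≫
        (HomologicalComplex.singleObjHomologySelfIso (.up ℤ) n G).hom := by
  have h₁ : (singleFunctorCompHomologyFunctorIso C n).hom.app G = (homologyFunctorFactors C n).hom.app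
      ((HomologicalComplex.single C (.up ℤ) n).obj G) ≫
        (HomologicalComplex.singleObjHomologySelfIso (.up ℤ) n G).hom := by
    have h₂ : (homologyFunctor C n).map (((singleFunctorsPostcompQIso C).hom.hom n).app G) =
        𝟙 _ := by
      rw [singleFunctorsPostcompQIso_hom_hom]
      exact (homologyFunctor C n).map_id _
    exact (congrArg₂ (· ≫ ·) h₂ (Category.id_comp _)).trans (Category.id_comp _)
  refine (congrArg (_ ≫ ·) h₁).trans ?_
  refine (Category.assoc _ _ _).symm.trans ?_
  exact (congrArg (· ≫ _) ((homologyFunctorFactors C n).hom.naturality f)).trans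
    (Category.assoc _ _ _)

instance (n : ℤ) (J : C) [Injective J] :
    CochainComplex.IsKInjective ((HomologicalComplex.single C (.up ℤ) n).obj J) := by
  have (i : ℤ) : Injective (((HomologicalComplex.single C (.up ℤ) n).obj J).X i) := by
    by_cases hi : i = n
    · subst hi
      exact Injective.of_iso (HomologicalComplex.singleObjXSelf (.up ℤ) i J).symm inferInstance
    · exact Injective.of_iso (HomologicalComplex.isZero_single_obj_X (.up ℤ) n J i hi).isoZero.symm
        inferInstance
  exact CochainComplex.isKInjective_of_injective _ n

/-- An injective object in degree `n` represents the dual of the cohomology in degree `n`. -/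
lemma homologyToSingle_bijective (n : ℤ) (K : DerivedCategory C) (J : C) [Injective J] :
    Function.Bijective (homologyToSingle n K J) := by
  suffices ∀ L : CochainComplex C ℤ, Function.Bijective (homologyToSingle n (Q.obj L) J) by
    let e := Q.objObjPreimageIso K
    refine ⟨fun x y h => ?_, fun φ => ?_⟩
    · rw [← cancel_epi e.hom]
      refine (this _).1 ?_
      rw [homologyToSingle_precomp, homologyToSingle_precomp, h]
    · obtain ⟨x, hx⟩ := (this _).2 ((homologyFunctor C n).map e.hom ≫ φ)
      refine ⟨e.inv ≫ x, ?_⟩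
      rw [homologyToSingle_precomp, hx, ← Functor.map_comp_assoc, e.inv_hom_id,
        CategoryTheory.Functor.map_id, Category.id_comp]
  intro L
  have hQ := CochainComplex.IsKInjective.Qh_map_bijective
    ((HomotopyCategory.quotient C (.up ℤ)).obj L)
    ((HomologicalComplex.single C (.up ℤ) n).obj J)
  refine ⟨(injective_iff_map_eq_zero _).2 (fun f hf => ?_), fun φ => ?_⟩
  · obtain ⟨f, rfl⟩ := hQ.2 f
    obtain ⟨f, rfl⟩ := (HomotopyCategory.quotient C (.up ℤ)).map_surjective f
    have h := (homologyToSingle_Q_map n f).symm.trans hf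
    replace h := (Preadditive.IsIso.comp_left_eq_zero _ _).1 h
    replace h := (Preadditive.IsIso.comp_right_eq_zero _ _).1 h
    obtain ⟨h⟩ := CochainComplex.nonempty_homotopy_zero_toSingle f h
    exact (DerivedCategory.Q_map_eq_of_homotopy C h).trans (Q.map_zero _ _)
  · obtain ⟨f, hf⟩ := CochainComplex.exists_toSingle
      ((homologyFunctorFactors C n).inv.app L ≫ φ)
    refine ⟨Q.map f, (homologyToSingle_Q_map n f).trans ((congrArg (_ ≫ ·) hf).trans ?_)⟩
    exact (homologyFunctorFactors C n).hom_inv_id_app_assoc L φ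

lemma isZero_homology_single {n m : ℤ} (h : n ≠ m) (G : C) :
    IsZero ((homologyFunctor C n).obj ((singleFunctor C m).obj G)) :=
  (HomologicalComplex.isZero_single_obj_homology (.up ℤ) m G n h).of_iso
    ((homologyFunctorFactors C n).app ((HomologicalComplex.single C (.up ℤ) m).obj G))

section

variable {S : ShortComplex C} (hS : S.ShortExact)

/-- The connecting morphism in the derived category of a short exact sequence of objects placed
in degree `m`. -/
noncomputable def singleConnecting (n m : ℤ) (h : n + 1 = m) :
    (singleFunctor C m).obj S.X₃ ⟶ (singleFunctor C n).obj S.X₁ :=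
  triangleOfSESδ (hS.map_of_exact (HomologicalComplex.single C (.up ℤ) m)) ≫
    ((singleFunctors C).shiftIso 1 n m (by omega)).hom.app S.X₁

lemma distinguished_single (m : ℤ) :
    Triangle.mk ((singleFunctor C m).map S.f) ((singleFunctor C m).map S.g)
      (triangleOfSESδ (hS.map_of_exact (HomologicalComplex.single C (.up ℤ) m)) :
        (singleFunctor C m).obj S.X₃ ⟶ ((singleFunctor C m).obj S.X₁)⟦(1 : ℤ)⟧) ∈
          distTriang (DerivedCategory C) :=
  triangleOfSES_distinguished (hS.map_of_exact (HomologicalComplex.single C (.up ℤ) m))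

lemma single_map_comp_singleConnecting (n m : ℤ) (h : n + 1 = m) :
    (singleFunctor C m).map S.g ≫ singleConnecting hS n m h = 0 := by
  rw [singleConnecting]
  refine (Category.assoc _ _ _).symm.trans ?_
  refine (congrArg (· ≫ _) (comp_distTriang_mor_zero₂₃ _ (distinguished_single hS m))).trans
    zero_comp

lemma exact_singleConnecting₃ (n m : ℤ) (h : n + 1 = m) {K : DerivedCategory C}
    (t : K ⟶ (singleFunctor C m).obj S.X₃) (ht : t ≫ singleConnecting hS n m h = 0) :
    ∃ u : K ⟶ (singleFunctor C m).obj S.X₂, t = u ≫ (singleFunctor C m).map S.g := by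
  refine Triangle.coyoneda_exact₃ _ (distinguished_single hS m) t ?_
  refine (cancel_mono (((singleFunctors C).shiftIso 1 n m (by omega)).hom.app S.X₁)).1 ?_
  exact (Category.assoc _ _ _).trans (ht.trans zero_comp.symm)

lemma exact_singleConnecting₁ (n m : ℤ) (h : n + 1 = m) {K : DerivedCategory C}
    (t : K ⟶ (singleFunctor C n).obj S.X₁) (ht : t ≫ (singleFunctor C n).map S.f = 0) :
    ∃ u : K ⟶ (singleFunctor C m).obj S.X₃, t = u ≫ singleConnecting hS n m h := by
  let e := (singleFunctors C).shiftIso 1 n m (by omega)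
  obtain ⟨u, hu⟩ := Triangle.coyoneda_exact₁ _ (distinguished_single hS m) (t ≫ e.inv.app S.X₁) (by
    refine (Category.assoc _ _ _).trans ?_
    refine (congrArg (t ≫ ·) (e.inv.naturality S.f).symm).trans ?_
    exact (Category.assoc _ _ _).symm.trans ((congrArg (· ≫ _) ht).trans zero_comp))
  refine ⟨u, ((Iso.comp_inv_eq (e.app S.X₁)).1 hu).trans (Category.assoc _ _ _)⟩

lemma exact_single₂ {S : ShortComplex C} (hS : S.ShortExact) (n : ℤ) {K : DerivedCategory C}
    (t : K ⟶ (singleFunctor C n).obj S.X₂) (ht : t ≫ (singleFunctor C n).map S.g = 0) :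
    ∃ u : K ⟶ (singleFunctor C n).obj S.X₁, t = u ≫ (singleFunctor C n).map S.f :=
  Triangle.coyoneda_exact₂ _ (distinguished_single hS n) t ht

end

end

end DerivedCategory

/-! ### Injective resolutions of length one -/

namespace DerivedCategory

open Opposite Pretriangulated Abelian

section

variable {C : Type u} [Category.{v} C] [Abelian C] [HasDerivedCategory.{w} C] [HasExt.{w'} C]
  {S : ShortComplex C} (hS : S.ShortExact)

/-- The connecting homomorphism `Hom(A, X₃) → Ext¹(A, X₁)` of a short exact sequence. -/
noncomputable def extConnecting (A : C) : (A ⟶ S.X₃) →+ Ext A S.X₁ 1 where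
  toFun f := (Ext.mk₀ f).comp hS.extClass (zero_add 1)
  map_zero' := by simp
  map_add' f g := by rw [Ext.mk₀_add, Ext.add_comp]

lemma extConnecting_apply {A : C} (f : A ⟶ S.X₃) :
    extConnecting hS A f = (Ext.mk₀ f).comp hS.extClass (zero_add 1) := rfl

lemma extConnecting_comp {A A' : C} (a : A' ⟶ A) (f : A ⟶ S.X₃) :
    extConnecting hS A' (a ≫ f) =
      (Ext.mk₀ a).comp (extConnecting hS A f) (zero_add 1) := by
  rw [extConnecting_apply, extConnecting_apply, ← Ext.mk₀_comp_mk₀, Ext.comp_assoc_of_second_deg_zero]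

lemma extConnecting_surjective [Injective S.X₂] (A : C) :
    Function.Surjective (extConnecting hS A) := by
  intro e
  obtain ⟨f, hf⟩ := Ext.covariant_sequence_exact₁ A hS e (Ext.eq_zero_of_injective _) (zero_add 1)
  obtain ⟨f, rfl⟩ := Ext.addEquiv₀.symm.surjective f
  exact ⟨f, hf⟩

lemma extConnecting_eq_zero_iff {A : C} (f : A ⟶ S.X₃) :
    extConnecting hS A f = 0 ↔ ∃ g : A ⟶ S.X₂, g ≫ S.g = f := by
  refine ⟨fun h => ?_, ?_⟩
  · obtain ⟨g, hg⟩ := Ext.covariant_sequence_exact₃ A hS (Ext.mk₀ f) (zero_add 1) h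
    obtain ⟨g, rfl⟩ := Ext.addEquiv₀.symm.surjective g
    exact ⟨g, Ext.addEquiv₀.symm.injective ((Ext.mk₀_comp_mk₀ _ _).symm.trans hg)⟩
  · rintro ⟨g, rfl⟩
    rw [extConnecting_comp, extConnecting_apply, hS.comp_extClass, Ext.comp_zero]

variable [Injective S.X₂] [Injective S.X₃]

/-- The morphisms to an injective object in degree `m` are the morphisms on cohomology. -/
noncomputable def homologyToSingleEquiv (m : ℤ) (K : DerivedCategory C) (J : C) [Injective J] :
    (K ⟶ (singleFunctor C m).obj J) ≃+ ((homologyFunctor C m).obj K ⟶ J) :=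
  AddEquiv.ofBijective (homologyToSingle m K J) (homologyToSingle_bijective m K J)

lemma homologyToSingleEquiv_symm_precomp (m : ℤ) {K K' : DerivedCategory C} {J : C} [Injective J]
    (k : K' ⟶ K) (f : (homologyFunctor C m).obj K ⟶ J) :
    (homologyToSingleEquiv m K' J).symm ((homologyFunctor C m).map k ≫ f) =
      k ≫ (homologyToSingleEquiv m K J).symm f := by
  refine (homologyToSingleEquiv m K' J).injective ?_
  rw [AddEquiv.apply_symm_apply]
  refine ((homologyToSingle_precomp m k _).trans ?_).symm
  exact congrArg (_ ≫ ·) ((homologyToSingleEquiv m K J).apply_symm_apply f)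

/-- A morphism on cohomology in degree `m` with values in `X₃` gives a morphism to `X₁` placed in
degree `m - 1`. -/
noncomputable def homologyConnecting (n m : ℤ) (h : n + 1 = m) (K : DerivedCategory C) :
    ((homologyFunctor C m).obj K ⟶ S.X₃) →+ (K ⟶ (singleFunctor C n).obj S.X₁) :=
  (Preadditive.rightComp K (singleConnecting hS n m h)).comp
    (homologyToSingleEquiv m K S.X₃).symm.toAddMonoidHom

lemma homologyConnecting_apply (n m : ℤ) (h : n + 1 = m) {K : DerivedCategory C}
    (f : (homologyFunctor C m).obj K ⟶ S.X₃) :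
    homologyConnecting hS n m h K f =
      (homologyToSingleEquiv m K S.X₃).symm f ≫ singleConnecting hS n m h := rfl

lemma homologyConnecting_eq_zero_iff (n m : ℤ) (h : n + 1 = m) {K : DerivedCategory C}
    (f : (homologyFunctor C m).obj K ⟶ S.X₃) :
    homologyConnecting hS n m h K f = 0 ↔ ∃ g, g ≫ S.g = f := by
  refine ⟨fun hf => ?_, ?_⟩
  · obtain ⟨u, hu⟩ := exact_singleConnecting₃ hS n m h _ hf
    refine ⟨homologyToSingle m K S.X₂ u, ?_⟩
    rw [← homologyToSingle_postcomp, ← hu]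
    exact (homologyToSingleEquiv m K S.X₃).apply_symm_apply f
  · rintro ⟨g, rfl⟩
    obtain ⟨g, rfl⟩ := (homologyToSingle_bijective m K S.X₂).2 g
    have : (homologyToSingleEquiv m K S.X₃).symm (homologyToSingle m K S.X₂ g ≫ S.g) =
        g ≫ (singleFunctor C m).map S.g :=
      (homologyToSingleEquiv m K S.X₃).injective (((homologyToSingleEquiv m K S.X₃).apply_symm_apply
        _).trans (homologyToSingle_postcomp m g S.g).symm)
    rw [homologyConnecting_apply, this, Category.assoc, single_map_comp_singleConnecting, comp_zero]

/-- Given an injective resolution of length one of `X₁`, an extension of the cohomology in degree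
`m` by `X₁` gives a morphism to `X₁` placed in degree `m - 1`. -/
noncomputable def extToSingle (n m : ℤ) (h : n + 1 = m) (K : DerivedCategory C) :
    Ext ((homologyFunctor C m).obj K) S.X₁ 1 →+ (K ⟶ (singleFunctor C n).obj S.X₁) :=
  (extConnecting hS _).liftOfSurjective (extConnecting_surjective hS _)
    ⟨homologyConnecting hS n m h K, fun f hf => (homologyConnecting_eq_zero_iff hS n m h f).2
      ((extConnecting_eq_zero_iff hS f).1 hf)⟩

lemma extToSingle_extConnecting (n m : ℤ) (h : n + 1 = m) {K : DerivedCategory C}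
    (f : (homologyFunctor C m).obj K ⟶ S.X₃) :
    extToSingle hS n m h K (extConnecting hS _ f) = homologyConnecting hS n m h K f :=
  AddMonoidHom.liftOfRightInverse_comp_apply _ _ _ _ f

lemma extToSingle_precomp (n m : ℤ) (h : n + 1 = m) {K K' : DerivedCategory C} (k : K' ⟶ K)
    (e : Ext ((homologyFunctor C m).obj K) S.X₁ 1) :
    extToSingle hS n m h K' ((Ext.mk₀ ((homologyFunctor C m).map k)).comp e (zero_add 1)) =
      k ≫ extToSingle hS n m h K e := by
  obtain ⟨f, rfl⟩ := extConnecting_surjective hS _ e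
  rw [← extConnecting_comp, extToSingle_extConnecting, extToSingle_extConnecting,
    homologyConnecting_apply, homologyConnecting_apply, homologyToSingleEquiv_symm_precomp,
    Category.assoc]

lemma extToSingle_injective (n m : ℤ) (h : n + 1 = m) (K : DerivedCategory C) :
    Function.Injective (extToSingle hS n m h K) := by
  refine (injective_iff_map_eq_zero _).2 (fun e he => ?_)
  obtain ⟨f, rfl⟩ := extConnecting_surjective hS _ e
  rw [extToSingle_extConnecting] at he
  exact (extConnecting_eq_zero_iff hS f).2 ((homologyConnecting_eq_zero_iff hS n m h f).1 he)

lemma homologyToSingle_extToSingle (n m : ℤ) (h : n + 1 = m) {K : DerivedCategory C}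
    (e : Ext ((homologyFunctor C m).obj K) S.X₁ 1) :
    homologyToSingle n K S.X₁ (extToSingle hS n m h K e) = 0 := by
  obtain ⟨f, rfl⟩ := extConnecting_surjective hS _ e
  rw [extToSingle_extConnecting, homologyConnecting_apply, homologyToSingle_precomp,
    (isZero_homology_single (by omega) S.X₃ : IsZero ((homologyFunctor C n).obj
      ((singleFunctor C m).obj S.X₃))).eq_of_src (homologyToSingle n _ _ _) 0, comp_zero]

lemma exists_extToSingle (n m : ℤ) (h : n + 1 = m) {K : DerivedCategory C}
    (t : K ⟶ (singleFunctor C n).obj S.X₁) (ht : homologyToSingle n K S.X₁ t = 0) :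
    ∃ e, extToSingle hS n m h K e = t := by
  obtain ⟨u, rfl⟩ := exact_singleConnecting₁ hS n m h t ((homologyToSingle_bijective n K S.X₂).1 (by
    rw [homologyToSingle_postcomp, ht, zero_comp, map_zero]))
  refine ⟨extConnecting hS _ (homologyToSingle m K S.X₃ u), ?_⟩
  rw [extToSingle_extConnecting, homologyConnecting_apply]
  exact congrArg (· ≫ _) ((homologyToSingleEquiv m K S.X₃).symm_apply_apply u)

/-- A morphism on cohomology with values in `X₁` lifts to a morphism to `X₂` placed in degree `n`,
which comes from `X₁` because its image in `X₃` vanishes on cohomology. -/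
lemma homologyToSingle_surjective {S : ShortComplex C} (hS : S.ShortExact) [Injective S.X₂]
    [Injective S.X₃] (n : ℤ) (K : DerivedCategory C) :
    Function.Surjective (homologyToSingle n K S.X₁) := by
  intro φ
  obtain ⟨u, hu⟩ := (homologyToSingle_bijective n K S.X₂).2 (φ ≫ S.f)
  obtain ⟨t, rfl⟩ := exact_single₂ hS n u ((homologyToSingle_bijective n K S.X₃).1 (by
    rw [homologyToSingle_postcomp, hu, Category.assoc, S.zero, comp_zero, map_zero]))
  have := hS.mono_f
  refine ⟨t, ?_⟩
  rw [← cancel_mono S.f, ← hu, homologyToSingle_postcomp]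

end

end DerivedCategory

namespace SheafDuality

/-- The injective resolution of length one of an abelian group. -/
noncomputable def injShortComplex (G : AddCommGrpCat.{u}) : ShortComplex AddCommGrpCat.{u} :=
  ShortComplex.mk (Injective.ι G) (cokernel.π (Injective.ι G)) (cokernel.condition _)

lemma injShortComplex_shortExact (G : AddCommGrpCat.{u}) : (injShortComplex G).ShortExact where
  exact := ShortComplex.exact_cokernel _
  mono_f := inferInstanceAs (Mono (Injective.ι G))
  epi_g := inferInstanceAs (Epi (cokernel.π (Injective.ι G)))

instance (G : AddCommGrpCat.{u}) : Injective (injShortComplex G).X₂ :=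
  inferInstanceAs (Injective (Injective.under G))

lemma smul_surjective_of_injective (J : AddCommGrpCat.{u}) [Injective J] {n : ℤ} (hn : n ≠ 0) :
    Function.Surjective (fun x : J => n • x) := by
  intro x
  have : Mono (n • 𝟙 ZZ.{u}) := by
    rw [AddCommGrpCat.mono_iff_injective]
    rintro ⟨a⟩ ⟨b⟩ h
    have h' : n * a = n * b := congrArg ULift.down h
    exact congrArg ULift.up (mul_left_cancel₀ hn h')
  refine ⟨(Injective.factorThru (ofElement x) (n • 𝟙 ZZ)).hom ⟨1⟩, ?_⟩
  have h := ConcreteCategory.congr_hom (Injective.comp_factorThru (ofElement x) (n • 𝟙 ZZ)) ⟨1⟩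
  rw [Preadditive.zsmul_comp, Category.id_comp] at h
  exact h.trans (ofElement_one x)

/-- Quotients of divisible groups are divisible. -/
lemma injective_of_epi {J J' : AddCommGrpCat.{u}} [Injective J] (p : J ⟶ J') [Epi p] :
    Injective J' := by
  let _ : DivisibleBy J ℤ := divisibleByOfSMulRightSurj J ℤ
    (fun hn => smul_surjective_of_injective J hn)
  let _ : DivisibleBy J' ℤ := Function.Surjective.divisibleBy p.hom
    ((AddCommGrpCat.epi_iff_surjective p).1 inferInstance) (fun x n => map_zsmul p.hom n x)
  exact AddCommGrpCat.injective_of_divisible J'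

instance (G : AddCommGrpCat.{u}) : Injective (injShortComplex G).X₃ :=
  have := (injShortComplex_shortExact G).epi_g
  injective_of_epi (injShortComplex G).g

end SheafDuality

/-! ### The universal coefficient sequence -/

namespace SheafDuality

open Opposite DerivedCategory Abelian

section

variable [HasDerivedCategory.{w} AddCommGrpCat.{u}]

/-- The cohomology in degree `i` of the derived complex of homomorphisms to a group `G` consists of
the morphisms to `G` placed in degree `-i`. -/
noncomputable def homologyDualEquiv (i n : ℤ) (h : i + n = 0)
    (K : DerivedCategory AddCommGrpCat.{u}) (G : AddCommGrpCat.{u}) :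
    (homologyFunctor AddCommGrpCat.{u} i).obj ((RHom.obj (op K)).obj (single G)) ≃+
      (K ⟶ (singleFunctor AddCommGrpCat.{u} n).obj G) :=
  AddEquiv.ofBijective
    ((Preadditive.rightComp K (((singleFunctors AddCommGrpCat.{u}).shiftIso i n 0 h).hom.app G)).comp
      (homologyDerivedHom K (single G) i))
    ((((singleFunctors AddCommGrpCat.{u}).shiftIso i n 0 h).app G).homToEquiv.bijective.comp
      (homologyDerivedHom_bijective K (single G) i))

lemma homologyDualEquiv_naturality (i n : ℤ) (h : i + n = 0)
    {K K' : DerivedCategory AddCommGrpCat.{u}} (k : K' ⟶ K) (G : AddCommGrpCat.{u})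
    (x : (homologyFunctor AddCommGrpCat.{u} i).obj ((RHom.obj (op K)).obj (single G))) :
    homologyDualEquiv i n h K' G
        (((homologyFunctor _ i).map ((RHom.map k.op).app (single G))).hom x) =
      k ≫ homologyDualEquiv i n h K G x := by
  have h₁ := homologyDerivedHom_map k (𝟙 (single G)) i x
  rw [CategoryTheory.Functor.map_id, CategoryTheory.Functor.map_id, Category.comp_id,
    Category.comp_id] at h₁
  exact (congrArg (· ≫ _) h₁).trans (Category.assoc _ _ _)

variable (i n m : ℤ) (hin : i + n = 0) (hnm : n + 1 = m) (G : AddCommGrpCat.{u})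

/-- The monomorphism in the universal coefficient sequence. -/
noncomputable def extToHomologyDual :
    (homologyFunctor AddCommGrpCat.{u} m).op ⋙ (extFunctor 1).flip.obj G ⟶
      RHom.flip.obj (single G) ⋙ homologyFunctor AddCommGrpCat.{u} i where
  app K := AddCommGrpCat.ofHom
    ((homologyDualEquiv i n hin K.unop G).symm.toAddMonoidHom.comp
      (extToSingle (injShortComplex_shortExact G) n m hnm K.unop))
  naturality K K' k := by
    ext e
    refine (homologyDualEquiv i n hin K'.unop G).injective ?_
    refine ((homologyDualEquiv i n hin K'.unop G).apply_symm_apply _).trans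
      (Eq.trans ?_ (homologyDualEquiv_naturality i n hin k.unop G _).symm)
    refine (extToSingle_precomp (injShortComplex_shortExact G) n m hnm k.unop e).trans ?_
    exact congrArg (_ ≫ ·) ((homologyDualEquiv i n hin K.unop G).apply_symm_apply _).symm

/-- The epimorphism in the universal coefficient sequence. -/
noncomputable def homologyDualToHom :
    RHom.flip.obj (single G) ⋙ homologyFunctor AddCommGrpCat.{u} i ⟶
      (homologyFunctor AddCommGrpCat.{u} n).op ⋙ preadditiveYoneda.obj G where
  app K := AddCommGrpCat.ofHom
    ((homologyToSingle n K.unop G).comp (homologyDualEquiv i n hin K.unop G).toAddMonoidHom)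
  naturality K K' k := by
    ext x
    exact (congrArg (homologyToSingle n K'.unop G)
      (homologyDualEquiv_naturality i n hin k.unop G x)).trans
        (homologyToSingle_precomp n k.unop _)

lemma extToHomologyDual_comp_homologyDualToHom (K : (DerivedCategory AddCommGrpCat.{u})ᵒᵖ) :
    (extToHomologyDual i n m hin hnm G).app K ≫ (homologyDualToHom i n hin G).app K = 0 := by
  ext e
  exact (congrArg (homologyToSingle n K.unop G)
    ((homologyDualEquiv i n hin K.unop G).apply_symm_apply _)).trans
      (homologyToSingle_extToSingle (injShortComplex_shortExact G) n m hnm e)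

/-- The universal coefficient sequence. -/
noncomputable def universalCoefficients (K : (DerivedCategory AddCommGrpCat.{u})ᵒᵖ) :
    ShortComplex AddCommGrpCat.{u} :=
  ShortComplex.mk _ _ (extToHomologyDual_comp_homologyDualToHom i n m hin hnm G K)

lemma universalCoefficients_shortExact (K : (DerivedCategory AddCommGrpCat.{u})ᵒᵖ) :
    (universalCoefficients i n m hin hnm G K).ShortExact where
  exact := by
    rw [ShortComplex.ab_exact_iff]
    intro x hx
    obtain ⟨e, he⟩ := exists_extToSingle (injShortComplex_shortExact G) n m hnm
      (homologyDualEquiv i n hin K.unop G x) hx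
    exact ⟨e, (AddEquiv.symm_apply_eq _).2 he⟩
  mono_f := (AddCommGrpCat.mono_iff_injective _).2
    ((homologyDualEquiv i n hin K.unop G).symm.injective.comp
      (extToSingle_injective (injShortComplex_shortExact G) n m hnm K.unop))
  epi_g := (AddCommGrpCat.epi_iff_surjective _).2
    ((homologyToSingle_surjective (injShortComplex_shortExact G) n K.unop).comp
      (homologyDualEquiv i n hin K.unop G).surjective)

/-- A splitting is provided by a morphism from `K` to its cohomology in degree `n` which is the
identity on cohomology in degree `n`. -/
noncomputable def universalCoefficientsSplitting (K : (DerivedCategory AddCommGrpCat.{u})ᵒᵖ) :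
    (universalCoefficients i n m hin hnm G K).Splitting := by
  let H := (homologyFunctor AddCommGrpCat.{u} n).obj K.unop
  have h := homologyToSingle_surjective (injShortComplex_shortExact H) n K.unop (𝟙 H)
  let t : K.unop ⟶ (singleFunctor AddCommGrpCat.{u} n).obj H := h.choose
  have ht : homologyToSingle n K.unop H t = 𝟙 H := h.choose_spec
  let σ : (H ⟶ G) →+ (K.unop ⟶ (singleFunctor AddCommGrpCat.{u} n).obj G) :=
    { toFun φ := t ≫ (singleFunctor AddCommGrpCat.{u} n).map φ
      map_zero' := by rw [Functor.map_zero, comp_zero]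
      map_add' φ ψ := by rw [Functor.map_add, Preadditive.comp_add] }
  have := (universalCoefficients_shortExact i n m hin hnm G K).mono_f
  refine ShortComplex.Splitting.ofExactOfSection _
    (universalCoefficients_shortExact i n m hin hnm G K).exact
    (AddCommGrpCat.ofHom ((homologyDualEquiv i n hin K.unop G).symm.toAddMonoidHom.comp σ)) ?_ this
  ext φ
  refine (congrArg (homologyToSingle n K.unop G)
    ((homologyDualEquiv i n hin K.unop G).apply_symm_apply _)).trans ?_
  exact (homologyToSingle_postcomp n t φ).trans
    ((congrArg (· ≫ φ) ht).trans (Category.id_comp φ))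

end

section

variable (X : TopCat.{u}) [HasDerivedCategory.{v} (Sh X)] [HasDerivedCategory.{w} AddCommGrpCat.{u}]
  [(piInv X).IsRightAdjoint]

/-- The universal coefficient sequence of the homology complex, in which the middle term is identified
with the cohomology of the dual. -/
lemma exists_universalCoefficients (i : ℤ) :
    ∃ (α : (homology X (i - 1)).op ⋙ (Abelian.extFunctor 1).flip.obj ZZ ⟶
        sheafDual X ⋙ cohomology X i)
      (β : sheafDual X ⋙ cohomology X i ⟶ (homology X i).op ⋙ preadditiveYoneda.obj ZZ),
      ∀ F, ∃ h : α.app F ≫ β.app F = 0,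
        (ShortComplex.mk (α.app F) (β.app F) h).ShortExact ∧
          Nonempty (ShortComplex.mk (α.app F) (β.app F) h).Splitting := by
  let e : ((LL X).op ⋙ RHom.flip.obj (single ZZ)) ⋙ homologyFunctor AddCommGrpCat.{u} i ≅
      sheafDual X ⋙ cohomology X i :=
    Functor.isoWhiskerRight (dualIso X) (homologyFunctor AddCommGrpCat.{u} i)
  let α := extToHomologyDual i (-i) (-(i - 1)) (by omega) (by omega) ZZ
  let β := homologyDualToHom i (-i) (by omega) ZZ
  refine ⟨Functor.whiskerLeft (LL X).op α ≫ e.hom, e.inv ≫ Functor.whiskerLeft (LL X).op β,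
    fun F => ?_⟩
  let a := α.app ((LL X).op.obj F)
  let b := β.app ((LL X).op.obj F)
  have hab : a ≫ b = 0 := extToHomologyDual_comp_homologyDualToHom i (-i) (-(i - 1)) _ _ ZZ _
  have h : (a ≫ e.hom.app F) ≫ (e.inv.app F ≫ b) = 0 := by
    rw [Category.assoc, e.hom_inv_id_app_assoc, hab]
  let e' : universalCoefficients i (-i) (-(i - 1)) (by omega) (by omega) ZZ ((LL X).op.obj F) ≅
      ShortComplex.mk (a ≫ e.hom.app F) (e.inv.app F ≫ b) h :=
    ShortComplex.isoMk (Iso.refl _) (e.app F) (Iso.refl _) (Category.id_comp _)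
      ((e.hom_inv_id_app_assoc F b).trans (Category.comp_id b).symm)
  exact ⟨h, ShortComplex.shortExact_of_iso e' (universalCoefficients_shortExact ..),
    ⟨(universalCoefficientsSplitting i (-i) (-(i - 1)) _ _ ZZ _).ofIso e'⟩⟩

end

end SheafDuality

/-! ### Cohomological triviality -/

namespace SheafDuality

open Opposite TopologicalSpace DerivedCategory Abelian

/-- Liftings along `P (S p)` of morphisms from `P (S Z)` are obtained from liftings along `Φ p` of
morphisms from `Φ Z`, when `P ∘ S` is isomorphic to `S' ∘ Φ` with `S'` full. -/
lemma exists_lift_of_iso {C C' D D' : Type*} [Category* C] [Category* C'] [Category* D]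
    [Category* D'] {S : C ⥤ D} {S' : C' ⥤ D'} {P : D ⥤ D'} {Φ : C ⥤ C'} [S'.Full]
    (e : S ⋙ P ≅ Φ ⋙ S') {Z A B : C} (p : A ⟶ B)
    (h : ∀ φ : Φ.obj Z ⟶ Φ.obj B, ∃ ψ, ψ ≫ Φ.map p = φ)
    (f : P.obj (S.obj Z) ⟶ P.obj (S.obj B)) : ∃ g, g ≫ P.map (S.map p) = f := by
  obtain ⟨φ, hφ⟩ := S'.map_surjective (e.inv.app Z ≫ f ≫ e.hom.app B)
  obtain ⟨ψ, rfl⟩ := h φ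
  refine ⟨e.hom.app Z ≫ S'.map ψ ≫ e.inv.app A, ?_⟩
  have he : e.inv.app A ≫ P.map (S.map p) = S'.map (Φ.map p) ≫ e.inv.app B :=
    (e.inv.naturality p).symm
  have he' : e.hom.app Z ≫ e.inv.app Z = 𝟙 (P.obj (S.obj Z)) := e.hom_inv_id_app Z
  have he'' : e.hom.app B ≫ e.inv.app B = 𝟙 (P.obj (S.obj B)) := e.hom_inv_id_app B
  rw [Functor.map_comp] at hφ
  simp only [Category.assoc, he, reassoc_of% hφ, he'', Category.comp_id, reassoc_of% he']

section

variable (X : TopCat.{u})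

/-- A set-theoretic section of an epimorphism of groups induces a section of the corresponding
morphism of constant sheaves of sets. -/
lemma epi_globalSections_map_constantSheaf_map {A B : AddCommGrpCat.{u}} (p : A ⟶ B) [Epi p] :
    Epi ((globalSections X).map ((constantSheaf (Opens.grothendieckTopology X)
      AddCommGrpCat.{u}).map p)) := by
  let J := Opens.grothendieckTopology X
  let U := forget AddCommGrpCat.{u}
  let e := constantCommuteCompose J U
  have h₁ : IsSplitEpi (U.map p) :=
    have := (epi_iff_surjective (U.map p)).2 ((AddCommGrpCat.epi_iff_surjective p).1 inferInstance)
    isSplitEpi_of_epi _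
  have h₂ : (constantSheaf J _ ⋙ sheafCompose J U).map p =
      e.hom.app A ≫ (constantSheaf J (Type u)).map (U.map p) ≫ e.inv.app B :=
    (NatIso.naturality_2 e p).symm
  have h₃ : IsSplitEpi ((constantSheaf J _ ⋙ sheafCompose J U).map p) := by
    rw [h₂]
    infer_instance
  have h₄ : Epi (((sheafSections J (Type u)).obj (op ⊤)).map
    ((constantSheaf J _ ⋙ sheafCompose J U).map p)) := inferInstance
  exact (AddCommGrpCat.epi_iff_surjective _).2 ((epi_iff_surjective _).1 h₄)

lemma exists_constantSheaf_lift {A B : AddCommGrpCat.{u}} (p : A ⟶ B) [Epi p]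
    (φ : (constantSheaf (Opens.grothendieckTopology X) AddCommGrpCat.{u}).obj ZZ ⟶
      (constantSheaf (Opens.grothendieckTopology X) AddCommGrpCat.{u}).obj B) :
    ∃ ψ, ψ ≫ (constantSheaf (Opens.grothendieckTopology X) AddCommGrpCat.{u}).map p = φ := by
  have := epi_globalSections_map_constantSheaf_map X p
  refine ⟨((constAdj X).homEquiv _ _).symm (Projective.factorThru ((constAdj X).homEquiv _ _ φ)
    ((globalSections X).map ((constantSheaf _ AddCommGrpCat.{u}).map p))), ?_⟩
  rw [← (constAdj X).homEquiv_naturality_right_symm, Projective.factorThru_comp,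
    Equiv.symm_apply_apply]

variable [HasDerivedCategory.{v} (Sh X)] [HasDerivedCategory.{w} AddCommGrpCat.{u}]

lemma exists_piInv_lift {A B : AddCommGrpCat.{u}} (p : A ⟶ B) [Epi p]
    (f : (piInv X).obj (single ZZ) ⟶ (piInv X).obj (single B)) :
    ∃ g : (piInv X).obj (single ZZ) ⟶ (piInv X).obj (single A),
      g ≫ (piInv X).map ((singleFunctor AddCommGrpCat.{u} 0).map p) = f :=
  exists_lift_of_iso ((constantSheaf (Opens.grothendieckTopology X)
    AddCommGrpCat.{u}).mapDerivedCategorySingleFunctor 0) p (exists_constantSheaf_lift X p) f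

variable [(piInv X).IsRightAdjoint]

/-- The complex which computes the homology of `X`. -/
noncomputable abbrev chains : DerivedCategory AddCommGrpCat.{u} :=
  (LL X).obj ((piInv X).obj (single ZZ))

lemma exists_chains_lift {A B : AddCommGrpCat.{u}} (p : A ⟶ B) [Epi p]
    (f : chains X ⟶ (singleFunctor AddCommGrpCat.{u} 0).obj B) :
    ∃ g : chains X ⟶ (singleFunctor AddCommGrpCat.{u} 0).obj A,
      g ≫ (singleFunctor AddCommGrpCat.{u} 0).map p = f := by
  let adj : LL X ⊣ piInv X := Adjunction.ofIsRightAdjoint _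
  obtain ⟨g, hg⟩ := exists_piInv_lift X p (adj.homEquiv _ _ f)
  refine ⟨(adj.homEquiv _ _).symm g, ?_⟩
  rw [← adj.homEquiv_naturality_right_symm, hg, Equiv.symm_apply_apply]

/-- Morphisms from `H₀(X, ℤ)` to an injective group lift along epimorphisms, as they are global sections
of constant sheaves. -/
lemma exists_homology_chains_lift {A B : AddCommGrpCat.{u}} (p : A ⟶ B) [Epi p] [Injective B]
    (f : (homologyFunctor AddCommGrpCat.{u} 0).obj (chains X) ⟶ B) :
    ∃ g : (homologyFunctor AddCommGrpCat.{u} 0).obj (chains X) ⟶ A, g ≫ p = f := by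
  obtain ⟨u, rfl⟩ := (homologyToSingle_bijective 0 (chains X) B).2 f
  obtain ⟨t, rfl⟩ := exists_chains_lift X p u
  exact ⟨homologyToSingle 0 _ A t, (homologyToSingle_postcomp 0 t p).symm⟩

lemma isZero_cohomology_iff (i n : ℤ) (h : i + n = 0) (G : AddCommGrpCat.{u}) :
    IsZero ((cohomology X i).obj ((piInv X).obj (single G))) ↔
      Subsingleton (chains X ⟶ (singleFunctor AddCommGrpCat.{u} n).obj G) := by
  have e : (homologyFunctor AddCommGrpCat.{u} i).obj ((RHom.obj (op (chains X))).obj (single G)) ≅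
      (cohomology X i).obj ((piInv X).obj (single G)) :=
    (homologyFunctor AddCommGrpCat.{u} i).mapIso ((RHomConstIso X).app (single G))
  rw [← (homologyDualEquiv i n h (chains X) G).toEquiv.subsingleton_congr, ← e.isZero_iff]
  exact ⟨fun h => AddCommGrpCat.subsingleton_of_isZero h,
    fun _ => AddCommGrpCat.isZero_of_subsingleton _⟩

/-- If `H^i(X, -)` vanishes on `H_i(X, ℤ)`, then so does the quotient `Hom(H_i(X, ℤ), H_i(X, ℤ))`.
Conversely, `H^i(X, G)` consists of extensions of `H_{i-1}(X, ℤ)` by `G` when `H_i(X, ℤ)` is zero.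
For `i = 1`, these extensions are trivial because morphisms from `H₀(X, ℤ)` to a quotient of an
injective group lift to this group. -/
lemma isCohomologicallyTrivial_iff : IsCohomologicallyTrivial X ↔
    ∀ i : ℤ, 0 < i → IsZero ((homology X i).obj ((piInv X).obj (single ZZ))) := by
  refine ⟨fun hX i hi => ?_, fun hX i hi G => ?_⟩
  · let H := (homologyFunctor AddCommGrpCat.{u} (-i)).obj (chains X)
    have : Subsingleton (chains X ⟶ (singleFunctor AddCommGrpCat.{u} (-i)).obj
        (injShortComplex H).X₁) := (isZero_cohomology_iff X i (-i) (by omega) H).1 (hX i hi H)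
    obtain ⟨t, ht⟩ := homologyToSingle_surjective (injShortComplex_shortExact H) (-i) (chains X)
      (𝟙 H)
    refine (IsZero.iff_id_eq_zero H).2 ?_
    exact ht.symm.trans ((congrArg _ (Subsingleton.elim t 0)).trans (map_zero _))
  · rw [isZero_cohomology_iff X i (-i) (by omega) G]
    refine subsingleton_of_forall_eq 0 (fun f => ?_)
    obtain ⟨e, rfl⟩ := exists_extToSingle (injShortComplex_shortExact G) (-i) (-(i - 1)) (by omega)
      f (IsZero.eq_of_src (hX i hi) _ _)
    obtain ⟨f, rfl⟩ := extConnecting_surjective (injShortComplex_shortExact G) _ e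
    refine (congrArg _ ((extConnecting_eq_zero_iff (injShortComplex_shortExact G) f).2 ?_)).trans
      (map_zero _)
    obtain rfl | hi' : i = 1 ∨ 0 < i - 1 := by omega
    · have := (injShortComplex_shortExact G).epi_g
      exact exists_homology_chains_lift X (injShortComplex G).g f
    · exact ⟨0, IsZero.eq_of_src (hX (i - 1) hi') _ _⟩

end

end SheafDuality

theorem mainTheorem2 (X : TopCat.{u}) [HasDerivedCategory.{v} (Sh X)]
    [HasDerivedCategory.{w} AddCommGrpCat.{u}] [(piInv X).IsRightAdjoint] :
    Nonempty ((LL X).op ⋙ RHom ≅ RHHom X ⋙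
      (Functor.whiskeringLeft _ _ _).obj (piInv X) ⋙ (Functor.whiskeringRight _ _ _).obj (RΓ X)) ∧
    Nonempty (RHom.obj (Opposite.op ((LL X).obj ((piInv X).obj (single ZZ)))) ≅ piInv X ⋙ RΓ X) ∧
    Nonempty ((LL X).op ⋙ dual ≅ sheafDual X ⋙ RΓ X) ∧
    (∀ i : ℤ,
      ∃ (α : (homology X (i - 1)).op ⋙ (Abelian.extFunctor 1).flip.obj ZZ ⟶
          sheafDual X ⋙ cohomology X i)
        (β : sheafDual X ⋙ cohomology X i ⟶ (homology X i).op ⋙ preadditiveYoneda.obj ZZ),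
        ∀ F, ∃ h : α.app F ≫ β.app F = 0,
          (ShortComplex.mk (α.app F) (β.app F) h).ShortExact ∧
            Nonempty (ShortComplex.mk (α.app F) (β.app F) h).Splitting) ∧
    (IsCohomologicallyTrivial X ↔
      ∀ i : ℤ, 0 < i → IsZero ((homology X i).obj ((piInv X).obj (single ZZ)))) :=
  ⟨⟨dualityIso X⟩, ⟨RHomConstIso X⟩, ⟨dualIso X⟩, exists_universalCoefficients X,
    isCohomologicallyTrivial_iff X⟩
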